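/- Let $n\ge 3$. Realize the Weyl group $W$ of type $D_n$ as the group of signed permutations $w$ of $\{\pm1,\dots,\pm n\}$ ($w(-k)=-w(k)$) generated by $s_1=(1,-2)(-1,2)$ and $s_i=(i-1,i)(-(i-1),-i)$, $2\le i\le n$, written in one-line notation $w=(w(1),\dots,w(n))$. It acts on $\mathbb R^n=\bigoplus_k\mathbb R\varepsilon_k$ by $w(\varepsilon_k)=\varepsilon_{w(k)}$, $\varepsilon_{-k}=-\varepsilon_k$. The simple roots are $\alpha_1=\varepsilon_1+\varepsilon_2$, $\alpha_i=\varepsilon_i-\varepsilon_{i-1}$ $(2\le i\le n)$, with fundamental weights $\omega_1,\dots,\omega_n$; the positive roots are $R^+=\{\varepsilon_j\pm\varepsilon_i: 1\le i<j\le n\}$. Let $W^{I_r}=\{w\in W: w(\alpha_i)\in R^+ \text{ for all } i\ne r\}$, ordered by the Bruhat order of $W$. For $x\in\mathbb R^n$ write $x\ge0$ if $x$ is a linear combination of simple roots with nonnegative real coefficients, and $x\le 0$ if $-x\ge 0$. Call $w\in W^{I_r}$ *minimal* if it is a minimal element of $\{w\in W^{I_r}:w(\omega_r)\le0\}$, and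 $v\in W^{I_r}$ *maximal* if it is a maximal element of $\{v\in W^{I_r}:v(\omega_r)\ge0\}$. Let $J_{p,[a,b]}$ be the set of integer tuples $\underline i=(i_1,\dots,i_p)$ with $a\le i_k\le b$ and $i_{k+1}-i_k\ge2$. Put $[\underline i]=\{i_1,\dots,i_p\}$, $\underline i'=(i_1-1,\dots,i_p-1)$, $-\underline i=(-i_p,\dots,-i_1)$ and $s_{\underline i}=s_{i_1}s_{i_2}\cdots s_{i_p}$. Let $A_a(\underline i)$ be the elements of $\{a,a+1,\dots,n\}\setminus([\underline i]\cup[\underline i'])$ in increasing order, and let $A_a^-(\underline i)$ be the same list with its smallest element $t$ (the first entry) replaced by $-t$. (i) For $r=1$ there is exactly one minimal $w$, namely $$w=\begin{cases}(-n,-(n-2),\dots,-4,-2,1,3,5,\dots,n-3,n-1)& n\equiv0\ (4)\\(-n,-(n-2),\dots,-4,-2,-1,3,5,\dots,n-3,n-1)& n\equiv2\ (4)\\(-n,-(n-2),\dots,-5,-3,-2,-1,4,6,\dots,n-3,n-1)& n\equiv1\ (4)\\(-n,-(n-2),\dots,-5,-3,-2,1,4,6,\dots,n-3,n-1)& n\equiv3\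 (4).\end{cases}$$ (ii) For $r=2$ there is exactly one minimal $w$, namely $$w=\begin{cases}(n,-(n-2),\dots,-4,-2,-1,3,5,\dots,n-3,n-1)& n\equiv0\ (4)\\(n,-(n-2),\dots,-4,-2,1,3,5,\dots,n-3,n-1)& n\equiv2\ (4)\\(n,-(n-2),\dots,-5,-3,-2,1,4,6,\dots,n-3,n-1)& n\equiv1\ (4)\\(n,-(n-2),\dots,-5,-3,-2,-1,4,6,\dots,n-3,n-1)& n\equiv3\ (4).\end{cases}$$ (In (i) and (ii), for $n=3$ the lists are $(-3,-2,1)$ and $(3,-2,-1)$.) (iii) Let $3\le r\le n-1$ and $n+1-r=2m$. The minimal $w$ are exactly the elements $w_{\underline i}$ $(\underline i\in J_{m,[3,n]})$ and $w_{1,\underline i},w_{2,\underline i}$ $(\underline i\in J_{m-1,[4,n]})$ below. Each of them is minimal, the corresponding $v$ is maximal with the indicated $v(\omega_r)$, $w$ is obtained from $v$ by the indicated product, and $w(\omega_r)=-v(\omega_r)$. * $v_{\underline i}(\omega_r)=\sum_k\alpha_{i_k}$ and $w_{\underline i}=s_{\underline i}v_{\underline i}$, where $v_{\underline i}=(\epsilon,A_2(\underline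 i),-\underline i',\underline i)$ and $w_{\underline i}=(\epsilon,A_2(\underline i),-\underline i,\underline i')$, with $\epsilon=-1$ for $m$ odd and $\epsilon=1$ for $m$ even. * $v_{1,\underline i}(\omega_r)=\alpha_1+\sum_k\alpha_{i_k}$ and $w_{1,\underline i}=s_1s_{\underline i}v_{1,\underline i}$, where $v_{1,\underline i}=(A,-\underline i',1,2,\underline i)$ and $w_{1,\underline i}=(A,-\underline i,-2,-1,\underline i')$, with $A=A_3(\underline i)$ for $m$ odd and $A=A_3^-(\underline i)$ for $m$ even. * $v_{2,\underline i}(\omega_r)=\alpha_2+\sum_k\alpha_{i_k}$ and $w_{2,\underline i}=s_2s_{\underline i}v_{2,\underline i}$, where $v_{2,\underline i}=(A,-\underline i',-1,2,\underline i)$ and $w_{2,\underline i}=(A,-\underline i,-2,1,\underline i')$, with $A=A_3^-(\underline i)$ for $m$ odd and $A=A_3(\underline i)$ for $m$ even. (iv) Let $3\le r\le n-1$ and $n+1-r=2m+1$. The minimal $w$ are exactly the elements $w_{\underline i}$ $(\underline i\in J_{m,[4,n]})$ and $w_{\underline i,1},w_{\underline i,2}$ $(\underline i\in J_{m-1,[5,n]})$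 below. Each of them is minimal, the corresponding $v$ is maximal with the indicated $v(\omega_r)$, $w$ is obtained from $v$ by the indicated product, and $w_{\underline i}(\omega_r)=-v_{\underline i}(\omega_r)$, $w_{\underline i,1}(\omega_r)=-v_{\underline i,1}(\omega_r)$, $w_{\underline i,2}(\omega_r)=-v_{\underline i,2}(\omega_r)$. (Note that $w_{\underline i,2}$ is obtained from $v_{\underline i,1}$ and $w_{\underline i,1}$ from $v_{\underline i,2}$.) * $v_{\underline i}(\omega_r)=\frac12\alpha_1+\frac12\alpha_2+\sum_k\alpha_{i_k}$ and $w_{\underline i}=s_1s_2s_{\underline i}v_{\underline i}$, where $v_{\underline i}=(\epsilon,A_3(\underline i),-\underline i',2,\underline i)$ and $w_{\underline i}=(-\epsilon,A_3(\underline i),-\underline i,-2,\underline i')$, with $\epsilon=-1$ for $m$ odd and $\epsilon=1$ for $m$ even. * $v_{\underline i,1}(\omega_r)=\frac32\alpha_1+\frac12\alpha_2+\alpha_3+\sum_k\alpha_{i_k}$ and $w_{\underline i,2}=s_2s_3s_1s_{\underline i}v_{\underline i,1}$, where $v_{\underline i,1}=(A,-\underline i',1,2,3,\underline i)$ and $w_{\underline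 i,2}=(A,-\underline i,-3,-2,1,\underline i')$, with $A=A_4(\underline i)$ for $m$ odd and $A=A_4^-(\underline i)$ for $m$ even. * $v_{\underline i,2}(\omega_r)=\frac12\alpha_1+\frac32\alpha_2+\alpha_3+\sum_k\alpha_{i_k}$ and $w_{\underline i,1}=s_1s_3s_2s_{\underline i}v_{\underline i,2}$, where $v_{\underline i,2}=(A,-\underline i',-1,2,3,\underline i)$ and $w_{\underline i,1}=(A,-\underline i,-3,-2,-1,\underline i')$, with $A=A_4^-(\underline i)$ for $m$ odd and $A=A_4(\underline i)$ for $m$ even. (v) For $r=n$ there is exactly one minimal $w$, namely $w=s_1s_2v=(-1,3,4,\dots,n,-2)$, where $v=(1,3,4,\dots,n,2)$ is maximal with $v(\omega_n)=\frac12\alpha_1+\frac12\alpha_2$; and $w(\omega_n)=-v(\omega_n)$. -/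

import Mathlib

/-!
The Weyl group of type `D_n` as a group of signed permutations of `{±1, …, ±n}`, acting on
`E = ℝ^n`; the simple root `α_1 = ε_1 + ε_2` is the special node and `α_i = ε_i - ε_{i-1}` for
`2 ≤ i ≤ n`.
-/

namespace TypeD

noncomputable section

/-- The real span of the character lattice, with its orthonormal coordinates. The coordinate with
number `k ∈ {1, …, n}` is the one at `k - 1 : Fin n`. -/
abbrev E (n : ℕ) : Type := Fin n → ℝ

/-- The vector `ε_k` for `1 ≤ k ≤ n`, and `ε_{-k} = -ε_k`. -/
def e (n : ℕ) (k : ℤ) : E n := fun j =>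
  if (j : ℤ) + 1 = k then 1 else if (j : ℤ) + 1 = -k then -1 else 0

/-- The simple roots `α_1 = ε_1 + ε_2`, `α_i = ε_i - ε_{i-1}` (`2 ≤ i ≤ n`). -/
def simpleRoot (n : ℕ) (i : ℤ) : E n :=
  if i = 1 then e n 1 + e n 2 else e n i - e n (i - 1)

/-- The positive roots `ε_j ± ε_i`, `1 ≤ i < j ≤ n`. -/
def posRoots (n : ℕ) : Set (E n) :=
  {x | ∃ i j : ℤ, 1 ≤ i ∧ i < j ∧ j ≤ n ∧ (x = e n j - e n i ∨ x = e n j + e n i)}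

/-- The fundamental weights: `ω_1 = (ε_1 + ⋯ + ε_n) / 2`, `ω_2 = (-ε_1 + ε_2 + ⋯ + ε_n) / 2`,
`ω_r = ε_r + ⋯ + ε_n` for `3 ≤ r ≤ n`. -/
def fundWeight (n : ℕ) (r : ℕ) : E n := fun j =>
  if r = 1 then 1 / 2
  else if r = 2 then (if (j : ℕ) = 0 then -1 / 2 else 1 / 2)
  else if r ≤ (j : ℕ) + 1 then 1 else 0

/-- The pairing `⟨x, β^∨⟩ = 2 (x, β) / (β, β)` of a weight with a coroot. -/
def corootPairing {n : ℕ} (x β : E n) : ℝ := 2 * (x ⬝ᵥ β) / (β ⬝ᵥ β)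

/-- `x ≥ 0` in the root order: `x` is a nonnegative combination of the simple roots. -/
def RootNonneg (n : ℕ) (x : E n) : Prop :=
  ∃ c : ℤ → ℝ, (∀ i ∈ Finset.Icc (1 : ℤ) n, 0 ≤ c i) ∧
    x = ∑ i ∈ Finset.Icc (1 : ℤ) n, c i • simpleRoot n i

/-- The simple reflections, as permutations of the integers: `s_1 = (1, -2)(-1, 2)` and
`s_i = (i - 1, i)(-(i - 1), -i)` for `2 ≤ i ≤ n`. -/
def s (i : ℤ) : Equiv.Perm ℤ :=
  if i = 1 then Equiv.swap 1 (-2) * Equiv.swap (-1) 2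
  else Equiv.swap (i - 1) i * Equiv.swap (-(i - 1)) (-i)

/-- The Weyl group of type `D_n`. -/
def weylGroup (n : ℕ) : Subgroup (Equiv.Perm ℤ) :=
  Subgroup.closure {t | ∃ i : ℤ, 1 ≤ i ∧ i ≤ n ∧ t = s i}

/-- The linear action on `E`, determined by `w(ε_k) = ε_{w(k)}`. -/
def act (n : ℕ) (w : Equiv.Perm ℤ) (x : E n) : E n :=
  ∑ j : Fin n, x j • e n (w ((j : ℤ) + 1))

/-- The one-line notation `(w(1), …, w(n))`. -/
def oneLine (n : ℕ) (w : Equiv.Perm ℤ) : List ℤ :=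
  (List.range n).map fun j => w ((j : ℤ) + 1)

/-- The Coxeter length with respect to the simple reflections `s_1, …, s_n`. -/
def length (n : ℕ) (w : Equiv.Perm ℤ) : ℕ :=
  sInf {k | ∃ l : List ℤ, (∀ i ∈ l, 1 ≤ i ∧ i ≤ n) ∧ (l.map s).prod = w ∧ l.length = k}

/-- The reflections of the Weyl group: the conjugates of the simple reflections. -/
def reflections (n : ℕ) : Set (Equiv.Perm ℤ) :=
  {t | ∃ g ∈ weylGroup n, ∃ i : ℤ, 1 ≤ i ∧ i ≤ n ∧ t = g * s i * g⁻¹}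

/-- The Bruhat order: `u ≤ v` if `v` is reached from `u` by left multiplications by reflections,
each of which increases the length. -/
def BruhatLE (n : ℕ) : Equiv.Perm ℤ → Equiv.Perm ℤ → Prop :=
  Relation.ReflTransGen fun u v =>
    length n u < length n v ∧ ∃ t ∈ reflections n, v = t * u

/-- `W^{I_r}`, `I_r = {α_r}`: the `w` in the Weyl group with `w(α_i) > 0` for all simple roots
`α_i ≠ α_r`. -/
def minReps (n r : ℕ) : Set (Equiv.Perm ℤ) :=
  {w | w ∈ weylGroup n ∧ ∀ i : ℤ, 1 ≤ i → i ≤ n → i ≠ r → act n w (simpleRoot n i) ∈ posRoots n}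

/-- `v` is a maximal element of `{v ∈ W^{I_r} : v(ω_r) ≥ 0}` in the Bruhat order. -/
def IsMaximalNonneg (n r : ℕ) (v : Equiv.Perm ℤ) : Prop :=
  (v ∈ minReps n r ∧ RootNonneg n (act n v (fundWeight n r))) ∧
    ∀ u ∈ minReps n r, RootNonneg n (act n u (fundWeight n r)) → BruhatLE n v u → u = v

/-- `w` is a minimal element of `{w ∈ W^{I_r} : w(ω_r) ≤ 0}` in the Bruhat order. -/
def IsMinimalNonpos (n r : ℕ) (w : Equiv.Perm ℤ) : Prop :=
  (w ∈ minReps n r ∧ RootNonneg n (-act n w (fundWeight n r))) ∧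
    ∀ u ∈ minReps n r, RootNonneg n (-act n u (fundWeight n r)) → BruhatLE n u w → u = w

/-- `J_{p,[a,b]}`: the tuples `(i_1, …, i_p)` of integers in `[a, b]` with
`i_{k+1} - i_k ≥ 2` for all `k`. -/
def J (p : ℕ) (a b : ℤ) : Set (List ℤ) :=
  {l | l.length = p ∧ (∀ x ∈ l, a ≤ x ∧ x ≤ b) ∧ l.IsChain fun x y => x + 2 ≤ y}

/-- The sum `∑_k α_{i_k}`. -/
def rootSum (n : ℕ) (i : List ℤ) : E n := (i.map (simpleRoot n)).sum

/-- The product `s_{i_1} s_{i_2} ⋯ s_{i_p}`. -/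
def word (i : List ℤ) : Equiv.Perm ℤ := (i.map s).prod

end

/-- `i' = (i_1 - 1, …, i_p - 1)`. -/
def pred (i : List ℤ) : List ℤ := i.map fun x => x - 1

/-- `-i = (-i_p, …, -i_1)`. -/
def neg (i : List ℤ) : List ℤ := (i.map fun x => -x).reverse

/-- `(a, a + 1, …, n)`, empty if `n < a`. -/
def interval (a n : ℕ) : List ℤ := (List.range (n + 1 - a)).map fun j => (a : ℤ) + j

/-- `[a, n] ∖ {[i], [i']}` in increasing order. -/
def rest (a n : ℕ) (i : List ℤ) : List ℤ :=
  (interval a n).filter fun x => x ∉ i ∧ x ∉ pred i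

/-- Changes the sign of the first entry of a list. On a list in increasing order
this replaces the minimum `t` by `-t`. -/
def negHead : List ℤ → List ℤ
  | [] => []
  | t :: l => -t :: l

/-- `(-n, -(n-2), …, -4, -2)` for even `n` and `(-n, -(n-2), …, -5, -3)` for odd `n`. -/
def down (n : ℕ) : List ℤ := (List.range (n / 2)).map fun j => -((n : ℤ) - 2 * j)

/-- `(3, 5, …, n-3, n-1)` for even `n` and `(4, 6, …, n-3, n-1)` for odd `n`. -/
def up (n : ℕ) : List ℤ :=
  (List.range (n / 2 - 1)).map fun j => (if Even n then 3 else 4) + 2 * (j : ℤ)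

/-- The minimal element for `r = 1`. -/
def wOne (n : ℕ) : List ℤ :=
  if n % 4 = 0 then down n ++ [1] ++ up n
  else if n % 4 = 2 then down n ++ [-1] ++ up n
  else if n % 4 = 1 then down n ++ [-2, -1] ++ up n
  else down n ++ [-2, 1] ++ up n

/-- The minimal element for `r = 2`; here `negHead (down n)` is `(n, -(n-2), …)`. -/
def wTwo (n : ℕ) : List ℤ :=
  if n % 4 = 0 then negHead (down n) ++ [-1] ++ up n
  else if n % 4 = 2 then negHead (down n) ++ [1] ++ up n
  else if n % 4 = 1 then negHead (down n) ++ [-2, 1] ++ up n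
  else negHead (down n) ++ [-2, -1] ++ up n

/-! `n + 1 - r = 2 m`: the elements `v_i, w_i` (`i ∈ J_{m,[3,n]}`) and
`v_{1,i}, w_{1,i}, v_{2,i}, w_{2,i}` (`i ∈ J_{m-1,[4,n]}`). -/

def vE (n m : ℕ) (i : List ℤ) : List ℤ :=
  (if Odd m then [-1] else [1]) ++ rest 2 n i ++ neg (pred i) ++ i

def wE (n m : ℕ) (i : List ℤ) : List ℤ :=
  (if Odd m then [-1] else [1]) ++ rest 2 n i ++ neg i ++ pred i

def vE1 (n m : ℕ) (i : List ℤ) : List ℤ :=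
  (if Odd m then rest 3 n i else negHead (rest 3 n i)) ++ neg (pred i) ++ [1, 2] ++ i

def wE1 (n m : ℕ) (i : List ℤ) : List ℤ :=
  (if Odd m then rest 3 n i else negHead (rest 3 n i)) ++ neg i ++ [-2, -1] ++ pred i

def vE2 (n m : ℕ) (i : List ℤ) : List ℤ :=
  (if Odd m then negHead (rest 3 n i) else rest 3 n i) ++ neg (pred i) ++ [-1, 2] ++ i

def wE2 (n m : ℕ) (i : List ℤ) : List ℤ :=
  (if Odd m then negHead (rest 3 n i) else rest 3 n i) ++ neg i ++ [-2, 1] ++ pred i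

/-! `n + 1 - r = 2 m + 1`: the elements `v_i, w_i` (`i ∈ J_{m,[4,n]}`) and
`v_{i,1}, w_{i,1}, v_{i,2}, w_{i,2}` (`i ∈ J_{m-1,[5,n]}`). -/

def vO (n m : ℕ) (i : List ℤ) : List ℤ :=
  (if Odd m then [-1] else [1]) ++ rest 3 n i ++ neg (pred i) ++ [2] ++ i

def wO (n m : ℕ) (i : List ℤ) : List ℤ :=
  (if Odd m then [1] else [-1]) ++ rest 3 n i ++ neg i ++ [-2] ++ pred i

def vO1 (n m : ℕ) (i : List ℤ) : List ℤ :=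
  (if Odd m then rest 4 n i else negHead (rest 4 n i)) ++ neg (pred i) ++ [1, 2, 3] ++ i

def wO2 (n m : ℕ) (i : List ℤ) : List ℤ :=
  (if Odd m then rest 4 n i else negHead (rest 4 n i)) ++ neg i ++ [-3, -2, 1] ++ pred i

def vO2 (n m : ℕ) (i : List ℤ) : List ℤ :=
  (if Odd m then negHead (rest 4 n i) else rest 4 n i) ++ neg (pred i) ++ [-1, 2, 3] ++ i

def wO1 (n m : ℕ) (i : List ℤ) : List ℤ :=
  (if Odd m then negHead (rest 4 n i) else rest 4 n i) ++ neg i ++ [-3, -2, -1] ++ pred i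

/-- `(1, 3, 4, …, n - 1, n, 2)`. -/
def vLast (n : ℕ) : List ℤ := [1] ++ interval 3 n ++ [2]

/-- `(-1, 3, 4, …, n - 1, n, -2)`. -/
def wLast (n : ℕ) : List ℤ := [-1] ++ interval 3 n ++ [-2]

noncomputable section

/-- `v` has the one-line notation `vLine`, is maximal with `v(ω_r) ≥ 0`, and `v(ω_r) = χ`. -/
def ListedMax (n r : ℕ) (vLine : List ℤ) (χ : E n) (v : Equiv.Perm ℤ) : Prop :=
  oneLine n v = vLine ∧ IsMaximalNonneg n r v ∧ act n v (fundWeight n r) = χ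

/-- `w` has the one-line notation `wLine` and is minimal with `w(ω_r) ≤ 0`. -/
def ListedMin (n r : ℕ) (wLine : List ℤ) (w : Equiv.Perm ℤ) : Prop :=
  oneLine n w = wLine ∧ IsMinimalNonpos n r w

/-- There is a matched pair `(v, w)`: `v` is maximal, given by `vLine`, with `v(ω_r) = χ`;
`w = x v` is minimal, given by `wLine`, and `w(ω_r) = -v(ω_r)`. -/
def Matched (n r : ℕ) (vLine : List ℤ) (χ : E n) (x : Equiv.Perm ℤ) (wLine : List ℤ) : Prop :=
  ∃ v w : Equiv.Perm ℤ, ListedMax n r vLine χ v ∧ ListedMin n r wLine w ∧ w = x * v ∧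
    act n w (fundWeight n r) = -act n v (fundWeight n r)

end

theorem dot_e (n : ℕ) (x : E n) (k : ℕ) (hk : k < n) : x ⬝ᵥ e n ((k : ℤ) + 1) = x ⟨k, hk⟩ := by
  have h : e n ((k : ℤ) + 1) = Pi.single (⟨k, hk⟩ : Fin n) (1 : ℝ) := by
    funext j
    by_cases hj : j = ⟨k, hk⟩
    · subst hj
      simp [e]
    · have h1 : (j : ℕ) ≠ k := fun h => hj (Fin.ext h)
      rw [Pi.single_eq_of_ne hj]
      unfold e
      rw [if_neg (by omega), if_neg (by omega)]
  rw [h, dotProduct_single_one]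

/-- `⟨ω_r, α_i^∨⟩ = δ_{ri}`: the vectors `ω_1, …, ω_n` are the fundamental weights. -/
theorem fundWeight_pairing (n : ℕ) (hn : 2 ≤ n) (r i : ℕ) (hr : 1 ≤ r) (hi : 1 ≤ i)
    (hi' : i ≤ n) :
    corootPairing (fundWeight n r) (simpleRoot n i) = if r = i then 1 else 0 := by
  rcases Nat.lt_or_ge 1 i with h | h
  · obtain ⟨k, rfl⟩ : ∃ k, i = k + 2 := ⟨i - 2, by omega⟩
    have hs : simpleRoot n ((k + 2 : ℕ) : ℤ)
        = e n (((k + 1 : ℕ) : ℤ) + 1) - e n ((k : ℤ) + 1) := by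
      unfold simpleRoot
      rw [if_neg (by omega)]
      push_cast
      congr 2 <;> ring
    have hd : ∀ x : E n, x ⬝ᵥ simpleRoot n ((k + 2 : ℕ) : ℤ)
        = x ⟨k + 1, by omega⟩ - x ⟨k, by omega⟩ := by
      intro x
      rw [hs, dotProduct_sub, dot_e n x (k + 1) (by omega), dot_e n x k (by omega)]
    have hq : simpleRoot n ((k + 2 : ℕ) : ℤ) ⬝ᵥ simpleRoot n ((k + 2 : ℕ) : ℤ) = 2 := by
      rw [hd, hs]
      simp only [Pi.sub_apply, e]
      push_cast
      split_ifs <;> first | omega | norm_num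
    rw [corootPairing, hq, hd]
    simp only [fundWeight]
    split_ifs <;> first | omega | (norm_num; done) | (exfalso; simp_all)
  · obtain rfl : i = 1 := by omega
    have hs : simpleRoot n ((1 : ℕ) : ℤ) = e n (((0 : ℕ) : ℤ) + 1) + e n (((1 : ℕ) : ℤ) + 1) := by
      unfold simpleRoot
      norm_num
    have hd : ∀ x : E n, x ⬝ᵥ simpleRoot n ((1 : ℕ) : ℤ)
        = x ⟨0, by omega⟩ + x ⟨1, by omega⟩ := by
      intro x
      rw [hs, dotProduct_add, dot_e n x 0 (by omega), dot_e n x 1 (by omega)]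
    have hq : simpleRoot n ((1 : ℕ) : ℤ) ⬝ᵥ simpleRoot n ((1 : ℕ) : ℤ) = 2 := by
      rw [hd, hs]
      simp only [Pi.add_apply, e]
      norm_num
    rw [corootPairing, hq, hd]
    simp only [fundWeight]
    split_ifs <;> first | omega | (norm_num; done) | (exfalso; simp_all)

end TypeD

open TypeD

/-!
If `u ≤ v` in the Bruhat order, then `u ω_r - v ω_r ≥ 0`. Elements of `W^{I_r}` are determined by
the weight `w ω_r`, and a simple reflection that raises `w ω_r` leads to a smaller element of
`W^{I_r}`. Hence a minimal `w` gives a weight `x = w ω_r ≤ 0` that leaves the cone of weights `≤ 0`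
under every simple reflection raising it; call such a weight *top*. For coordinates in `{-1, 0, 1}`
the top weights can be classified by reading their simple root coefficients from the last
coordinate down. Those of a given norm are pairwise incomparable, as their coefficients add up to
essentially the same height, so each of them does come from a minimal element and its negative from
a maximal one. An element of `W^{I_r}` increases along the simple roots other than `α_r`, so its
one-line notation can be read off from the weight. For `r = 1, 2` the same applies to `2 ω_r`,
whose orbit consists of the vectors with coordinates `±1` of given sign product and contains one
top vector.
-/

namespace TypeD

variable {n r : ℕ} {a b i j : ℤ} {w g u : Equiv.Perm ℤ}

/-- `i` is a node of the Dynkin diagram of `D_n`. -/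
abbrev IsNode (n : ℕ) (i : ℤ) : Prop := 1 ≤ i ∧ i ≤ n

/-- `k` is one of `±1, …, ±n`, the points on which the Weyl group acts. -/
abbrev InRange (n : ℕ) (k : ℤ) : Prop := k ≠ 0 ∧ -(n : ℤ) ≤ k ∧ k ≤ n

/-- `ε_a - ε_b` is a root, which by `mem_posRoots_iff` is positive exactly when `b < a`. -/
abbrev IsRootPair (n : ℕ) (a b : ℤ) : Prop := InRange n a ∧ InRange n b ∧ a ≠ b ∧ a ≠ -b

theorem IsNode.inRange (hi : IsNode n i) : InRange n i := by omega

theorem IsRootPair.symm (h : IsRootPair n a b) : IsRootPair n b a := by omega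

/-- The lower end of the simple root `α_i = ε_i - ε_{lo i}`; so `lo 1 = -2`. -/
def lo (i : ℤ) : ℤ := if i = 1 then -2 else i - 1

theorem lo_cases (i : ℤ) : (i = 1 ∧ lo i = -2) ∨ (i ≠ 1 ∧ lo i = i - 1) := by
  unfold lo
  split_ifs <;> omega

theorem lo_lt (i : ℤ) : lo i < i := by
  have := lo_cases i
  omega

theorem isRootPair_lo (hn : 2 ≤ n) (hi : IsNode n i) : IsRootPair n i (lo i) := by
  have := lo_cases i
  omega

theorem s_apply (hi : 1 ≤ i) (x : ℤ) : s i x =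
    if x = i then lo i else if x = lo i then i else if x = -i then -lo i
      else if x = -lo i then -i else x := by
  unfold s lo
  by_cases h : i = 1
  · simp only [h, if_true, Equiv.Perm.mul_apply]
    generalize hy : Equiv.swap (-1) 2 x = y
    rw [Equiv.swap_apply_def] at hy ⊢
    split_ifs at hy ⊢ <;> omega
  · simp only [h, if_false, Equiv.Perm.mul_apply]
    generalize hy : Equiv.swap (-(i - 1)) (-i) x = y
    rw [Equiv.swap_apply_def] at hy ⊢
    split_ifs at hy ⊢ <;> omega

theorem s_self_apply (hi : 1 ≤ i) : s i i = lo i := by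
  rw [s_apply hi, if_pos rfl]

theorem s_lo_apply (hi : 1 ≤ i) : s i (lo i) = i := by
  rw [s_apply hi, if_neg (lo_lt i).ne, if_pos rfl]

theorem s_neg (hi : 1 ≤ i) (x : ℤ) : s i (-x) = -s i x := by
  have := lo_cases i
  rw [s_apply hi, s_apply hi]
  split_ifs <;> omega

theorem s_mul_s (hi : 1 ≤ i) : s i * s i = 1 := by
  have := lo_cases i
  ext x
  rw [Equiv.Perm.mul_apply, Equiv.Perm.one_apply, s_apply hi, s_apply hi]
  split_ifs <;> omega

theorem s_inv (hi : 1 ≤ i) : (s i)⁻¹ = s i :=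
  inv_eq_of_mul_eq_one_left (s_mul_s hi)

/-- `s_i` permutes the positive roots other than `α_i = ε_i - ε_{lo i} = ε_{-lo i} - ε_{-i}`. -/
theorem s_lt_s (hi : 1 ≤ i) (hab : IsRootPair n a b) (h : b < a)
    (h₁ : ¬(b = lo i ∧ a = i)) (h₂ : ¬(b = -i ∧ a = -lo i)) : s i b < s i a := by
  have := lo_cases i
  rw [s_apply hi, s_apply hi]
  split_ifs <;> omega

/-- Permutations of `ℤ` that commute with negation and move only `±1, …, ±n`. -/
def IsSigned (n : ℕ) (w : Equiv.Perm ℤ) : Prop :=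
  (∀ k, w (-k) = -w k) ∧ ∀ k : ℤ, k < -n ∨ (n : ℤ) < k → w k = k

theorem apply_inv_apply (w : Equiv.Perm ℤ) (k : ℤ) : w (w⁻¹ k) = k := w.apply_symm_apply k

theorem inv_apply_apply (w : Equiv.Perm ℤ) (k : ℤ) : w⁻¹ (w k) = k := w.symm_apply_apply k

namespace IsSigned

theorem one (n : ℕ) : IsSigned n 1 := ⟨fun _ => rfl, fun _ _ => rfl⟩

theorem mul (hg : IsSigned n g) (hw : IsSigned n w) : IsSigned n (g * w) :=
  ⟨fun k => by simp only [Equiv.Perm.mul_apply, hw.1, hg.1],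
    fun k hk => by simp only [Equiv.Perm.mul_apply, hw.2 k hk, hg.2 k hk]⟩

theorem inv (hw : IsSigned n w) : IsSigned n w⁻¹ :=
  ⟨fun k => by rw [Equiv.Perm.inv_eq_iff_eq, hw.1, apply_inv_apply],
    fun k hk => by rw [Equiv.Perm.inv_eq_iff_eq, hw.2 k hk]⟩

theorem map_zero (hw : IsSigned n w) : w 0 = 0 := by
  have := hw.1 0
  rw [neg_zero] at this
  omega

theorem inRange (hw : IsSigned n w) (ha : InRange n a) : InRange n (w a) := by
  refine ⟨fun h => ha.1 (w.injective (h.trans hw.map_zero.symm)), ?_⟩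
  by_contra h
  have := w.injective (hw.2 (w a) (by omega))
  omega

theorem isRootPair (hw : IsSigned n w) (h : IsRootPair n a b) : IsRootPair n (w a) (w b) := by
  refine ⟨hw.inRange h.1, hw.inRange h.2.1, w.injective.ne h.2.2.1, ?_⟩
  rw [← hw.1]
  exact w.injective.ne h.2.2.2

/-- Substitution `k ↦ |w k|` in a product of values of an even function. -/
theorem prod_even {M : Type*} [CommMonoid M] (hw : IsSigned n w) {f : ℤ → M}
    (hf : ∀ k, f (-k) = f k) :
    ∏ k ∈ Finset.Icc (1 : ℤ) n, f (w k) = ∏ k ∈ Finset.Icc (1 : ℤ) n, f k := by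
  have habs : ∀ {g : Equiv.Perm ℤ} {k : ℤ}, IsSigned n g → k ∈ Finset.Icc (1 : ℤ) n →
      |g k| ∈ Finset.Icc (1 : ℤ) n := fun hg hk => by
    rw [Finset.mem_Icc] at hk ⊢
    have := hg.inRange (IsNode.inRange hk)
    exact ⟨Int.one_le_abs this.1, abs_le.2 this.2⟩
  have hinv : ∀ {g : Equiv.Perm ℤ} {k : ℤ}, IsSigned n g → k ∈ Finset.Icc (1 : ℤ) n →
      |g⁻¹ (|g k|)| = k := fun {g k} hg hk => by
    rw [Finset.mem_Icc] at hk
    rcases abs_choice (g k) with h | h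
    · rw [h, inv_apply_apply, abs_of_nonneg (by omega)]
    · rw [h, hg.inv.1, inv_apply_apply, abs_neg, abs_of_nonneg (by omega)]
  refine Finset.prod_nbij' (fun k => |w k|) (fun k => |w⁻¹ k|) (fun k => habs hw)
    (fun k => habs hw.inv) (fun k => hinv hw) (fun k => ?_) fun k _ => ?_
  · have := hinv (k := k) hw.inv
    rwa [inv_inv] at this
  · rcases abs_choice (w k) with h | h
    · rw [h]
    · rw [h, hf]

end IsSigned

/-- The product of the signs in the one-line notation of `w`. It is `1` on the Weyl group of type
`D_n`, which has index two in the group of all signed permutations. -/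
noncomputable def signProd (n : ℕ) (w : Equiv.Perm ℤ) : ℤ := ∏ k ∈ Finset.Icc (1 : ℤ) n, (w k).sign

theorem IsSigned.prod_odd {R : Type*} [CommRing R] (hw : IsSigned n w) {f : ℤ → R}
    (hf : ∀ k, f (-k) = -f k) :
    ∏ k ∈ Finset.Icc (1 : ℤ) n, f (w k) = signProd n w * ∏ k ∈ Finset.Icc (1 : ℤ) n, f k := by
  have hsplit : ∀ k ∈ Finset.Icc (1 : ℤ) n, f (w k) = ((w k).sign : R) * f |w k| := by
    intro k hk
    have hk := (hw.inRange (IsNode.inRange (Finset.mem_Icc.1 hk))).1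
    rcases lt_or_gt_of_ne hk with h | h
    · simp only [Int.sign_eq_neg_one_of_neg h, abs_of_neg h, hf, Int.cast_neg, Int.cast_one,
        neg_mul, one_mul, neg_neg]
    · simp only [Int.sign_eq_one_of_pos h, abs_of_pos h, Int.cast_one, one_mul]
  rw [Finset.prod_congr rfl hsplit, Finset.prod_mul_distrib, signProd, Int.cast_prod,
    hw.prod_even (f := fun k => f |k|) fun k => by rw [abs_neg]]
  congr 1
  refine Finset.prod_congr rfl fun k hk => ?_
  rw [abs_of_pos (Finset.mem_Icc.1 hk).1]

theorem signProd_mul (hg : IsSigned n g) (hw : IsSigned n w) :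
    signProd n (g * w) = signProd n w * signProd n g := by
  have := hw.prod_odd (f := fun k => (g k).sign) fun k => by rw [hg.1, Int.sign_neg]
  exact_mod_cast this

theorem signProd_one (n : ℕ) : signProd n 1 = 1 :=
  Finset.prod_eq_one fun _ hk => Int.sign_eq_one_of_pos (Finset.mem_Icc.1 hk).1

theorem signProd_s (hn : 2 ≤ n) (hi : 1 ≤ i) : signProd n (s i) = 1 := by
  obtain rfl | hi := hi.eq_or_lt
  · rw [signProd, Finset.prod_eq_mul (1 : ℤ) 2 (by norm_num)]
    · rfl
    · intro k hk hne
      rw [Finset.mem_Icc] at hk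
      rw [s_apply le_rfl, lo, if_pos rfl]
      exact Int.sign_eq_one_of_pos (by split_ifs <;> omega)
    all_goals
      intro h
      rw [Finset.mem_Icc] at h
      omega
  · refine Finset.prod_eq_one fun k hk => Int.sign_eq_one_of_pos ?_
    rw [Finset.mem_Icc] at hk
    have := lo_cases i
    rw [s_apply hi.le]
    split_ifs <;> omega

theorem isSigned_s (hn : 2 ≤ n) (hi : IsNode n i) : IsSigned n (s i) := by
  refine ⟨s_neg hi.1, fun k hk => ?_⟩
  have := lo_cases i
  rw [s_apply hi.1]
  split_ifs <;> omega

theorem s_mem (hi : IsNode n i) : s i ∈ weylGroup n :=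
  Subgroup.subset_closure ⟨i, hi.1, hi.2, rfl⟩

theorem isSigned_of_mem (hn : 2 ≤ n) (hw : w ∈ weylGroup n) : IsSigned n w := by
  induction hw using Subgroup.closure_induction with
  | mem x hx =>
    obtain ⟨i, h₁, h₂, rfl⟩ := hx
    exact isSigned_s hn ⟨h₁, h₂⟩
  | one => exact .one n
  | mul x y _ _ hx hy => exact hx.mul hy
  | inv x _ hx => exact hx.inv

theorem signProd_of_mem (hn : 2 ≤ n) (hw : w ∈ weylGroup n) : signProd n w = 1 := by
  induction hw using Subgroup.closure_induction with
  | mem x hx =>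
    obtain ⟨i, h₁, -, rfl⟩ := hx
    exact signProd_s hn h₁
  | one => exact signProd_one n
  | mul x y hx' hy' hx hy =>
    rw [signProd_mul (isSigned_of_mem hn hx') (isSigned_of_mem hn hy'), hx, hy, one_mul]
  | inv x hx' hx =>
    have hsx := isSigned_of_mem hn hx'
    rw [← signProd_one n, ← mul_inv_cancel x, signProd_mul hsx hsx.inv, hx, mul_one]

theorem lt_of_lo_lt {α : Type*} [AddCommGroup α] [LinearOrder α] [IsOrderedAddMonoid α]
    {f : ℤ → α} (hodd : ∀ k, f (-k) = -f k) (hf : ∀ i, IsNode n i → f (lo i) < f i)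
    (hab : IsRootPair n a b) (h : b < a) : f b < f a := by
  have hmono : StrictMonoOn f (Set.Icc 1 n) := by
    refine strictMonoOn_of_lt_add_one Set.ordConnected_Icc fun k _ hk hk' => ?_
    have := hf (k + 1) ⟨by linarith [hk.1], hk'.2⟩
    rwa [lo, if_neg (by linarith [hk.1]), add_sub_cancel_right] at this
  have hsum : ∀ {c d : ℤ}, 1 ≤ c → c < d → d ≤ n → 0 < f c + f d := by
    intro c d hc hcd hd
    have h₁₂ : 0 < f 1 + f 2 := by
      have := hf 1 (by omega)
      rwa [lo, if_pos rfl, hodd, neg_lt_iff_pos_add] at this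
    exact h₁₂.trans_le (add_le_add (hmono.monotoneOn ⟨le_rfl, by omega⟩ ⟨hc, by omega⟩ hc)
      (hmono.monotoneOn ⟨by omega, by omega⟩ ⟨by omega, hd⟩ (by omega)))
  rcases lt_or_gt_of_ne hab.1.1 with ha | ha <;> rcases lt_or_gt_of_ne hab.2.1.1 with hb | hb
  · have := hmono (a := -a) (b := -b) ⟨by omega, by omega⟩ ⟨by omega, by omega⟩ (by omega)
    rwa [hodd, hodd, neg_lt_neg_iff] at this
  · omega
  · rw [← neg_neg b, hodd, neg_lt_iff_pos_add]
    rcases lt_or_gt_of_ne hab.2.2.2 with hlt | hlt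
    · exact hsum (by omega) hlt (by omega)
    · rw [add_comm]
      exact hsum (by omega) hlt (by omega)
  · exact hmono ⟨by omega, by omega⟩ ⟨by omega, by omega⟩ h

theorem apply_eq_self_of_lo_lt (hn : 2 ≤ n) (hw : IsSigned n w)
    (hpos : ∀ i, IsNode n i → w (lo i) < w i) (ha : 2 ≤ a) (han : a ≤ n) : w a = a := by
  have hmono : MonotoneOn (fun k => w k - k) (Set.Icc 2 n) := by
    refine monotoneOn_of_le_add_one Set.ordConnected_Icc fun k _ hk hk' => ?_
    have := hpos (k + 1) ⟨by linarith [hk.1], hk'.2⟩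
    rw [lo, if_neg (by linarith [hk.1]), add_sub_cancel_right] at this
    omega
  have hlow : 2 ≤ w 2 := by
    have h₁ := lt_of_lo_lt hw.1 hpos (a := 2) (b := 1) (by omega) (by omega)
    have h₂ := lt_of_lo_lt hw.1 hpos (a := 2) (b := -1) (by omega) (by omega)
    have := hw.inRange (a := 1) (by omega)
    rw [hw.1] at h₂
    omega
  have hup := hw.inRange (a := n) (by omega)
  have h₂ := hmono ⟨le_rfl, by omega⟩ ⟨ha, han⟩ ha
  have h₃ := hmono ⟨ha, han⟩ ⟨by omega, le_rfl⟩ han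
  dsimp only at h₂ h₃
  omega

theorem eq_one_of_lo_lt (hn : 2 ≤ n) (hw : IsSigned n w) (hsign : signProd n w = 1)
    (hpos : ∀ i, IsNode n i → w (lo i) < w i) : w = 1 := by
  have hfix : ∀ k : ℤ, 2 ≤ k → k ≤ n → w k = k := fun k => apply_eq_self_of_lo_lt hn hw hpos
  have hone : w 1 = 1 := by
    have hsign₁ : (w 1).sign = 1 := by
      refine (Finset.prod_eq_single (f := fun k => (w k).sign) 1 (fun k hk hne => ?_)
        fun h => ?_).symm.trans hsign
      · rw [Finset.mem_Icc] at hk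
        rw [hfix k (by omega) hk.2, Int.sign_eq_one_of_pos (by omega)]
      · exact absurd (Finset.mem_Icc.2 ⟨le_rfl, by omega⟩) h
    have hlt := hpos 2 (by omega)
    rw [hfix 2 le_rfl (by omega)] at hlt
    have := Int.sign_eq_one_iff_pos.1 hsign₁
    simp only [lo, OfNat.ofNat_ne_one, if_false] at hlt
    norm_num at hlt
    omega
  have hnonneg : ∀ k : ℤ, 0 ≤ k → w k = k := by
    intro k hk
    obtain rfl | rfl | ⟨h₁, h₂⟩ | h : k = 0 ∨ k = 1 ∨ (2 ≤ k ∧ k ≤ n) ∨ (n : ℤ) < k := by omega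
    · exact hw.map_zero
    · exact hone
    · exact hfix k h₁ h₂
    · exact hw.2 k (.inr h)
  ext k
  rcases le_or_gt 0 k with h | h
  · exact hnonneg k h
  · rw [← neg_neg k, hw.1, hnonneg (-k) (by omega), Equiv.Perm.one_apply]

theorem e_neg (n : ℕ) (a : ℤ) : e n (-a) = -e n a := by
  funext j
  simp only [e, Pi.neg_apply, neg_neg]
  split_ifs <;> first | omega | simp only [neg_neg, neg_zero]

theorem simpleRoot_eq (n : ℕ) (i : ℤ) : simpleRoot n i = e n i - e n (lo i) := by
  unfold simpleRoot lo
  split_ifs with h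
  · rw [h, e_neg, sub_neg_eq_add]
  · rfl

/-- The coordinate of `x` with the signed number `a`, so that `coord x (-a) = -coord x a`. -/
noncomputable def coord (x : E n) (a : ℤ) : ℝ := x ⬝ᵥ e n a

theorem coord_neg_right (x : E n) (a : ℤ) : coord x (-a) = -coord x a := by
  rw [coord, e_neg, dotProduct_neg, coord]

theorem coord_add (x y : E n) (a : ℤ) : coord (x + y) a = coord x a + coord y a :=
  add_dotProduct _ _ _

theorem coord_sub (x y : E n) (a : ℤ) : coord (x - y) a = coord x a - coord y a :=
  sub_dotProduct _ _ _

theorem coord_neg (x : E n) (a : ℤ) : coord (-x) a = -coord x a :=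
  neg_dotProduct _ _

theorem coord_smul (t : ℝ) (x : E n) (a : ℤ) : coord (t • x) a = t * coord x a :=
  smul_dotProduct _ _ _

theorem coord_fin (x : E n) (j : Fin n) : coord x ((j : ℤ) + 1) = x j :=
  dot_e n x j j.2

theorem exists_fin (ha : IsNode n a) : ∃ j : Fin n, (j : ℤ) + 1 = a :=
  ⟨⟨(a - 1).toNat, by omega⟩, by dsimp only; omega⟩

theorem coord_eq_of_odd {x : E n} {f : ℤ → ℝ} (hodd : ∀ k, k ≠ 0 → f (-k) = -f k)
    (hf : ∀ j : Fin n, x j = f ((j : ℤ) + 1)) (ha : InRange n a) : coord x a = f a := by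
  rcases lt_or_gt_of_ne ha.1 with h | h
  · obtain ⟨j, hj⟩ := exists_fin (n := n) (a := -a) (by omega)
    rw [← neg_inj, ← coord_neg_right, ← hodd a ha.1, ← hj, coord_fin, hf]
  · obtain ⟨j, rfl⟩ := exists_fin (n := n) (a := a) (by omega)
    rw [coord_fin, hf]

theorem ext_coord {x y : E n} (h : ∀ k, IsNode n k → coord x k = coord y k) : x = y := by
  funext j
  rw [← coord_fin x, ← coord_fin y]
  exact h _ (by omega)

theorem coord_e (hb : InRange n b) :
    coord (e n a) b = if a = b then 1 else if a = -b then -1 else 0 := by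
  refine coord_eq_of_odd (f := fun k => if a = k then (1 : ℝ) else if a = -k then -1 else 0)
    (fun k hk => ?_) (fun j => ?_) hb
  · split_ifs <;> first | omega | simp only [neg_neg, neg_zero]
  · simp only [e]
    split_ifs <;> first | omega | rfl

theorem coord_e_self (ha : InRange n a) : coord (e n a) a = 1 := by
  rw [coord_e ha, if_pos rfl]

theorem coord_e_of_isRootPair (h : IsRootPair n a b) : coord (e n a) b = 0 := by
  rw [coord_e h.2.1, if_neg h.2.2.1, if_neg h.2.2.2]

theorem act_sub (w : Equiv.Perm ℤ) (x y : E n) : act n w (x - y) = act n w x - act n w y := by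
  simp only [act, Pi.sub_apply, sub_smul, Finset.sum_sub_distrib]

theorem act_one (x : E n) : act n 1 x = x := by
  refine ext_coord fun k hk => ?_
  obtain ⟨j, rfl⟩ := exists_fin hk
  rw [coord, act, sum_dotProduct, Finset.sum_eq_single j (fun i _ hij => ?_) (by simp)]
  · rw [smul_dotProduct, ← coord, Equiv.Perm.one_apply, coord_e_self hk.inRange, coord_fin,
      smul_eq_mul, mul_one]
  · rw [smul_dotProduct, ← coord, Equiv.Perm.one_apply, coord_e_of_isRootPair, smul_zero]
    have := Fin.val_ne_of_ne hij
    omega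

theorem coord_act_apply (hw : IsSigned n w) (x : E n) (ha : InRange n a) :
    coord (act n w x) (w a) = coord x a := by
  have hbasis : ∀ b, e n (w b) ⬝ᵥ e n (w a) = e n b ⬝ᵥ e n a := fun b => by
    rw [← coord, ← coord, coord_e (hw.inRange ha), coord_e ha, ← hw.1]
    simp only [w.injective.eq_iff]
  conv_rhs => rw [← act_one x]
  simp only [coord, act, sum_dotProduct, smul_dotProduct, hbasis, Equiv.Perm.one_apply]

theorem coord_act (hw : IsSigned n w) (x : E n) (ha : InRange n a) :
    coord (act n w x) a = coord x (w⁻¹ a) := by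
  rw [← coord_act_apply hw x (hw.inv.inRange ha), apply_inv_apply]

theorem act_e (hw : IsSigned n w) (a : ℤ) : act n w (e n a) = e n (w a) := by
  refine ext_coord fun k hk => ?_
  rw [coord_act hw _ hk.inRange, coord_e (hw.inv.inRange hk.inRange), coord_e hk.inRange]
  simp only [Equiv.Perm.eq_inv_iff_eq, ← hw.inv.1]

theorem act_simpleRoot (hw : IsSigned n w) (i : ℤ) :
    act n w (simpleRoot n i) = e n (w i) - e n (w (lo i)) := by
  rw [simpleRoot_eq, act_sub, act_e hw, act_e hw]

theorem act_mul (hg : IsSigned n g) (hw : IsSigned n w) (x : E n) :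
    act n (g * w) x = act n g (act n w x) := by
  refine ext_coord fun k hk => ?_
  rw [coord_act (hg.mul hw) _ hk.inRange, coord_act hg _ hk.inRange,
    coord_act hw _ (hg.inv.inRange hk.inRange), mul_inv_rev, Equiv.Perm.mul_apply]

theorem act_dotProduct_act (hw : IsSigned n w) (x y : E n) :
    act n w x ⬝ᵥ act n w y = x ⬝ᵥ y := by
  rw [act, sum_dotProduct]
  refine Finset.sum_congr rfl fun j _ => ?_
  rw [smul_dotProduct, dotProduct_comm, ← coord, coord_act_apply hw _ (by omega), coord_fin,
    smul_eq_mul]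

theorem dotProduct_simpleRoot (x : E n) (i : ℤ) :
    x ⬝ᵥ simpleRoot n i = coord x i - coord x (lo i) := by
  rw [simpleRoot_eq, dotProduct_sub, coord, coord]

theorem simpleRoot_dotProduct_self (hn : 2 ≤ n) (hi : IsNode n i) :
    simpleRoot n i ⬝ᵥ simpleRoot n i = 2 := by
  have h := isRootPair_lo hn hi
  rw [dotProduct_simpleRoot, simpleRoot_eq, coord_sub, coord_sub, coord_e_self h.1,
    coord_e_self h.2.1, coord_e_of_isRootPair h, coord_e_of_isRootPair h.symm]
  norm_num

theorem act_s (hn : 2 ≤ n) (hi : IsNode n i) (x : E n) :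
    act n (s i) x = x - (coord x i - coord x (lo i)) • simpleRoot n i := by
  refine ext_coord fun k hk => ?_
  have := lo_cases i
  rw [coord_act (isSigned_s hn hi) _ hk.inRange, s_inv hi.1, coord_sub, coord_smul,
    simpleRoot_eq n, coord_sub, coord_e hk.inRange, coord_e hk.inRange, s_apply hi.1]
  split_ifs <;> try omega
  · rw [‹k = i›]
    ring
  · rw [‹k = lo i›]
    ring
  · rw [‹k = -lo i›, coord_neg_right, coord_neg_right]
    ring
  · ring

/-- The reflection in `ε_a - ε_b`, where `a = g i` and `b = g (lo i)`. -/
theorem act_conj_s (hn : 2 ≤ n) (hg : IsSigned n g) (hi : IsNode n i) (x : E n) :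
    act n (g * s i * g⁻¹) x
      = x - (coord x (g i) - coord x (g (lo i))) • (e n (g i) - e n (g (lo i))) := by
  have hs := isSigned_s hn hi
  have hcoord : ∀ {a}, InRange n a → coord (act n g⁻¹ x) a = coord x (g a) := fun ha => by
    rw [coord_act hg.inv x ha, inv_inv]
  have hsmul : ∀ (t : ℝ) (y : E n), act n g (t • y) = t • act n g y := fun t y => by
    simp only [act, Pi.smul_apply, Finset.smul_sum, smul_assoc]
  rw [act_mul (hg.mul hs) hg.inv, act_mul hg hs, act_s hn hi, act_sub, hsmul,
    ← act_mul hg hg.inv, mul_inv_cancel, act_one, act_simpleRoot hg,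
    hcoord hi.inRange, hcoord (isRootPair_lo hn hi).2.1]

/-- The vector `(1, 2, …, n)`, which is strictly dominant: it pairs with `ε_a - ε_b` to
`a - b`. -/
def rho (n : ℕ) : E n := fun j => (j : ℝ) + 1

theorem coord_rho (ha : InRange n a) : coord (rho n) a = a :=
  coord_eq_of_odd (f := fun k => (k : ℝ)) (fun k _ => Int.cast_neg k)
    (fun j => by simp only [rho]; push_cast; rfl) ha

theorem rho_dotProduct_pos {x : E n} (hx : x ∈ posRoots n) : 0 < rho n ⬝ᵥ x := by
  obtain ⟨i, j, hi, hij, hj, rfl | rfl⟩ := hx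
  · rw [dotProduct_sub, ← coord, ← coord, coord_rho (by omega), coord_rho (by omega), sub_pos]
    exact_mod_cast hij
  · rw [dotProduct_add, ← coord, ← coord, coord_rho (by omega), coord_rho (by omega)]
    exact_mod_cast (by omega : 0 < j + i)

theorem mem_posRoots_iff (hab : IsRootPair n a b) : e n a - e n b ∈ posRoots n ↔ b < a := by
  refine ⟨fun h => ?_, fun h => ?_⟩
  · have := rho_dotProduct_pos h
    rw [dotProduct_sub, ← coord, ← coord, coord_rho hab.1, coord_rho hab.2.1, sub_pos] at this
    exact_mod_cast this
  · have hneg : e n a - e n b = e n (-b) - e n (-a) := by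
      rw [e_neg, e_neg, neg_sub_neg]
    rcases lt_or_gt_of_ne hab.1.1 with ha | ha <;> rcases lt_or_gt_of_ne hab.2.1.1 with hb | hb
    · exact ⟨-a, -b, by omega, by omega, by omega, .inl hneg⟩
    · omega
    · rcases lt_or_gt_of_ne hab.2.2.2 with hlt | hlt
      · exact ⟨a, -b, by omega, hlt, by omega, .inr (by rw [hneg, e_neg n a, sub_neg_eq_add])⟩
      · exact ⟨-b, a, by omega, hlt, by omega, .inr (by rw [e_neg, sub_eq_add_neg])⟩
    · exact ⟨b, a, by omega, h, by omega, .inl rfl⟩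

theorem mem_minReps_iff (hn : 2 ≤ n) : w ∈ minReps n r ↔
    w ∈ weylGroup n ∧ ∀ i, IsNode n i → i ≠ r → w (lo i) < w i := by
  refine and_congr_right fun hw => forall_congr' fun i => ?_
  rw [and_imp]
  refine imp_congr_right fun hi => imp_congr_right fun hi' => imp_congr_right fun _ => ?_
  have hsw := isSigned_of_mem hn hw
  rw [act_simpleRoot hsw, mem_posRoots_iff (hsw.isRootPair (isRootPair_lo hn ⟨hi, hi'⟩))]

/-- Half the squared distance from `ρ` to `w ρ`, as `|w ρ| = |ρ|`. It decreases under `w ↦ w s_i` at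
a descent and thus serves as a measure for induction on `w`. -/
noncomputable def displacement (n : ℕ) (w : Equiv.Perm ℤ) : ℝ :=
  rho n ⬝ᵥ rho n - act n w (rho n) ⬝ᵥ rho n

theorem displacement_nonneg (hw : IsSigned n w) : 0 ≤ displacement n w := by
  have h := dotProduct_self_star_nonneg (act n w (rho n) - rho n)
  rw [star_trivial, dotProduct_sub, sub_dotProduct, sub_dotProduct, act_dotProduct_act hw,
    dotProduct_comm (rho n) (act n w _)] at h
  rw [displacement]
  linarith

theorem displacement_mul_s (hn : 2 ≤ n) (hw : IsSigned n w) (hi : IsNode n i)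
    (h : w i < w (lo i)) : displacement n (w * s i) ≤ displacement n w - 1 := by
  have hlo := isRootPair_lo hn hi
  have hconj : w * s i = w * s i * w⁻¹ * w := by rw [inv_mul_cancel_right]
  have hs := isSigned_s hn hi
  have hprod : (1 : ℝ) ≤ (i - lo i) * (w (lo i) - w i) := by
    exact_mod_cast one_le_mul_of_one_le_of_one_le (by have := lo_lt i; omega) (by omega)
  rw [hconj, displacement, act_mul ((hw.mul hs).mul hw.inv) hw, act_conj_s hn hw hi,
    sub_dotProduct, smul_dotProduct, coord_act_apply hw _ hlo.1, coord_act_apply hw _ hlo.2.1,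
    coord_rho hlo.1, coord_rho hlo.2.1, dotProduct_comm (_ - _) (rho n), dotProduct_sub, ← coord,
    ← coord, coord_rho (hw.inRange hlo.1), coord_rho (hw.inRange hlo.2.1), displacement,
    smul_eq_mul]
  linarith

theorem mem_weylGroup (hn : 2 ≤ n) (hw : IsSigned n w) (hsign : signProd n w = 1) :
    w ∈ weylGroup n := by
  obtain ⟨N, hN⟩ := exists_nat_gt (displacement n w)
  induction N generalizing w with
  | zero => exact absurd (displacement_nonneg hw) (not_le.2 (by exact_mod_cast hN))
  | succ N ih =>
    by_cases hpos : ∀ i, IsNode n i → w (lo i) < w i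
    · rw [eq_one_of_lo_lt hn hw hsign hpos]
      exact one_mem _
    · push Not at hpos
      obtain ⟨i, hi, hle⟩ := hpos
      have hs := isSigned_s hn hi
      have hlt : w i < w (lo i) :=
        hle.lt_of_ne (hw.isRootPair (isRootPair_lo hn hi)).2.2.1
      have hmem : w * s i ∈ weylGroup n := by
        refine ih (hw.mul hs) ?_ ?_
        · rw [signProd_mul hw hs, signProd_s hn hi.1, hsign, one_mul]
        · have := displacement_mul_s hn hw hi hlt
          push_cast at hN
          linarith
      rwa [← Subgroup.mul_mem_cancel_right _ (s_mem hi)]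

/-- The coefficient of `α_k` in `x`, as the fundamental weights are dual to the simple roots. -/
noncomputable def coef (x : E n) (k : ℕ) : ℝ := x ⬝ᵥ fundWeight n k

theorem coef_add (x y : E n) (k : ℕ) : coef (x + y) k = coef x k + coef y k :=
  add_dotProduct _ _ _

theorem coef_sub (x y : E n) (k : ℕ) : coef (x - y) k = coef x k - coef y k :=
  sub_dotProduct _ _ _

theorem coef_neg (x : E n) (k : ℕ) : coef (-x) k = -coef x k :=
  neg_dotProduct _ _

theorem coef_smul (t : ℝ) (x : E n) (k : ℕ) : coef (t • x) k = t * coef x k :=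
  smul_dotProduct _ _ _

theorem coef_zero (k : ℕ) : coef (0 : E n) k = 0 := zero_dotProduct _

theorem coef_of_gt (x : E n) {k : ℕ} (hk : 3 ≤ k) (hk' : n < k) : coef x k = 0 := by
  have : fundWeight n k = 0 := by
    funext j
    simp only [fundWeight, Pi.zero_apply]
    split_ifs <;> first | omega | rfl
  rw [coef, this, dotProduct_zero]

theorem coef_succ (x : E n) {k : ℕ} (hk : 3 ≤ k) : coef x k = coord x k + coef x (k + 1) := by
  have : fundWeight n k = e n k + fundWeight n (k + 1) := by
    funext j
    simp only [fundWeight, e, Pi.add_apply]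
    split_ifs <;> first | omega | norm_num
  rw [coef, this, dotProduct_add, coord, coef]

theorem coef_one_sub (x : E n) : coef x 1 - coef x 2 = coord x 1 := by
  have : fundWeight n 1 - fundWeight n 2 = e n 1 := by
    funext j
    simp only [fundWeight, e, Pi.sub_apply]
    split_ifs <;> first | omega | norm_num
  rw [coef, coef, ← dotProduct_sub, this, coord]

theorem coef_one_add (x : E n) : coef x 1 + coef x 2 = coord x 2 + coef x 3 := by
  have : fundWeight n 1 + fundWeight n 2 = e n 2 + fundWeight n 3 := by
    funext j
    simp only [fundWeight, e, Pi.add_apply]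
    split_ifs <;> first | omega | norm_num
  rw [coef, coef, ← dotProduct_add, this, dotProduct_add, coord, coef]

theorem coef_simpleRoot (hn : 2 ≤ n) {k : ℕ} (hk : 1 ≤ k) (hi : IsNode n i) :
    coef (simpleRoot n i) k = if (k : ℤ) = i then 1 else 0 := by
  have hpair := simpleRoot_dotProduct_self hn hi
  lift i to ℕ using by omega
  simp only [Nat.cast_inj]
  rw [← fundWeight_pairing n hn k i hk (by omega) (by omega), corootPairing, hpair, coef,
    dotProduct_comm, mul_div_cancel_left₀ _ two_ne_zero]

theorem eq_zero_of_coef {x : E n} (h : ∀ k : ℕ, 1 ≤ k → coef x k = 0) : x = 0 := by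
  refine ext_coord fun k hk => ?_
  lift k to ℕ using by omega
  rw [coord, coord, zero_dotProduct, ← coord]
  obtain rfl | rfl | hk : k = 1 ∨ k = 2 ∨ 3 ≤ k := by omega
  · have := coef_one_sub x
    rwa [h 1 le_rfl, h 2 one_le_two, sub_zero, eq_comm] at this
  · have := coef_one_add x
    rwa [h 1 le_rfl, h 2 one_le_two, h 3 (by norm_num), add_zero, add_zero, eq_comm] at this
  · have := coef_succ x hk
    rwa [h k (by omega), h (k + 1) (by omega), add_zero, eq_comm] at this

theorem eq_of_coef (hn : 2 ≤ n) {x y : E n}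
    (h : ∀ k : ℕ, 1 ≤ k → k ≤ n → coef x k = coef y k) : x = y := by
  refine sub_eq_zero.1 (eq_zero_of_coef fun k hk => ?_)
  rw [coef_sub, sub_eq_zero]
  rcases le_or_gt k n with hkn | hkn
  · exact h k hk hkn
  · rw [coef_of_gt x (by omega) hkn, coef_of_gt y (by omega) hkn]

theorem coef_linearCombination (hn : 2 ≤ n) (c : ℤ → ℝ) {k : ℕ} (hk : 1 ≤ k) (hkn : k ≤ n) :
    coef (∑ i ∈ Finset.Icc (1 : ℤ) n, c i • simpleRoot n i) k = c k := by
  rw [coef, sum_dotProduct, Finset.sum_eq_single (k : ℤ)]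
  · rw [← coef, coef_smul, coef_simpleRoot hn hk (by omega), if_pos rfl, mul_one]
  · intro i hi hik
    rw [← coef, coef_smul, coef_simpleRoot hn hk (Finset.mem_Icc.1 hi), if_neg hik.symm, mul_zero]
  · intro h
    exact absurd (Finset.mem_Icc.2 ⟨by omega, by omega⟩) h

theorem rootNonneg_iff (hn : 2 ≤ n) (x : E n) :
    RootNonneg n x ↔ ∀ k : ℕ, 1 ≤ k → k ≤ n → 0 ≤ coef x k := by
  refine ⟨?_, fun h => ⟨fun i => coef x i.toNat, fun i hi => ?_, ?_⟩⟩
  · rintro ⟨c, hc, rfl⟩ k hk hkn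
    rw [coef_linearCombination hn c hk hkn]
    exact hc _ (Finset.mem_Icc.2 ⟨by omega, by omega⟩)
  · rw [Finset.mem_Icc] at hi
    exact h _ (by omega) (by omega)
  · refine eq_of_coef hn fun k hk hkn => ?_
    rw [coef_linearCombination hn _ hk hkn, Int.toNat_natCast]

theorem rootNonneg_zero (n : ℕ) : RootNonneg n 0 :=
  ⟨0, fun _ _ => le_rfl, by simp only [Pi.zero_apply, zero_smul, Finset.sum_const_zero]⟩

theorem RootNonneg.add (hn : 2 ≤ n) {x y : E n} (hx : RootNonneg n x) (hy : RootNonneg n y) :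
    RootNonneg n (x + y) := by
  rw [rootNonneg_iff hn] at *
  intro k hk hkn
  rw [coef_add]
  exact add_nonneg (hx k hk hkn) (hy k hk hkn)

theorem RootNonneg.smul (hn : 2 ≤ n) {x : E n} {t : ℝ} (ht : 0 ≤ t) (hx : RootNonneg n x) :
    RootNonneg n (t • x) := by
  rw [rootNonneg_iff hn] at *
  intro k hk hkn
  rw [coef_smul]
  exact mul_nonneg ht (hx k hk hkn)

theorem rootNonneg_simpleRoot (hn : 2 ≤ n) (hi : IsNode n i) : RootNonneg n (simpleRoot n i) := by
  rw [rootNonneg_iff hn]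
  intro k hk _
  rw [coef_simpleRoot hn hk hi]
  split_ifs <;> norm_num

theorem coord_fundWeight_sub_lo (hn : 2 ≤ n) (hr : 1 ≤ r) (hi : IsNode n i) :
    coord (fundWeight n r) i - coord (fundWeight n r) (lo i) = if (r : ℤ) = i then 1 else 0 := by
  rw [← coef_simpleRoot hn hr hi, coef, dotProduct_comm, dotProduct_simpleRoot]

theorem toLex_coord_fundWeight_lt (hn : 2 ≤ n) (hr : 1 ≤ r) (hw : IsSigned n w)
    (hpos : ∀ i, IsNode n i → i ≠ r → w (lo i) < w i) (hab : IsRootPair n a b) (h : b < a) :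
    toLex (coord (fundWeight n r) b, w b) < toLex (coord (fundWeight n r) a, w a) := by
  refine lt_of_lo_lt (f := fun k => toLex (coord (fundWeight n r) k, w k))
    (fun k => ?_) (fun i hi => ?_) hab h
  · rw [coord_neg_right, hw.1]
    rfl
  · have hsub := coord_fundWeight_sub_lo hn hr hi
    rw [Prod.Lex.toLex_lt_toLex]
    split_ifs at hsub with hri
    · exact .inl (by linarith)
    · exact .inr ⟨by linarith, hpos i hi (Ne.symm hri)⟩

theorem coord_fundWeight_mono (hn : 2 ≤ n) (hr : 1 ≤ r) (hab : IsRootPair n a b) (h : b < a) :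
    coord (fundWeight n r) b ≤ coord (fundWeight n r) a := by
  have := toLex_coord_fundWeight_lt hn hr (.one n) (fun i _ _ => lo_lt i) hab h
  rw [Prod.Lex.toLex_lt_toLex] at this
  exact this.elim le_of_lt fun h => h.1.le

theorem rootNonneg_e_sub_e (hn : 2 ≤ n) (hab : IsRootPair n a b) (h : b < a) :
    RootNonneg n (e n a - e n b) := by
  rw [rootNonneg_iff hn]
  intro k hk _
  rw [coef, dotProduct_comm, dotProduct_sub, ← coord, ← coord, sub_nonneg]
  exact coord_fundWeight_mono hn hk hab h

theorem conj_s_eq_of_pair (hg : IsSigned n g) (hi : 1 ≤ i) (hj : 1 ≤ j)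
    (h : (g i = j ∧ g (lo i) = lo j) ∨ (g i = -lo j ∧ g (lo i) = -j)) :
    g * s i * g⁻¹ = s j := by
  rw [mul_inv_eq_iff_eq_mul]
  ext x
  rw [Equiv.Perm.mul_apply, Equiv.Perm.mul_apply, s_apply hi, s_apply hj]
  rcases h with ⟨hgi, hglo⟩ | ⟨hgi, hglo⟩
  · rw [← hglo, ← hgi, ← hg.1, ← hg.1]
    simp only [g.injective.eq_iff]
    split_ifs <;> rfl
  · have hlo : lo j = g (-i) := by rw [hg.1, hgi, neg_neg]
    have hj : j = g (-lo i) := by rw [hg.1, hglo, neg_neg]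
    have := lo_cases i
    rw [hlo, hj, ← hg.1, ← hg.1, neg_neg, neg_neg]
    simp only [g.injective.eq_iff]
    split_ifs <;> first | rfl | omega

theorem exchange_condition (hn : 2 ≤ n) (hi : IsNode n i) (l : List ℤ) (hl : ∀ j ∈ l, IsNode n j)
    (hg : IsSigned n g) (hlt : g (lo i) < g i)
    (hinv : (l.map s).prod⁻¹ (g i) < (l.map s).prod⁻¹ (g (lo i))) :
    ∃ l' : List ℤ, (∀ j ∈ l', IsNode n j) ∧ l'.length + 1 = l.length ∧
      (l'.map s).prod = g * s i * g⁻¹ * (l.map s).prod := by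
  induction l generalizing g with
  | nil => exact absurd hinv hlt.not_gt
  | cons j l ih =>
    obtain ⟨hj, hl⟩ := List.forall_mem_cons.1 hl
    by_cases hc : (g (lo i) = lo j ∧ g i = j) ∨ (g (lo i) = -j ∧ g i = -lo j)
    · refine ⟨l, hl, rfl, ?_⟩
      rw [conj_s_eq_of_pair hg hi.1 hj.1 (by tauto), List.map_cons, List.prod_cons, ← mul_assoc,
        s_mul_s hj.1, one_mul]
    · have hroot := hg.isRootPair (isRootPair_lo hn hi)
      have hlt' : s j (g (lo i)) < s j (g i) :=
        s_lt_s hj.1 hroot hlt (by tauto) (by tauto)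
      rw [List.map_cons, List.prod_cons, mul_inv_rev, s_inv hj.1] at hinv
      obtain ⟨l', hl', hlen, hprod⟩ := ih hl ((isSigned_s hn hj).mul hg) hlt' hinv
      refine ⟨j :: l', List.forall_mem_cons.2 ⟨hj, hl'⟩, by
        rw [List.length_cons, List.length_cons, hlen], ?_⟩
      rw [List.map_cons, List.prod_cons, hprod, List.map_cons, List.prod_cons, mul_inv_rev,
        s_inv hj.1]
      simp only [← mul_assoc, s_mul_s hj.1, one_mul]

theorem exists_word (hw : w ∈ weylGroup n) :
    ∃ l : List ℤ, (∀ i ∈ l, IsNode n i) ∧ (l.map s).prod = w := by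
  have hinv : ∀ t ∈ {t | ∃ i : ℤ, 1 ≤ i ∧ i ≤ n ∧ t = s i}, t⁻¹ = t := by
    rintro _ ⟨i, hi, -, rfl⟩
    exact s_inv hi
  induction hw using Subgroup.closure_induction'' with
  | mem x hx =>
    obtain ⟨i, hi, hin, rfl⟩ := hx
    exact ⟨[i], List.forall_mem_singleton.2 ⟨hi, hin⟩, List.prod_singleton⟩
  | inv_mem x hx =>
    rw [hinv x hx]
    obtain ⟨i, hi, hin, rfl⟩ := hx
    exact ⟨[i], List.forall_mem_singleton.2 ⟨hi, hin⟩, List.prod_singleton⟩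
  | one => exact ⟨[], List.forall_mem_nil _, rfl⟩
  | mul x y _ _ hx hy =>
    obtain ⟨l, hl, rfl⟩ := hx
    obtain ⟨l', hl', rfl⟩ := hy
    exact ⟨l ++ l', List.forall_mem_append.2 ⟨hl, hl'⟩, by rw [List.map_append, List.prod_append]⟩

theorem length_conj_s_mul_lt (hn : 2 ≤ n) (hu : u ∈ weylGroup n) (hg : IsSigned n g)
    (hi : IsNode n i) (hlt : g (lo i) < g i) (hinv : u⁻¹ (g i) < u⁻¹ (g (lo i))) :
    length n (g * s i * g⁻¹ * u) < length n u := by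
  obtain ⟨l₀, hl₀, hu₀⟩ := exists_word hu
  obtain ⟨l, hl, rfl, hlen⟩ : length n u ∈ {k | ∃ l : List ℤ, (∀ i ∈ l, 1 ≤ i ∧ i ≤ n) ∧
      (l.map s).prod = u ∧ l.length = k} := Nat.sInf_mem ⟨l₀.length, l₀, hl₀, hu₀, rfl⟩
  obtain ⟨l', hl', hlen', hprod⟩ := exchange_condition hn hi l hl hg hlt hinv
  have : length n (g * s i * g⁻¹ * (l.map s).prod) ≤ l'.length :=
    Nat.sInf_le ⟨l', hl', hprod, rfl⟩
  omega

theorem exists_lt_of_mem_reflections (hn : 2 ≤ n) {t : Equiv.Perm ℤ} (ht : t ∈ reflections n) :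
    ∃ g ∈ weylGroup n, ∃ i, IsNode n i ∧ g (lo i) < g i ∧ t = g * s i * g⁻¹ := by
  obtain ⟨g, hg, i, hi, hin, rfl⟩ := ht
  rcases lt_or_gt_of_ne
    ((isSigned_of_mem hn hg).isRootPair (isRootPair_lo hn ⟨hi, hin⟩)).2.2.1 with h | h
  · refine ⟨g * s i, mul_mem hg (s_mem ⟨hi, hin⟩), i, ⟨hi, hin⟩, ?_, ?_⟩
    · rwa [Equiv.Perm.mul_apply, Equiv.Perm.mul_apply, s_self_apply hi, s_lo_apply hi]
    · rw [mul_inv_rev, s_inv hi, mul_assoc (g * s i), ← mul_assoc (s i) (s i), s_mul_s hi,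
        one_mul]
  · exact ⟨g, hg, i, ⟨hi, hin⟩, h, rfl⟩

theorem rootNonneg_act_sub_act_conj_s_mul (hn : 2 ≤ n) (hr : 1 ≤ r) (hu : u ∈ weylGroup n)
    (hg : IsSigned n g) (hi : IsNode n i) (hlt : g (lo i) < g i)
    (hlen : length n u < length n (g * s i * g⁻¹ * u)) :
    RootNonneg n (act n u (fundWeight n r) - act n (g * s i * g⁻¹ * u) (fundWeight n r)) := by
  have hsu := isSigned_of_mem hn hu
  have hroot := hg.isRootPair (isRootPair_lo hn hi)
  have hroot' := hsu.inv.isRootPair hroot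
  have hlt' : u⁻¹ (g (lo i)) < u⁻¹ (g i) := by
    by_contra h
    exact hlen.not_gt (length_conj_s_mul_lt hn hu hg hi hlt (by omega))
  rw [act_mul ((hg.mul (isSigned_s hn hi)).mul hg.inv) hsu, act_conj_s hn hg hi, sub_sub_cancel]
  refine RootNonneg.smul hn ?_ (rootNonneg_e_sub_e hn hroot hlt)
  rw [coord_act hsu _ hroot.1, coord_act hsu _ hroot.2.1, sub_nonneg]
  exact coord_fundWeight_mono hn hr hroot' hlt'

theorem BruhatLE.rootNonneg (hn : 2 ≤ n) (hr : 1 ≤ r) {v : Equiv.Perm ℤ} (hu : u ∈ weylGroup n)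
    (h : BruhatLE n u v) :
    RootNonneg n (act n u (fundWeight n r) - act n v (fundWeight n r)) := by
  suffices h' : v ∈ weylGroup n ∧
      RootNonneg n (act n u (fundWeight n r) - act n v (fundWeight n r)) from h'.2
  unfold BruhatLE at h
  induction h with
  | refl =>
    rw [sub_self]
    exact ⟨hu, rootNonneg_zero n⟩
  | tail _ hstep ih =>
    obtain ⟨hlen, t, ht, rfl⟩ := hstep
    obtain ⟨g, hg, i, hi, hlt, rfl⟩ := exists_lt_of_mem_reflections hn ht
    refine ⟨mul_mem (mul_mem (mul_mem hg (s_mem hi)) (inv_mem hg)) ih.1, ?_⟩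
    have hadd := ih.2.add hn
      (rootNonneg_act_sub_act_conj_s_mul hn hr ih.1 (isSigned_of_mem hn hg) hi hlt hlen)
    rwa [sub_add_sub_cancel] at hadd

theorem eq_of_act_fundWeight_eq (hn : 2 ≤ n) (hr : 1 ≤ r) (hu : u ∈ minReps n r)
    (hw : w ∈ minReps n r) (h : act n u (fundWeight n r) = act n w (fundWeight n r)) : u = w := by
  rw [mem_minReps_iff hn] at hu hw
  have hsu := isSigned_of_mem hn hu.1
  have hsw := isSigned_of_mem hn hw.1
  have hg : w⁻¹ * u ∈ weylGroup n := mul_mem (inv_mem hw.1) hu.1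
  have hsg := isSigned_of_mem hn hg
  have hfix : ∀ {a}, InRange n a →
      coord (fundWeight n r) ((w⁻¹ * u) a) = coord (fundWeight n r) a := fun ha => by
    rw [← coord_act_apply hsu _ ha, h, coord_act hsw _ (hsu.inRange ha), Equiv.Perm.mul_apply]
  refine (inv_mul_eq_one.1 (eq_one_of_lo_lt hn hsg (signProd_of_mem hn hg) fun i hi => ?_)).symm
  have hroot := isRootPair_lo hn hi
  have hroot' := hsg.isRootPair hroot
  by_contra hle
  have hltw := toLex_coord_fundWeight_lt hn hr hsw hw.2 hroot'.symm (by omega)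
  rw [hfix hroot.1, hfix hroot.2.1, Equiv.Perm.mul_apply, Equiv.Perm.mul_apply,
    apply_inv_apply, apply_inv_apply] at hltw
  exact hltw.not_gt (toLex_coord_fundWeight_lt hn hr hsu hu.2 hroot (lo_lt i))

theorem inv_lt_inv_lo (hn : 2 ≤ n) (hr : 1 ≤ r) (hw : w ∈ weylGroup n) (hi : IsNode n i)
    (hlt : coord (act n w (fundWeight n r)) i < coord (act n w (fundWeight n r)) (lo i)) :
    w⁻¹ i < w⁻¹ (lo i) := by
  have hsw := isSigned_of_mem hn hw
  have hroot := isRootPair_lo hn hi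
  have hroot' := hsw.inv.isRootPair hroot
  rw [coord_act hsw _ hroot.1, coord_act hsw _ hroot.2.1] at hlt
  by_contra hle
  exact hlt.not_ge (coord_fundWeight_mono hn hr hroot' (by omega))

theorem s_mul_mem_minReps (hn : 2 ≤ n) (hr : 1 ≤ r) (hw : w ∈ minReps n r) (hi : IsNode n i)
    (hlt : coord (act n w (fundWeight n r)) i < coord (act n w (fundWeight n r)) (lo i)) :
    s i * w ∈ minReps n r := by
  rw [mem_minReps_iff hn] at hw ⊢
  have hsw := isSigned_of_mem hn hw.1
  have hinv := inv_lt_inv_lo hn hr hw.1 hi hlt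
  refine ⟨mul_mem (s_mem hi) hw.1, fun j hj hjr => ?_⟩
  have := lo_lt j
  refine s_lt_s hi.1 (hsw.isRootPair (isRootPair_lo hn hj)) (hw.2 j hj hjr) ?_ ?_
  · rintro ⟨hlo, hj⟩
    rw [← hlo, ← hj, inv_apply_apply, inv_apply_apply] at hinv
    omega
  · rintro ⟨hlo, hj⟩
    rw [eq_neg_iff_add_eq_zero, add_comm, ← eq_neg_iff_add_eq_zero, ← hsw.1] at hlo hj
    rw [hj, hlo, inv_apply_apply, inv_apply_apply] at hinv
    omega

theorem bruhatLE_s_mul (hn : 2 ≤ n) (hr : 1 ≤ r) (hw : w ∈ weylGroup n) (hi : IsNode n i)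
    (hlt : coord (act n w (fundWeight n r)) i < coord (act n w (fundWeight n r)) (lo i)) :
    BruhatLE n (s i * w) w := by
  have hone : (1 : Equiv.Perm ℤ) * s i * 1⁻¹ = s i := by rw [one_mul, inv_one, mul_one]
  have hlen := length_conj_s_mul_lt hn hw (.one n) hi (lo_lt i) (inv_lt_inv_lo hn hr hw hi hlt)
  rw [hone] at hlen
  refine .single ⟨hlen, s i, ⟨1, one_mem _, i, hi.1, hi.2, hone.symm⟩, ?_⟩
  rw [← mul_assoc, s_mul_s hi.1, one_mul]

/-- All coordinates of `x` are `-1`, `0` or `1`, as for the weights in the orbits of `ω_r`, `r ≥ 3`,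
and of `2 ω_1` and `2 ω_2`. -/
def IsSmall (x : E n) : Prop :=
  ∀ k : ℤ, IsNode n k → coord x k = -1 ∨ coord x k = 0 ∨ coord x k = 1

theorem IsSmall.of_inRange {x : E n} (hx : IsSmall x) (ha : InRange n a) :
    coord x a = -1 ∨ coord x a = 0 ∨ coord x a = 1 := by
  rcases lt_or_gt_of_ne ha.1 with h | h
  · have := hx (-a) (by omega)
    rw [coord_neg_right] at this
    rcases this with h | h | h
    · exact Or.inr (Or.inr (by linarith))
    · exact Or.inr (Or.inl (by linarith))
    · exact Or.inl (by linarith)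
  · exact hx a (by omega)

theorem IsSmall.sub_lo_le (hn : 2 ≤ n) {x : E n} (hx : IsSmall x) (hi : IsNode n i)
    (h : coord x i < coord x (lo i)) : coord x i - coord x (lo i) ≤ -1 := by
  rcases hx.of_inRange hi.inRange with h1 | h1 | h1 <;>
    rcases hx.of_inRange (isRootPair_lo hn hi).2.1 with h2 | h2 | h2 <;> rw [h1, h2] at h ⊢ <;>
    linarith

theorem rootNonneg_neg_iff (hn : 2 ≤ n) (x : E n) :
    RootNonneg n (-x) ↔ ∀ k : ℕ, 1 ≤ k → k ≤ n → coef x k ≤ 0 := by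
  simp only [rootNonneg_iff hn, coef_neg, Left.nonneg_neg_iff]

theorem rootNonneg_smul_iff (hn : 2 ≤ n) {t : ℝ} (ht : 0 < t) {x : E n} :
    RootNonneg n (t • x) ↔ RootNonneg n x := by
  simp only [rootNonneg_iff hn, coef_smul, mul_nonneg_iff_of_pos_left ht]

theorem RootNonneg.antisymm (hn : 2 ≤ n) {x y : E n} (h : RootNonneg n (x - y))
    (h' : RootNonneg n (y - x)) : x = y := by
  rw [rootNonneg_iff hn] at h h'
  refine eq_of_coef hn fun k h1 h2 => le_antisymm ?_ ?_
  · simpa only [coef_sub, sub_nonneg] using h' k h1 h2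
  · simpa only [coef_sub, sub_nonneg] using h k h1 h2

theorem coef_act_s (hn : 2 ≤ n) (hi : IsNode n i) (x : E n) {k : ℕ} (hk : 1 ≤ k) :
    coef (act n (s i) x) k
      = coef x k - if (k : ℤ) = i then coord x i - coord x (lo i) else 0 := by
  rw [act_s hn hi, coef_sub, coef_smul, coef_simpleRoot hn hk hi, mul_ite, mul_one, mul_zero]

theorem rootNonneg_neg_act_s_iff (hn : 2 ≤ n) {x : E n} (hx : RootNonneg n (-x)) {i : ℕ}
    (hi : IsNode n i) :
    RootNonneg n (-act n (s i) x) ↔ coef x i ≤ coord x i - coord x (lo i) := by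
  rw [rootNonneg_neg_iff hn] at hx ⊢
  constructor
  · intro h
    have := h i (by omega) (by omega)
    rwa [coef_act_s hn hi x (by omega), if_pos rfl, sub_nonpos] at this
  · intro h k hk hk'
    rw [coef_act_s hn hi x hk]
    split_ifs with hki
    · rw [Nat.cast_inj] at hki
      subst hki
      exact sub_nonpos.2 h
    · simpa only [sub_zero] using hx k hk hk'

/-- A small weight `x ≤ 0` which leaves the cone of weights `≤ 0` under every simple reflection
raising it. These are the candidates for the weights of minimal elements. -/
structure IsTop (x : E n) : Prop where
  small : IsSmall x
  nonpos : RootNonneg n (-x)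
  no_lift : ∀ i : ℕ, IsNode n i → coord x i < coord x (lo i) →
    ¬ RootNonneg n (-act n (s i) x)

namespace IsTop

variable {x : E n}

theorem coef_nonpos (hn : 2 ≤ n) (hx : IsTop x) {k : ℕ} (hk : IsNode n k) : coef x k ≤ 0 :=
  (rootNonneg_neg_iff hn x).1 hx.nonpos k (by omega) (by omega)

theorem lt_coef (hn : 2 ≤ n) (hx : IsTop x) {i : ℕ} (hi : IsNode n i)
    (h : coord x i < coord x (lo i)) : coord x i - coord x (lo i) < coef x i := by
  have := hx.no_lift i hi h
  rwa [rootNonneg_neg_act_s_iff hn hx.nonpos hi, not_le] at this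

theorem lt_coef_one (hn : 2 ≤ n) (hx : IsTop x) (h : coord x 1 < -coord x 2) :
    coord x 1 + coord x 2 < coef x 1 := by
  have := hx.lt_coef hn (i := 1) (by omega)
  rw [show lo ((1 : ℕ) : ℤ) = -2 from rfl, coord_neg_right, sub_neg_eq_add, Nat.cast_one] at this
  exact this h

theorem lt_coef_succ (hn : 2 ≤ n) (hx : IsTop x) {k : ℕ} (hk : 1 ≤ k) (hk' : k + 1 ≤ n)
    (h : coord x (k + 1) < coord x k) : coord x (k + 1) - coord x k < coef x (k + 1) := by
  have := hx.lt_coef hn (i := k + 1) (by omega)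
  rw [show lo ((k + 1 : ℕ) : ℤ) = k by have := lo_cases (k + 1 : ℕ); omega, Nat.cast_succ] at this
  exact this h

theorem neg_two_lt_coef_three (hn : 3 ≤ n) (hx : IsTop x) (h : coord x 3 = -1) :
    -2 < coef x 3 := by
  by_contra! hlt
  have hadd := coef_one_add x
  have hsub := coef_one_sub x
  have hlift1 := hx.lt_coef_one (by omega)
  have hlift2 := hx.lt_coef_succ (by omega) (k := 1) le_rfl (by omega)
  have hlift3 := hx.lt_coef_succ (by omega) (k := 2) (by omega) (by omega)
  norm_num at hlift2 hlift3
  rcases hx.small 2 (by omega) with h2 | h2 | h2 <;> rw [h2] at hadd hlift1 hlift2 hlift3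
  · rcases hx.small 1 (by omega) with h1 | h1 | h1 <;> rw [h1] at hsub hlift1 hlift2 <;>
      norm_num at * <;> linarith
  all_goals
    rw [h] at hlift3
    norm_num at hlift3
    linarith

/-- Otherwise the run of `-1`s could be followed down to the third coordinate. -/
theorem neg_two_lt_coef (hn : 3 ≤ n) (hx : IsTop x) {k : ℕ} (hk : 3 ≤ k) (hkn : k ≤ n)
    (h : coord x k = -1) : -2 < coef x k := by
  induction k, hk using Nat.le_induction with
  | base => exact hx.neg_two_lt_coef_three hn h
  | succ k hk ih =>
    by_contra! hlt
    have hlift := hx.lt_coef_succ (by omega) (by omega) hkn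
    have hsucc := coef_succ x hk
    rw [Nat.cast_succ] at h
    rw [h] at hlift
    rcases hx.small k (by omega) with hk1 | hk1 | hk1
    · linarith [ih (by omega) hk1]
    all_goals
      rw [hk1] at hlift
      norm_num at hlift
      linarith

theorem coef_of_three_le (hn : 3 ≤ n) (hx : IsTop x) {k : ℕ} (hk : 3 ≤ k) :
    coef x k = 0 ∨ (coef x k = -1 ∧ coef x (k + 1) = 0) := by
  rcases lt_or_ge n k with hkn | hkn
  · exact Or.inl (coef_of_gt x hk hkn)
  have hsmall := hx.small k (by omega)
  have hsucc := coef_succ x hk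
  have hnonpos := hx.coef_nonpos (by omega) (k := k) (by omega)
  rcases hx.coef_of_three_le hn (k := k + 1) (by omega) with h | ⟨h, h'⟩
  · rcases hsmall with hk1 | hk1 | hk1
    · exact Or.inr ⟨by linarith, h⟩
    · exact Or.inl (by linarith)
    · linarith
  · rcases hsmall with hk1 | hk1 | hk1
    · linarith [hx.neg_two_lt_coef hn hk hkn hk1]
    · have hkn' : k + 1 ≤ n := by
        by_contra! hc
        linarith [coef_of_gt x (k := k + 1) (by omega) hc]
      have hsucc' := coef_succ x (k := k + 1) (by omega)
      have hlift := hx.lt_coef_succ (by omega) (by omega) hkn'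
      rw [Nat.cast_succ] at hsucc'
      linarith [hlift (by linarith)]
    · exact Or.inl (by linarith)
termination_by n + 1 - k

theorem end_cases_of_coef_three_eq_zero (hn : 3 ≤ n) (hx : IsTop x) (h : coef x 3 = 0) :
    (coef x 1 = 0 ∧ coef x 2 = 0) ∨ (coef x 1 = -1 ∧ coef x 2 = 0) ∨
      (coef x 1 = 0 ∧ coef x 2 = -1) ∨ (coef x 1 = -1 / 2 ∧ coef x 2 = -1 / 2) := by
  have hadd := coef_one_add x
  have hsub := coef_one_sub x
  have hnonpos1 := hx.coef_nonpos (by omega) (k := 1) (by omega)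
  have hnonpos2 := hx.coef_nonpos (by omega) (k := 2) (by omega)
  rcases hx.small 2 (by omega) with h2 | h2 | h2 <;>
    rcases hx.small 1 (by omega) with h1 | h1 | h1
  · exact Or.inr (Or.inl ⟨by linarith, by linarith⟩)
  · exact Or.inr (Or.inr (Or.inr ⟨by linarith, by linarith⟩))
  · exact Or.inr (Or.inr (Or.inl ⟨by linarith, by linarith⟩))
  · linarith
  · exact Or.inl ⟨by linarith, by linarith⟩
  all_goals linarith

theorem end_cases_of_coef_three_eq_neg_one (hn : 3 ≤ n) (hx : IsTop x) (h : coef x 3 = -1)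
    (h' : coef x 4 = 0) :
    (coef x 1 = 0 ∧ coef x 2 = 0) ∨ (coef x 1 = -3 / 2 ∧ coef x 2 = -1 / 2) ∨
      (coef x 1 = -1 / 2 ∧ coef x 2 = -3 / 2) := by
  have hadd := coef_one_add x
  have hsub := coef_one_sub x
  have hnonpos1 := hx.coef_nonpos (by omega) (k := 1) (by omega)
  have hnonpos2 := hx.coef_nonpos (by omega) (k := 2) (by omega)
  have hlift2 := hx.lt_coef_succ (by omega) (k := 1) le_rfl (by omega)
  have hlift3 := hx.lt_coef_succ (by omega) (k := 2) (by omega) (by omega)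
  have h3 : coord x 3 = -1 := by
    have := coef_succ x (k := 3) le_rfl
    norm_num at this
    linarith
  norm_num at hlift2 hlift3
  rcases hx.small 2 (by omega) with h2 | h2 | h2
  · rcases hx.small 1 (by omega) with h1 | h1 | h1
    · exact Or.inr (Or.inl ⟨by linarith, by linarith⟩)
    · linarith [hlift2 (by linarith)]
    · exact Or.inr (Or.inr ⟨by linarith, by linarith⟩)
  · linarith [hlift3 (by linarith)]
  · rcases hx.small 1 (by omega) with h1 | - | h1
    · linarith
    · exact Or.inl ⟨by linarith, by linarith⟩
    · linarith

end IsTop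

/-- A set of small weights stable under the simple reflections. -/
structure IsStable (X : Set (E n)) : Prop where
  small : ∀ x ∈ X, IsSmall x
  act_s_mem : ∀ x ∈ X, ∀ i : ℤ, IsNode n i → act n (s i) x ∈ X

theorem IsStable.act_mem (hn : 2 ≤ n) {X : Set (E n)} (hX : IsStable X) (hw : w ∈ weylGroup n)
    {x : E n} (hx : x ∈ X) : act n w x ∈ X := by
  obtain ⟨l, hl, rfl⟩ := exists_word hw
  induction l with
  | nil => simpa only [List.map_nil, List.prod_nil, act_one] using hx
  | cons i l ih =>
    rw [List.forall_mem_cons] at hl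
    have hmem : (l.map s).prod ∈ weylGroup n :=
      Subgroup.list_prod_mem _ (List.forall_mem_map.2 fun j hj => s_mem (hl.2 j hj))
    rw [List.map_cons, List.prod_cons, act_mul (isSigned_s hn hl.1) (isSigned_of_mem hn hmem)]
    exact hX.act_s_mem _ (ih hl.2 hmem) i hl.1

theorem sum_coef_act_s (hn : 2 ≤ n) {i : ℕ} (hi : IsNode n i) (x : E n) :
    ∑ k ∈ Finset.Icc 1 n, coef (act n (s i) x) k
      = ∑ k ∈ Finset.Icc 1 n, coef x k - (coord x i - coord x (lo i)) := by
  rw [Finset.sum_congr rfl fun k hk => coef_act_s hn hi x (Finset.mem_Icc.1 hk).1,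
    Finset.sum_sub_distrib]
  simp only [Nat.cast_inj]
  rw [Finset.sum_ite_eq', if_pos (Finset.mem_Icc.2 (by omega))]

theorem IsStable.exists_isTop (hn : 2 ≤ n) {X : Set (E n)} (hX : IsStable X) {x : E n}
    (hx : x ∈ X) (hneg : RootNonneg n (-x)) : ∃ y ∈ X, IsTop y ∧ RootNonneg n (y - x) := by
  obtain ⟨N, hN⟩ := exists_nat_gt (-∑ k ∈ Finset.Icc 1 n, coef x k)
  induction N generalizing x with
  | zero =>
    have : ∑ k ∈ Finset.Icc 1 n, coef x k ≤ 0 := Finset.sum_nonpos fun k hk =>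
      (rootNonneg_neg_iff hn x).1 hneg k (Finset.mem_Icc.1 hk).1 (Finset.mem_Icc.1 hk).2
    rw [Nat.cast_zero] at hN
    linarith
  | succ N ih =>
    by_cases hl : ∀ i : ℕ, IsNode n i → coord x i < coord x (lo i) →
        ¬ RootNonneg n (-act n (s i) x)
    · exact ⟨x, hx, ⟨hX.small x hx, hneg, hl⟩, by simpa only [sub_self] using rootNonneg_zero n⟩
    push Not at hl
    obtain ⟨i, hi, hlt, hneg'⟩ := hl
    have hle := (hX.small x hx).sub_lo_le hn hi hlt
    obtain ⟨y, hy, htop, hyx⟩ := ih (hX.act_s_mem x hx i hi) hneg' (by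
      rw [sum_coef_act_s hn hi]
      rw [Nat.cast_succ] at hN
      linarith)
    refine ⟨y, hy, htop, ?_⟩
    have hstep : RootNonneg n (act n (s i) x - x) := by
      rw [act_s hn hi, sub_sub_cancel_left, ← neg_smul]
      exact (rootNonneg_simpleRoot hn hi).smul hn (by linarith)
    simpa only [sub_add_sub_cancel] using hyx.add hn hstep

theorem IsStable.eq_of_maximal_top (hn : 2 ≤ n) {X : Set (E n)} (hX : IsStable X) {y : E n}
    (hy : ∀ z ∈ X, IsTop z → RootNonneg n (z - y) → z = y) {x : E n} (hx : x ∈ X)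
    (hneg : RootNonneg n (-x)) (hle : RootNonneg n (x - y)) : x = y := by
  obtain ⟨z, hz, htop, hzx⟩ := hX.exists_isTop hn hx hneg
  obtain rfl := hy z hz htop (by simpa only [sub_add_sub_cancel] using hzx.add hn hle)
  exact hle.antisymm hn hzx

theorem act_smul (w : Equiv.Perm ℤ) (t : ℝ) (x : E n) : act n w (t • x) = t • act n w x := by
  simp only [act, Pi.smul_apply, smul_assoc, Finset.smul_sum]

theorem act_neg (w : Equiv.Perm ℤ) (x : E n) : act n w (-x) = -act n w x := by
  simpa only [neg_one_smul] using act_smul w (-1) x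

theorem isMinimalNonpos_of_weight (hn : 2 ≤ n) (hr : 1 ≤ r) {X : Set (E n)} (hX : IsStable X)
    {κ : ℝ} (hκ : 0 < κ) (hmem : κ • fundWeight n r ∈ X) (hw : w ∈ minReps n r)
    (hneg : RootNonneg n (-act n w (fundWeight n r)))
    (hy : ∀ z ∈ X, IsTop z → RootNonneg n (z - κ • act n w (fundWeight n r)) →
      z = κ • act n w (fundWeight n r)) : IsMinimalNonpos n r w := by
  refine ⟨⟨hw, hneg⟩, fun u hu hneg_u hle => eq_of_act_fundWeight_eq hn hr hu hw ?_⟩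
  refine (smul_right_inj hκ.ne').1 (hX.eq_of_maximal_top hn hy ?_ ?_ ?_)
  · rw [← act_smul]
    exact hX.act_mem hn hu.1 hmem
  · rwa [← smul_neg, rootNonneg_smul_iff hn hκ]
  · rw [← smul_sub, rootNonneg_smul_iff hn hκ]
    exact hle.rootNonneg hn hr hu.1

theorem isMaximalNonneg_of_weight (hn : 2 ≤ n) (hr : 1 ≤ r) {X : Set (E n)} (hX : IsStable X)
    (hmem : -fundWeight n r ∈ X) (hw : w ∈ minReps n r)
    (hneg : RootNonneg n (act n w (fundWeight n r)))
    (hy : ∀ z ∈ X, IsTop z → RootNonneg n (z - -act n w (fundWeight n r)) →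
      z = -act n w (fundWeight n r)) : IsMaximalNonneg n r w := by
  refine ⟨⟨hw, hneg⟩, fun u hu hneg_u hle => eq_of_act_fundWeight_eq hn hr hu hw ?_⟩
  refine neg_injective (hX.eq_of_maximal_top hn hy ?_ ?_ ?_)
  · rw [← act_neg]
    exact hX.act_mem hn hu.1 hmem
  · rwa [neg_neg]
  · rw [neg_sub_neg]
    exact hle.rootNonneg hn hr hw.1

theorem IsMinimalNonpos.isTop (hn : 2 ≤ n) (hr : 1 ≤ r) {κ : ℝ} (hκ : 0 < κ)
    (hw : IsMinimalNonpos n r w) (hsmall : IsSmall (κ • act n w (fundWeight n r))) :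
    IsTop (κ • act n w (fundWeight n r)) := by
  obtain ⟨⟨hmem, hneg⟩, hmin⟩ := hw
  refine ⟨hsmall, by rwa [← smul_neg, rootNonneg_smul_iff hn hκ], fun i hi hlt hneg' => ?_⟩
  simp only [coord_smul] at hlt
  rw [act_smul, ← smul_neg, rootNonneg_smul_iff hn hκ,
    ← act_mul (isSigned_s hn hi) (isSigned_of_mem hn hmem.1)] at hneg'
  have hlt' := lt_of_mul_lt_mul_left hlt hκ.le
  have hs : s i = 1 := mul_eq_right.1
    (hmin _ (s_mul_mem_minReps hn hr hmem hi hlt') hneg' (bruhatLE_s_mul hn hr hmem.1 hi hlt'))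
  have := s_self_apply hi.1
  rw [hs, Equiv.Perm.one_apply] at this
  exact (lo_lt i).ne' this

/-- Lists over `ℤ` such as `interval a n` are built from `List.range`, coerced through the `List`
monad. -/
theorem list_natCast_eq_map (l : List ℕ) :
    (do let j ← l; pure (j : ℤ)) = l.map fun j : ℕ => (j : ℤ) :=
  List.map_eq_flatMap.symm

theorem interval_eq_map (a n : ℕ) :
    interval a n = (List.range (n + 1 - a)).map fun j : ℕ => (a : ℤ) + j := by
  rw [interval, list_natCast_eq_map, List.map_map]
  rfl

theorem mem_interval {a n : ℕ} {x : ℤ} : x ∈ interval a n ↔ (a : ℤ) ≤ x ∧ x ≤ n := by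
  simp only [interval_eq_map, List.mem_map, List.mem_range]
  constructor
  · rintro ⟨j, hj, rfl⟩
    omega
  · intro h
    exact ⟨(x - a).toNat, by omega, by omega⟩

theorem pairwise_interval (a n : ℕ) : (interval a n).Pairwise (· < ·) := by
  rw [interval_eq_map, List.pairwise_map]
  exact List.pairwise_lt_range.imp fun h => by omega

theorem length_interval (a n : ℕ) : (interval a n).length = n + 1 - a := by
  rw [interval_eq_map, List.length_map, List.length_range]

theorem pairwise_of_mem_J {p : ℕ} {l : List ℤ} (hl : l ∈ J p a b) :
    l.Pairwise fun x y => x + 2 ≤ y := by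
  have : IsTrans ℤ fun x y => x + 2 ≤ y := ⟨fun x y z hxy hyz => by omega⟩
  exact List.isChain_iff_pairwise.1 hl.2.2

theorem rootSum_nil (n : ℕ) : rootSum n [] = 0 := rfl

theorem rootSum_cons (n : ℕ) (i : ℤ) (l : List ℤ) :
    rootSum n (i :: l) = simpleRoot n i + rootSum n l := rfl

theorem coef_rootSum (hn : 2 ≤ n) {k : ℕ} (hk : 1 ≤ k) {l : List ℤ} (hl : ∀ x ∈ l, IsNode n x) :
    coef (rootSum n l) k = l.count (k : ℤ) := by
  induction l with
  | nil => rw [rootSum_nil, coef_zero, List.count_nil, Nat.cast_zero]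
  | cons i l ih =>
    rw [List.forall_mem_cons] at hl
    rw [rootSum_cons, coef_add, coef_simpleRoot hn hk hl.1, ih hl.2, List.count_cons]
    simp only [beq_iff_eq, eq_comm (a := i)]
    split_ifs <;> push_cast <;> ring

theorem exists_mem_J_of_coef (hn : 2 ≤ n) {a : ℕ} (ha : 1 ≤ a) {x : E n}
    (hx : ∀ k : ℕ, a ≤ k → coef x k = 0 ∨ (coef x k = -1 ∧ coef x (k + 1) = 0)) :
    ∃ p, ∃ l ∈ J p a n, ∀ k : ℕ, 1 ≤ k → k ≤ n →
      coef (rootSum n l) k = if a ≤ k then -coef x k else 0 := by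
  classical
  let l := (interval a n).filter fun k => coef x k.toNat = -1
  have hmem : ∀ k : ℤ, k ∈ l ↔ ((a : ℤ) ≤ k ∧ k ≤ n) ∧ coef x k.toNat = -1 := by
    intro k
    simp only [l, List.mem_filter, mem_interval, decide_eq_true_eq]
  have hlt : l.Pairwise (· < ·) := (pairwise_interval a n).filter _
  have hgap : l.Pairwise fun y z => y + 2 ≤ z := hlt.imp_of_mem fun {y z} hy hz hyz => by
    rw [hmem] at hy hz
    by_contra hc
    rcases hx y.toNat (by omega) with h | ⟨-, h⟩
    · linarith [hy.2]
    · rw [show y.toNat + 1 = z.toNat by omega] at h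
      linarith [hz.2]
  refine ⟨l.length, l, ⟨rfl, fun y hy => ((hmem y).1 hy).1, hgap.isChain⟩, fun k hk hkn => ?_⟩
  rw [coef_rootSum hn hk fun y hy => by have := ((hmem y).1 hy).1; omega,
    List.Nodup.count (hlt.imp fun h => h.ne)]
  simp only [hmem, Int.toNat_natCast, Nat.cast_le]
  by_cases hak : a ≤ k
  · rcases hx k hak with h | ⟨h, -⟩ <;> norm_num [h, hak, hkn]
  · simp only [hak, false_and, if_false, Nat.cast_zero]

theorem dotProduct_rootSum_eq_zero (y : E n) {l : List ℤ}
    (hl : ∀ i ∈ l, coord y i = coord y (lo i)) : y ⬝ᵥ rootSum n l = 0 := by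
  induction l with
  | nil => rw [rootSum_nil, dotProduct_zero]
  | cons i l ih =>
    rw [List.forall_mem_cons] at hl
    rw [rootSum_cons, dotProduct_add, dotProduct_simpleRoot, hl.1, sub_self, ih hl.2, add_zero]

theorem rootSum_dotProduct_self (hn : 2 ≤ n) (ha : 2 ≤ a) {p : ℕ} {l : List ℤ}
    (hl : l ∈ J p a n) : rootSum n l ⬝ᵥ rootSum n l = 2 * p := by
  have hgap := pairwise_of_mem_J hl
  obtain ⟨rfl, hmem, -⟩ := hl
  induction l with
  | nil => rw [rootSum_nil, dotProduct_zero, List.length_nil, Nat.cast_zero, mul_zero]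
  | cons i l ih =>
    rw [List.pairwise_cons] at hgap
    rw [List.forall_mem_cons] at hmem
    have hlo : lo i = i - 1 := by have := lo_cases i; omega
    have horth : simpleRoot n i ⬝ᵥ rootSum n l = 0 :=
      dotProduct_rootSum_eq_zero _ fun j hj => by
        have hij := hgap.1 j hj
        have hj := hmem.2 j hj
        have hlo' : lo j = j - 1 := by have := lo_cases j; omega
        rw [simpleRoot_eq, coord_sub, coord_sub, hlo, hlo']
        iterate 4 rw [coord_e_of_isRootPair (by omega)]
    rw [rootSum_cons, add_dotProduct, dotProduct_add, dotProduct_add,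
      simpleRoot_dotProduct_self hn (by omega), horth, dotProduct_comm (rootSum n l), horth,
      ih hgap.2 hmem.2, List.length_cons]
    push_cast
    ring

theorem add_rootSum_dotProduct_self (hn : 2 ≤ n) (ha : 2 ≤ a) {p : ℕ} {l : List ℤ}
    (hl : l ∈ J p a n) {y : E n} (hy : ∀ k : ℤ, a - 1 ≤ k → k ≤ n → coord y k = 0) :
    (y + rootSum n l) ⬝ᵥ (y + rootSum n l) = y ⬝ᵥ y + 2 * p := by
  have horth : y ⬝ᵥ rootSum n l = 0 := dotProduct_rootSum_eq_zero _ fun j hj => by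
    have := hl.2.1 j hj
    rw [hy j (by omega) (by omega), hy (lo j) (by have := lo_cases j; omega)
      (by have := lo_lt j; omega)]
  rw [add_dotProduct, dotProduct_add, dotProduct_add, rootSum_dotProduct_self hn ha hl,
    dotProduct_comm (rootSum n l), horth]
  ring

theorem coef_eq_zero_of_coord {x : E n} {k : ℕ} (hk : 3 ≤ k)
    (h : ∀ j : ℤ, k ≤ j → j ≤ n → coord x j = 0) : coef x k = 0 := by
  rcases lt_or_ge n k with hkn | hkn
  · exact coef_of_gt x hk hkn
  · rw [coef_succ x hk, h k le_rfl (by omega), zero_add]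
    exact coef_eq_zero_of_coord (by omega) fun j hj => h j (by omega)
termination_by n + 1 - k

theorem IsTop.exists_neg_eq_add_rootSum (hn : 3 ≤ n) {x y : E n} (hx : IsTop x) {a : ℕ}
    (ha : 3 ≤ a) (hlow : ∀ k : ℕ, 1 ≤ k → k < a → coef y k = -coef x k)
    (hhigh : ∀ k : ℤ, a - 1 ≤ k → k ≤ n → coord y k = 0) :
    ∃ p, ∃ l ∈ J p a n, -x = y + rootSum n l ∧ x ⬝ᵥ x = y ⬝ᵥ y + 2 * p := by
  obtain ⟨p, l, hl, hcoef⟩ := exists_mem_J_of_coef (by omega) (by omega : 1 ≤ a)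
    fun k hk => hx.coef_of_three_le hn (ha.trans hk)
  have hneg : -x = y + rootSum n l := eq_of_coef (by omega) fun k hk hkn => by
    rw [coef_neg, coef_add, hcoef k hk hkn]
    split_ifs with hak
    · rw [coef_eq_zero_of_coord (by omega) fun j hj => hhigh j (by omega), zero_add]
    · rw [hlow k hk (by omega), add_zero]
  refine ⟨p, l, hl, hneg, ?_⟩
  rw [← add_rootSum_dotProduct_self (by omega) (by omega) hl hhigh, ← hneg, neg_dotProduct_neg]

/-- The part at the nodes `1, 2` common to the weights `(α_1 + α_2) / 2 + ∑ α_{i_k}`. -/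
noncomputable def oddEnd (n : ℕ) : E n :=
  (1 / 2 : ℝ) • simpleRoot n 1 + (1 / 2 : ℝ) • simpleRoot n 2

/-- The part of `v_{i,1}(ω_r)` at the nodes `1, 2, 3`. -/
noncomputable def oddEndOne (n : ℕ) : E n :=
  (3 / 2 : ℝ) • simpleRoot n 1 + (1 / 2 : ℝ) • simpleRoot n 2 + simpleRoot n 3

/-- The part of `v_{i,2}(ω_r)` at the nodes `1, 2, 3`. -/
noncomputable def oddEndTwo (n : ℕ) : E n :=
  (1 / 2 : ℝ) • simpleRoot n 1 + (3 / 2 : ℝ) • simpleRoot n 2 + simpleRoot n 3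

theorem simpleRoot_one (n : ℕ) : simpleRoot n 1 = e n 1 + e n 2 := if_pos rfl

theorem simpleRoot_two (n : ℕ) : simpleRoot n 2 = e n 2 - e n 1 := if_neg (by norm_num)

theorem simpleRoot_three (n : ℕ) : simpleRoot n 3 = e n 3 - e n 2 := if_neg (by norm_num)

theorem oddEnd_eq (n : ℕ) : oddEnd n = e n 2 := by
  rw [oddEnd, simpleRoot_one, simpleRoot_two]
  module

theorem oddEndOne_eq (n : ℕ) : oddEndOne n = e n 1 + e n 2 + e n 3 := by
  rw [oddEndOne, simpleRoot_one, simpleRoot_two, simpleRoot_three]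
  module

theorem oddEndTwo_eq (n : ℕ) : oddEndTwo n = -e n 1 + e n 2 + e n 3 := by
  rw [oddEndTwo, simpleRoot_one, simpleRoot_two, simpleRoot_three]
  module

theorem e_dotProduct_self (ha : InRange n a) : e n a ⬝ᵥ e n a = 1 := coord_e_self ha

theorem e_dotProduct_of_isRootPair (h : IsRootPair n a b) : e n a ⬝ᵥ e n b = 0 :=
  coord_e_of_isRootPair h

theorem oddEnd_dotProduct_self (hn : 2 ≤ n) : oddEnd n ⬝ᵥ oddEnd n = 1 := by
  rw [oddEnd_eq, e_dotProduct_self (by omega)]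

theorem oddEndOne_dotProduct_self (hn : 3 ≤ n) : oddEndOne n ⬝ᵥ oddEndOne n = 3 := by
  simp only [oddEndOne_eq, add_dotProduct, dotProduct_add]
  iterate 3 rw [e_dotProduct_self (by omega)]
  iterate 6 rw [e_dotProduct_of_isRootPair (by omega)]
  norm_num

theorem oddEndTwo_dotProduct_self (hn : 3 ≤ n) : oddEndTwo n ⬝ᵥ oddEndTwo n = 3 := by
  simp only [oddEndTwo_eq, add_dotProduct, dotProduct_add, neg_dotProduct, dotProduct_neg]
  iterate 3 rw [e_dotProduct_self (by omega)]
  iterate 6 rw [e_dotProduct_of_isRootPair (by omega)]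
  norm_num

/-- The weights `v(ω_r)` for `n + 1 - r = 2 m`. -/
def EvenWeight (n m : ℕ) (y : E n) : Prop :=
  (∃ l ∈ J m 3 n, y = rootSum n l) ∨
    ∃ q, q + 1 = m ∧ ∃ l ∈ J q 4 n,
      y = simpleRoot n 1 + rootSum n l ∨ y = simpleRoot n 2 + rootSum n l

/-- The weights `v(ω_r)` for `n + 1 - r = 2 m + 1`. -/
def OddWeight (n m : ℕ) (y : E n) : Prop :=
  (∃ l ∈ J m 4 n, y = oddEnd n + rootSum n l) ∨
    ∃ q, q + 1 = m ∧ ∃ l ∈ J q 5 n, y = oddEndOne n + rootSum n l ∨ y = oddEndTwo n + rootSum n l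

theorem coord_simpleRoot_eq_zero (hi : IsNode n i) (hk : IsNode n a) (h : max i 2 < a) :
    coord (simpleRoot n i) a = 0 := by
  have := lo_cases i
  rw [simpleRoot_eq, coord_sub, coord_e_of_isRootPair (by omega), coord_e_of_isRootPair (by omega),
    sub_self]

theorem IsTop.exists_evenWeight_of_coef_eq_zero (hn : 3 ≤ n) {x : E n} (hx : IsTop x)
    (h1 : coef x 1 = 0) (h2 : coef x 2 = 0) :
    ∃ m : ℕ, x ⬝ᵥ x = 2 * m ∧ EvenWeight n m (-x) := by
  obtain ⟨p, l, hl, hneg, hnorm⟩ := hx.exists_neg_eq_add_rootSum hn (y := 0) le_rfl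
    (fun k hk hk' => by
      obtain rfl | rfl : k = 1 ∨ k = 2 := by omega
      · rw [h1, coef_zero, neg_zero]
      · rw [h2, coef_zero, neg_zero])
    fun k _ _ => zero_dotProduct _
  rw [zero_add] at hneg
  rw [zero_dotProduct, zero_add] at hnorm
  exact ⟨p, hnorm, Or.inl ⟨l, hl, hneg⟩⟩

theorem IsTop.evenWeight_or_oddWeight_of_coef_three_eq_zero (hn : 3 ≤ n) {x : E n} (hx : IsTop x)
    (h3 : coef x 3 = 0) : (∃ m : ℕ, x ⬝ᵥ x = 2 * m ∧ EvenWeight n m (-x)) ∨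
      (∃ m : ℕ, x ⬝ᵥ x = 2 * m + 1 ∧ OddWeight n m (-x)) := by
  have hn2 : 2 ≤ n := by omega
  rcases hx.end_cases_of_coef_three_eq_zero hn h3 with ⟨h1, h2⟩ | ⟨h1, h2⟩ | ⟨h1, h2⟩ | ⟨h1, h2⟩
  · exact Or.inl (hx.exists_evenWeight_of_coef_eq_zero hn h1 h2)
  · obtain ⟨p, l, hl, hneg, hnorm⟩ := hx.exists_neg_eq_add_rootSum hn (y := simpleRoot n 1) (a := 4)
      (by omega) (by
        intro k hk hk'
        rw [coef_simpleRoot hn2 hk (by omega)]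
        interval_cases k <;> norm_num [h1, h2, h3])
      fun k hk hk' => coord_simpleRoot_eq_zero (by omega) (by omega) (by omega)
    rw [simpleRoot_dotProduct_self hn2 (by omega)] at hnorm
    refine Or.inl ⟨p + 1, ?_, Or.inr ⟨p, rfl, l, hl, Or.inl hneg⟩⟩
    push_cast
    linarith
  · obtain ⟨p, l, hl, hneg, hnorm⟩ := hx.exists_neg_eq_add_rootSum hn (y := simpleRoot n 2) (a := 4)
      (by omega) (by
        intro k hk hk'
        rw [coef_simpleRoot hn2 hk (by omega)]
        interval_cases k <;> norm_num [h1, h2, h3])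
      fun k hk hk' => coord_simpleRoot_eq_zero (by omega) (by omega) (by omega)
    rw [simpleRoot_dotProduct_self hn2 (by omega)] at hnorm
    refine Or.inl ⟨p + 1, ?_, Or.inr ⟨p, rfl, l, hl, Or.inr hneg⟩⟩
    push_cast
    linarith
  · obtain ⟨p, l, hl, hneg, hnorm⟩ := hx.exists_neg_eq_add_rootSum hn (y := oddEnd n) (a := 4)
      (by omega) (by
        intro k hk hk'
        rw [oddEnd, coef_add, coef_smul, coef_smul, coef_simpleRoot hn2 hk (by omega),
          coef_simpleRoot hn2 hk (by omega)]
        interval_cases k <;> norm_num [h1, h2, h3])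
      fun k hk hk' => by rw [oddEnd_eq, coord_e_of_isRootPair (by omega)]
    rw [oddEnd_dotProduct_self hn2] at hnorm
    exact Or.inr ⟨p, by linarith, Or.inl ⟨l, hl, hneg⟩⟩

theorem IsTop.evenWeight_or_oddWeight (hn : 3 ≤ n) {x : E n} (hx : IsTop x) :
    (∃ m : ℕ, x ⬝ᵥ x = 2 * m ∧ EvenWeight n m (-x)) ∨
      (∃ m : ℕ, x ⬝ᵥ x = 2 * m + 1 ∧ OddWeight n m (-x)) := by
  have hn2 : 2 ≤ n := by omega
  rcases hx.coef_of_three_le hn (k := 3) le_rfl with h3 | ⟨h3, h4⟩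
  · exact hx.evenWeight_or_oddWeight_of_coef_three_eq_zero hn h3
  rcases hx.end_cases_of_coef_three_eq_neg_one hn h3 h4 with ⟨h1, h2⟩ | ⟨h1, h2⟩ | ⟨h1, h2⟩
  · exact Or.inl (hx.exists_evenWeight_of_coef_eq_zero hn h1 h2)
  · obtain ⟨p, l, hl, hneg, hnorm⟩ := hx.exists_neg_eq_add_rootSum hn (y := oddEndOne n) (a := 5)
      (by omega) (by
        intro k hk hk'
        rw [oddEndOne, coef_add, coef_add, coef_smul, coef_smul,
          coef_simpleRoot hn2 hk (by omega), coef_simpleRoot hn2 hk (by omega),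
          coef_simpleRoot hn2 hk (by omega)]
        interval_cases k <;> norm_num [h1, h2, h3, h4])
      fun k hk hk' => by
        rw [oddEndOne_eq, coord_add, coord_add]
        iterate 3 rw [coord_e_of_isRootPair (by omega)]
        norm_num
    rw [oddEndOne_dotProduct_self hn] at hnorm
    refine Or.inr ⟨p + 1, ?_, Or.inr ⟨p, rfl, l, hl, Or.inl hneg⟩⟩
    push_cast
    linarith
  · obtain ⟨p, l, hl, hneg, hnorm⟩ := hx.exists_neg_eq_add_rootSum hn (y := oddEndTwo n) (a := 5)
      (by omega) (by
        intro k hk hk'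
        rw [oddEndTwo, coef_add, coef_add, coef_smul, coef_smul,
          coef_simpleRoot hn2 hk (by omega), coef_simpleRoot hn2 hk (by omega),
          coef_simpleRoot hn2 hk (by omega)]
        interval_cases k <;> norm_num [h1, h2, h3, h4])
      fun k hk hk' => by
        rw [oddEndTwo_eq, coord_add, coord_add, coord_neg]
        iterate 3 rw [coord_e_of_isRootPair (by omega)]
        norm_num
    rw [oddEndTwo_dotProduct_self hn] at hnorm
    refine Or.inr ⟨p + 1, ?_, Or.inr ⟨p, rfl, l, hl, Or.inr hneg⟩⟩
    push_cast
    linarith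

theorem IsTop.evenWeight (hn : 3 ≤ n) {x : E n} (hx : IsTop x) {m : ℕ}
    (h : x ⬝ᵥ x = (2 * m : ℕ)) : EvenWeight n m (-x) := by
  rcases hx.evenWeight_or_oddWeight hn with ⟨q, hq, hy⟩ | ⟨q, hq, -⟩ <;> rw [h] at hq <;>
    norm_cast at hq
  · rwa [show m = q by omega]
  · omega

theorem IsTop.oddWeight (hn : 3 ≤ n) {x : E n} (hx : IsTop x) {m : ℕ}
    (h : x ⬝ᵥ x = (2 * m + 1 : ℕ)) : OddWeight n m (-x) := by
  rcases hx.evenWeight_or_oddWeight hn with ⟨q, hq, -⟩ | ⟨q, hq, hy⟩ <;> rw [h] at hq <;>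
    norm_cast at hq
  · omega
  · rwa [show m = q by omega]

/-- The sum of the coefficients of `α_a, …, α_n`. -/
noncomputable def height (a : ℕ) (x : E n) : ℝ := ∑ k ∈ Finset.Icc a n, coef x k

theorem height_add (a : ℕ) (x y : E n) : height a (x + y) = height a x + height a y := by
  simp only [height, coef_add, Finset.sum_add_distrib]

theorem height_sub (a : ℕ) (x y : E n) : height a (x - y) = height a x - height a y := by
  simp only [height, coef_sub, Finset.sum_sub_distrib]

theorem height_smul (a : ℕ) (t : ℝ) (x : E n) : height a (t • x) = t * height a x := by
  simp only [height, coef_smul, Finset.mul_sum]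

theorem height_simpleRoot (hn : 2 ≤ n) {a : ℕ} (ha : 1 ≤ a) (hi : IsNode n i) :
    height a (simpleRoot n i) = if (a : ℤ) ≤ i then 1 else 0 := by
  lift i to ℕ using by omega
  rw [height, Finset.sum_congr rfl fun k hk =>
    coef_simpleRoot hn (ha.trans (Finset.mem_Icc.1 hk).1) hi]
  simp only [Nat.cast_inj, Finset.sum_ite_eq', Finset.mem_Icc]
  exact if_congr (by omega) rfl rfl

theorem height_rootSum (hn : 2 ≤ n) {a : ℕ} (ha : 1 ≤ a) {p : ℕ} (hb : a ≤ b) {l : List ℤ}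
    (hl : l ∈ J p b n) : height a (rootSum n l) = p := by
  obtain ⟨rfl, hmem, -⟩ := hl
  induction l with
  | nil => simp only [rootSum_nil, height, coef_zero, Finset.sum_const_zero, List.length_nil,
      Nat.cast_zero]
  | cons i l ih =>
    rw [List.forall_mem_cons] at hmem
    rw [rootSum_cons, height_add, height_simpleRoot hn ha (by omega), if_pos (by omega),
      ih hmem.2, List.length_cons, Nat.cast_succ, add_comm]

theorem height_nonneg (hn : 2 ≤ n) {a : ℕ} (ha : 1 ≤ a) {x : E n} (hx : RootNonneg n x) :
    0 ≤ height a x :=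
  Finset.sum_nonneg fun k hk => by
    rw [Finset.mem_Icc] at hk
    exact (rootNonneg_iff hn x).1 hx k (by omega) hk.2

theorem eq_of_height_eq (hn : 2 ≤ n) {x y : E n} (hx : RootNonneg n (x - y))
    (h : height 1 x = height 1 y) : x = y := by
  have hsum : height 1 (x - y) = 0 := by rw [height_sub, h, sub_self]
  rw [rootNonneg_iff hn] at hx
  rw [height, Finset.sum_eq_zero_iff_of_nonneg fun k hk =>
    hx k (Finset.mem_Icc.1 hk).1 (Finset.mem_Icc.1 hk).2] at hsum
  exact eq_of_coef hn fun k hk hk' => sub_eq_zero.1 <| by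
    rw [← coef_sub, hsum k (Finset.mem_Icc.2 ⟨hk, hk'⟩)]

theorem EvenWeight.height_eq (hn : 3 ≤ n) {m : ℕ} {y : E n} (hy : EvenWeight n m y) :
    height 1 y = m := by
  have hn2 : 2 ≤ n := by omega
  rcases hy with ⟨l, hl, rfl⟩ | ⟨q, rfl, l, hl, rfl | rfl⟩
  · exact height_rootSum hn2 le_rfl (by norm_num) hl
  all_goals
    rw [height_add, height_rootSum hn2 le_rfl (by norm_num) hl,
      height_simpleRoot hn2 le_rfl (by omega), if_pos (by norm_num), Nat.cast_succ, add_comm]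

theorem EvenWeight.eq_of_rootNonneg_sub (hn : 3 ≤ n) {m : ℕ} {x y : E n} (hx : EvenWeight n m x)
    (hy : EvenWeight n m y) (h : RootNonneg n (x - y)) : x = y :=
  eq_of_height_eq (by omega) h ((hx.height_eq hn).trans (hy.height_eq hn).symm)

theorem OddWeight.height_eq (hn : 3 ≤ n) {m : ℕ} {y : E n} (hy : OddWeight n m y) :
    (height 1 y = m + 1 ∧ height 4 y = m) ∨ (height 1 y = m + 2 ∧ height 4 y = m - 1) := by
  have hn2 : 2 ≤ n := by omega
  have hroot : ∀ a : ℕ, 1 ≤ a → ∀ i : ℤ, 1 ≤ i → i ≤ 3 →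
      height a (simpleRoot n i) = if (a : ℤ) ≤ i then 1 else 0 :=
    fun a ha i hi hi' => height_simpleRoot hn2 ha (by omega)
  rcases hy with ⟨l, hl, rfl⟩ | ⟨q, rfl, l, hl, rfl | rfl⟩
  · refine Or.inl ⟨?_, ?_⟩ <;>
      rw [height_add, height_rootSum hn2 (by norm_num) (by norm_num) hl, oddEnd] <;>
      norm_num [height_add, height_smul, hroot, add_comm]
  · refine Or.inr ⟨?_, ?_⟩ <;>
      rw [height_add, height_rootSum hn2 (by norm_num) (by norm_num) hl, oddEndOne,
        Nat.cast_succ]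
    · norm_num [height_add, height_smul, hroot]
      ring
    · norm_num [height_add, height_smul, hroot]
  · refine Or.inr ⟨?_, ?_⟩ <;>
      rw [height_add, height_rootSum hn2 (by norm_num) (by norm_num) hl, oddEndTwo,
        Nat.cast_succ]
    · norm_num [height_add, height_smul, hroot]
      ring
    · norm_num [height_add, height_smul, hroot]

theorem OddWeight.eq_of_rootNonneg_sub (hn : 3 ≤ n) {m : ℕ} {x y : E n} (hx : OddWeight n m x)
    (hy : OddWeight n m y) (h : RootNonneg n (x - y)) : x = y := by
  have h1 := height_nonneg (by omega) (a := 1) le_rfl h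
  have h4 := height_nonneg (by omega) (a := 4) (by norm_num) h
  rw [height_sub] at h1 h4
  rcases hx.height_eq hn with ⟨hx1, -⟩ | ⟨hx1, hx4⟩ <;>
    rcases hy.height_eq hn with ⟨hy1, hy4⟩ | ⟨hy1, -⟩
  · exact eq_of_height_eq (by omega) h (hx1.trans hy1.symm)
  · linarith
  · linarith
  · exact eq_of_height_eq (by omega) h (hx1.trans hy1.symm)

theorem oneLine_eq_map (n : ℕ) (w : Equiv.Perm ℤ) :
    oneLine n w = (List.range n).map fun j : ℕ => w ((j : ℤ) + 1) := by
  rw [oneLine, list_natCast_eq_map, List.map_map]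
  rfl

theorem length_oneLine (n : ℕ) (w : Equiv.Perm ℤ) : (oneLine n w).length = n := by
  rw [oneLine_eq_map, List.length_map, List.length_range]

theorem oneLine_mul (n : ℕ) (g w : Equiv.Perm ℤ) : oneLine n (g * w) = (oneLine n w).map g := by
  rw [oneLine_eq_map, oneLine_eq_map, List.map_map]
  rfl

theorem getElem_oneLine {k : ℕ} (hk : k < (oneLine n w).length) : (oneLine n w)[k] = w (k + 1) := by
  simp only [oneLine_eq_map, List.getElem_map, List.getElem_range]

theorem prod_sign_oneLine (n : ℕ) (w : Equiv.Perm ℤ) :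
    ((oneLine n w).map Int.sign).prod = signProd n w := by
  rw [oneLine_eq_map, List.map_map, signProd]
  induction n with
  | zero => rfl
  | succ n ih =>
    have hIcc : Finset.Icc (1 : ℤ) (n + 1 : ℕ) = insert (n + 1 : ℤ) (Finset.Icc (1 : ℤ) n) := by
      ext k
      simp only [Finset.mem_Icc, Finset.mem_insert]
      omega
    rw [hIcc, Finset.prod_insert (by simp), ← ih, List.range_succ, List.map_append,
      List.prod_append, mul_comm, List.map_singleton, List.prod_singleton, Function.comp_apply]

/-- The odd function that agrees with `f` on `{1, …, n}` and fixes all integers beyond `±n`. -/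
def oddExtension (n : ℕ) (f : ℤ → ℤ) (k : ℤ) : ℤ := if |k| ≤ n then k.sign * f |k| else k

section OddExtension

variable {f : ℤ → ℤ} {k k' : ℤ}

theorem oddExtension_of_abs_le (hk : |k| ≤ n) : oddExtension n f k = k.sign * f |k| := if_pos hk

theorem oddExtension_of_lt_abs (hk : n < |k|) : oddExtension n f k = k := if_neg hk.not_ge

theorem oddExtension_zero (n : ℕ) (f : ℤ → ℤ) : oddExtension n f 0 = 0 := by
  rw [oddExtension_of_abs_le (by simp), Int.sign_zero, zero_mul]

theorem oddExtension_neg (n : ℕ) (f : ℤ → ℤ) (k : ℤ) :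
    oddExtension n f (-k) = -oddExtension n f k := by
  rw [oddExtension, oddExtension, Int.sign_neg, abs_neg, neg_mul]
  split_ifs <;> rfl

theorem abs_oddExtension (hk : k ≠ 0) (hkn : |k| ≤ n) : |oddExtension n f k| = |f (|k|)| := by
  rw [oddExtension_of_abs_le hkn, abs_mul, Int.abs_sign_of_ne_zero hk, one_mul]

variable (hf : Set.MapsTo (fun k => |f k|) (Set.Icc 1 n) (Set.Icc 1 n))
include hf

theorem abs_oddExtension_mem (hk : k ≠ 0) (hkn : |k| ≤ n) :
    |oddExtension n f k| ∈ Set.Icc (1 : ℤ) n := by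
  rw [abs_oddExtension hk hkn]
  exact hf ⟨Int.one_le_abs hk, hkn⟩

theorem abs_oddExtension_le_iff : |oddExtension n f k| ≤ n ↔ |k| ≤ n := by
  rcases lt_or_ge (n : ℤ) |k| with hkn | hkn
  · rw [oddExtension_of_lt_abs hkn]
  · rcases eq_or_ne k 0 with rfl | hk
    · rw [oddExtension_zero]
    · exact iff_of_true (abs_oddExtension_mem hf hk hkn).2 hkn

theorem oddExtension_eq_zero_iff : oddExtension n f k = 0 ↔ k = 0 := by
  refine ⟨fun h => by_contra fun hk => ?_, fun h => h ▸ oddExtension_zero n f⟩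
  have hkn : |k| ≤ n := (abs_oddExtension_le_iff hf).1 (by rw [h]; simp)
  have := (abs_oddExtension_mem hf hk hkn).1
  rw [h, abs_zero] at this
  omega

theorem oddExtension_injective (hinj : Set.InjOn (fun k => |f k|) (Set.Icc 1 n)) :
    Function.Injective (oddExtension n f) := by
  intro k k' h
  have hle : |k| ≤ n ↔ |k'| ≤ n := by
    rw [← abs_oddExtension_le_iff hf, h, abs_oddExtension_le_iff hf]
  have hzero : k = 0 ↔ k' = 0 := by
    rw [← oddExtension_eq_zero_iff hf, h, oddExtension_eq_zero_iff hf]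
  by_cases hkn : |k| ≤ n
  · by_cases hk : k = 0
    · rw [hk, hzero.1 hk]
    have hk' := mt hzero.2 hk
    have habs : |k| = |k'| :=
      hinj ⟨Int.one_le_abs hk, hkn⟩ ⟨Int.one_le_abs hk', hle.1 hkn⟩ (by
        simp only [← abs_oddExtension hk hkn, ← abs_oddExtension hk' (hle.1 hkn), h])
    refine (abs_eq_abs.1 habs).resolve_right ?_
    rintro rfl
    rw [oddExtension_neg] at h
    exact hk' ((oddExtension_eq_zero_iff hf).1 (by omega))
  · rwa [oddExtension_of_lt_abs (not_le.1 hkn),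
      oddExtension_of_lt_abs (not_le.1 (mt hle.2 hkn))] at h

theorem oddExtension_surjective (hinj : Set.InjOn (fun k => |f k|) (Set.Icc 1 n)) :
    Function.Surjective (oddExtension n f) := by
  intro y
  rcases lt_or_ge (n : ℤ) |y| with hy | hy
  · exact ⟨y, oddExtension_of_lt_abs hy⟩
  · have hmaps : Set.MapsTo (oddExtension n f) (Finset.Icc (-(n : ℤ)) n)
        (Finset.Icc (-(n : ℤ)) n) := fun k hk => by
      simp only [Finset.coe_Icc, Set.mem_Icc, ← abs_le] at hk ⊢
      exact (abs_oddExtension_le_iff hf).2 hk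
    have hsurj := Finset.surjOn_of_injOn_of_card_le _ hmaps
      (oddExtension_injective hf hinj).injOn le_rfl
    obtain ⟨k, -, hk⟩ := hsurj (Finset.mem_coe.2 (Finset.mem_Icc.2 (abs_le.1 hy)))
    exact ⟨k, hk⟩

theorem exists_isSigned_eqOn (hinj : Set.InjOn (fun k => |f k|) (Set.Icc 1 n)) :
    ∃ w, IsSigned n w ∧ Set.EqOn w f (Set.Icc 1 n) := by
  have hbij : Function.Bijective (oddExtension n f) :=
    ⟨oddExtension_injective hf hinj, oddExtension_surjective hf hinj⟩
  refine ⟨Equiv.ofBijective _ hbij,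
    ⟨oddExtension_neg n f, fun k hk => oddExtension_of_lt_abs (lt_abs.2 ?_)⟩, fun k hk => ?_⟩
  · omega
  · have hpos : 0 < k := hk.1
    rw [Equiv.ofBijective_apply, oddExtension_of_abs_le (by rw [abs_of_pos hpos]; exact hk.2),
      abs_of_pos hpos, Int.sign_eq_one_of_pos hpos, one_mul]

end OddExtension

theorem exists_oneLine_eq (hn : 2 ≤ n) {L : List ℤ}
    (hL : (L.map fun x => |x|).Perm (interval 1 n)) (hs : (L.map Int.sign).prod = 1) :
    ∃ w ∈ weylGroup n, oneLine n w = L := by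
  have hlen : L.length = n := by
    rw [← List.length_map (fun x => |x|), hL.length_eq, length_interval, Nat.add_sub_cancel]
  have hget : ∀ {k : ℤ}, 1 ≤ k → k ≤ n →
      ∃ h : (k - 1).toNat < L.length, L.getD (k - 1).toNat 0 = L[(k - 1).toNat] := fun hk hkn =>
    ⟨by omega, List.getD_eq_getElem _ _ (by omega)⟩
  obtain ⟨w, hw, hwL⟩ := exists_isSigned_eqOn (n := n) (f := fun k => L.getD (k - 1).toNat 0)
    (fun k hk => by
      obtain ⟨h, heq⟩ := hget hk.1 hk.2
      dsimp only
      rw [heq]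
      simpa only [Nat.cast_one, Set.mem_Icc] using
        mem_interval.1 (hL.mem_iff.1 (List.mem_map_of_mem (List.getElem_mem h))))
    fun k hk k' hk' h => by
      obtain ⟨hlt, heq⟩ := hget hk.1 hk.2
      obtain ⟨hlt', heq'⟩ := hget hk'.1 hk'.2
      have hnodup := hL.nodup_iff.2 ((pairwise_interval 1 n).imp fun h => h.ne)
      have := (hnodup.getElem_inj_iff (i := (k - 1).toNat) (j := (k' - 1).toNat)
        (hi := by rwa [List.length_map]) (hj := by rwa [List.length_map])).1 (by
          simpa only [List.getElem_map, heq, heq'] using h)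
      have := hk.1
      have := hk'.1
      omega
  have hline : oneLine n w = L := by
    refine List.ext_getElem (by rw [length_oneLine, hlen]) fun j hj hj' => ?_
    rw [getElem_oneLine, hwL ⟨by omega, by omega⟩]
    dsimp only
    rw [add_sub_cancel_right, Int.toNat_natCast, List.getD_eq_getElem _ _ hj']
  exact ⟨w, mem_weylGroup hn hw (by rw [← prod_sign_oneLine, hline, hs]), hline⟩

section OneLineBlocks

variable {A B : List ℤ}

theorem getElem_of_oneLine_eq_append_left (h : oneLine n w = A ++ B) {k : ℕ} (hk : k < A.length) :
    A[k] = w (k + 1) := by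
  rw [← List.getElem_append_left hk (bs := B) (h' := by rw [List.length_append]; omega)]
  simp only [← h, getElem_oneLine]

theorem getElem_of_oneLine_eq_append_right (h : oneLine n w = A ++ B) {k : ℕ}
    (hk : k < B.length) : B[k] = w ((A.length + k : ℕ) + 1) := by
  have : B[k] = (A ++ B)[A.length + k]'(by rw [List.length_append]; omega) := by
    simp only [List.getElem_append_right (Nat.le_add_right _ _), Nat.add_sub_cancel_left]
  rw [this]
  simp only [← h, getElem_oneLine]

theorem mem_minReps_of_oneLine (hn : 2 ≤ n) (hr : 3 ≤ r) (hw : w ∈ weylGroup n)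
    (hline : oneLine n w = A ++ B) (hlen : A.length + 1 = r)
    (hA : A.Pairwise fun x y => |x| < y) (hB : B.Pairwise (· < ·)) : w ∈ minReps n r := by
  have hlenB : A.length + B.length = n := by
    rw [← List.length_append, ← hline, length_oneLine]
  have habs : ∀ j k : ℕ, j < k → k < A.length → |w (j + 1)| < w (k + 1) := fun j k hjk hk => by
    simpa only [getElem_of_oneLine_eq_append_left hline] using
      List.pairwise_iff_getElem.1 hA j k (hjk.trans hk) hk hjk
  refine (mem_minReps_iff hn).2 ⟨hw, fun i hi hir => ?_⟩
  rcases lo_cases i with ⟨rfl, hlo⟩ | ⟨hi1, hlo⟩ <;> rw [hlo]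
  · have : |w 1| < w 2 := by exact_mod_cast habs 0 1 one_pos (by omega)
    rw [(isSigned_of_mem hn hw).1]
    linarith [neg_abs_le (w 1)]
  · rcases lt_or_gt_of_ne hir with hir | hir
    · have := habs (i - 2).toNat (i - 1).toNat (by omega) (by omega)
      rw [show ((i - 2).toNat : ℤ) + 1 = i - 1 by omega,
        show ((i - 1).toNat : ℤ) + 1 = i by omega] at this
      exact (le_abs_self _).trans_lt this
    · have := List.pairwise_iff_getElem.1 hB (i - 1 - r).toNat (i - r).toNat (by omega) (by omega)
        (by omega)
      rwa [getElem_of_oneLine_eq_append_right hline, getElem_of_oneLine_eq_append_right hline,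
        show ((A.length + (i - 1 - r).toNat : ℕ) : ℤ) + 1 = i - 1 by omega,
        show ((A.length + (i - r).toNat : ℕ) : ℤ) + 1 = i by omega] at this

theorem act_fundWeight_of_oneLine (hr : 3 ≤ r) (hline : oneLine n w = A ++ B)
    (hlen : A.length + 1 = r) : act n w (fundWeight n r) = (B.map (e n)).sum := by
  have hlenB : A.length + B.length = n := by
    rw [← List.length_append, ← hline, length_oneLine]
  calc act n w (fundWeight n r)
    _ = ∑ j : Fin n, (if r ≤ (j : ℕ) + 1 then (1 : ℝ) else 0) • e n (w ((j : ℤ) + 1)) := by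
      simp only [act, fundWeight, if_neg (show r ≠ 1 by omega), if_neg (show r ≠ 2 by omega)]
    _ = ∑ j ∈ Finset.range (A.length + B.length),
          (if r ≤ j + 1 then (1 : ℝ) else 0) • e n (w ((j : ℤ) + 1)) := by
      rw [hlenB, Finset.sum_range]
    _ = ∑ j ∈ Finset.range B.length, e n (w ((A.length + j : ℕ) + 1)) := by
      rw [Finset.sum_range_add, Finset.sum_eq_zero, zero_add]
      · exact Finset.sum_congr rfl fun j _ => by rw [if_pos (by omega), one_smul]
      · intro j hj
        rw [if_neg (by have := Finset.mem_range.1 hj; omega), zero_smul]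
    _ = (B.map (e n)).sum := by
      rw [← Fin.sum_univ_fun_getElem, Finset.sum_range]
      simp only [getElem_of_oneLine_eq_append_right hline]

end OneLineBlocks

theorem mem_pred {l : List ℤ} {y : ℤ} : y ∈ pred l ↔ y + 1 ∈ l := by
  simp only [pred, List.mem_map, sub_eq_iff_eq_add, exists_eq_right]

theorem mem_neg {l : List ℤ} {y : ℤ} : y ∈ neg l ↔ -y ∈ l := by
  simp only [neg, List.mem_reverse, List.mem_map, neg_eq_iff_eq_neg, exists_eq_right]

theorem mem_rest {a : ℕ} {l : List ℤ} {y : ℤ} :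
    y ∈ rest a n l ↔ (a ≤ y ∧ y ≤ n) ∧ y ∉ l ∧ y ∉ pred l := by
  simp only [rest, List.mem_filter, mem_interval, decide_eq_true_eq]

theorem pairwise_pred {l : List ℤ} (h : l.Pairwise (· < ·)) : (pred l).Pairwise (· < ·) := by
  rw [pred, List.pairwise_map]
  exact h.imp fun h => by omega

theorem pairwise_neg {l : List ℤ} (h : l.Pairwise (· < ·)) : (neg l).Pairwise (· < ·) := by
  rw [neg, List.pairwise_reverse, List.pairwise_map]
  exact h.imp fun h => by omega

theorem pairwise_rest (a n : ℕ) (l : List ℤ) : (rest a n l).Pairwise (· < ·) :=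
  (pairwise_interval a n).filter _

theorem map_neg_of_odd (hw : IsSigned n w) (l : List ℤ) : (neg l).map w = neg (l.map w) := by
  simp only [neg, List.map_reverse, List.map_map, Function.comp_def, hw.1]

theorem map_abs_of_nonneg {l : List ℤ} (h : ∀ x ∈ l, 0 ≤ x) : l.map (fun x => |x|) = l :=
  (List.map_congr_left fun x hx => abs_of_nonneg (h x hx)).trans (List.map_id l)

theorem map_abs_neg (l : List ℤ) :
    (neg l).map (fun x => |x|) = (l.map fun x => |x|).reverse := by
  simp only [neg, List.map_reverse, List.map_map, Function.comp_def, abs_neg]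

theorem prod_sign_of_pos {l : List ℤ} (h : ∀ x ∈ l, 0 < x) : (l.map Int.sign).prod = 1 :=
  List.prod_eq_one fun x hx => by
    obtain ⟨y, hy, rfl⟩ := List.mem_map.1 hx
    exact Int.sign_eq_one_of_pos (h y hy)

theorem prod_sign_neg (l : List ℤ) :
    ((neg l).map Int.sign).prod = (-1) ^ l.length * (l.map Int.sign).prod := by
  rw [neg, List.map_reverse, List.prod_reverse]
  induction l with
  | nil => rfl
  | cons i l ih =>
    simp only [List.map_cons, List.prod_cons, ih, List.length_cons, Int.sign_neg]
    ring

theorem sum_map_e_neg (n : ℕ) (l : List ℤ) :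
    ((neg l).map (e n)).sum = -(l.map (e n)).sum := by
  rw [neg, List.map_reverse, List.sum_reverse, List.map_map, List.sum_neg, List.map_map]
  simp only [Function.comp_def, e_neg]

theorem rootSum_eq_sub {l : List ℤ} (hl : ∀ x ∈ l, 2 ≤ x) :
    rootSum n l = (l.map (e n)).sum - ((pred l).map (e n)).sum := by
  induction l with
  | nil => simp only [rootSum_nil, pred, List.map_nil, List.sum_nil, sub_zero]
  | cons i l ih =>
    have hi : simpleRoot n i = e n i - e n (i - 1) :=
      if_neg (by have := hl i List.mem_cons_self; omega)
    rw [rootSum_cons, ih fun x hx => hl x (List.mem_cons_of_mem _ hx), hi]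
    simp only [pred, List.map_cons, List.sum_cons]
    abel

theorem interval_append {b : ℕ} (hb : b ≤ n) :
    interval 1 b ++ interval (b + 1) n = interval 1 n := by
  rw [interval_eq_map, interval_eq_map, interval_eq_map,
    show n + 1 - 1 = b + 1 - 1 + (n + 1 - (b + 1)) by omega, List.range_add, List.map_append,
    List.map_map]
  congr 1
  refine List.map_congr_left fun j _ => ?_
  rw [Function.comp_apply]
  omega

section Word

variable {l : List ℤ} {y : ℤ}

theorem s_apply_of_abs_ne (hi : 2 ≤ i) (h : |y| ≠ i) (h' : |y| ≠ i - 1) : s i y = y := by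
  have := abs_cases y
  rw [s_apply (by omega)]
  rcases lo_cases i with h | h <;> split_ifs <;> omega

theorem word_apply_of_abs_notMem (hl : ∀ x ∈ l, 2 ≤ x) (h : |y| ∉ l) (h' : |y| ∉ pred l) :
    word l y = y := by
  induction l with
  | nil => rfl
  | cons i l ih =>
    rw [mem_pred, List.mem_cons, not_or] at h'
    rw [List.mem_cons, not_or] at h
    change s i (word l y) = y
    rw [ih (fun x hx => hl x (List.mem_cons_of_mem _ hx)) h.2 (mem_pred.not.2 h'.2),
      s_apply_of_abs_ne (hl i List.mem_cons_self) h.1 (by omega)]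

theorem word_apply_mem (hl : ∀ x ∈ l, 2 ≤ x) (hp : l.Pairwise fun x y => x + 2 ≤ y) (hy : y ∈ l) :
    word l y = y - 1 ∧ word l (y - 1) = y := by
  induction l with
  | nil => cases hy
  | cons i l ih =>
    rw [List.pairwise_cons] at hp
    have hi := hl i List.mem_cons_self
    have hl' : ∀ x ∈ l, 2 ≤ x := fun x hx => hl x (List.mem_cons_of_mem _ hx)
    change s i (word l y) = y - 1 ∧ s i (word l (y - 1)) = y
    rcases List.mem_cons.1 hy with rfl | hy
    · have hlo : lo y = y - 1 := by have := lo_cases y; omega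
      rw [word_apply_of_abs_notMem hl', word_apply_of_abs_notMem hl']
      · exact ⟨by rw [s_self_apply (by omega), hlo], by rw [← hlo, s_lo_apply (by omega)]⟩
      all_goals
        rw [abs_of_pos (by omega)]
        try rw [mem_pred]
        intro h
        have := hp.1 _ h
        omega
    · obtain ⟨hdown, hup⟩ := ih hl' hp.2 hy
      have hgap := hp.1 y hy
      rw [hdown, hup]
      exact ⟨s_apply_of_abs_ne hi (by rw [abs_of_pos] <;> omega) (by rw [abs_of_pos] <;> omega),
        s_apply_of_abs_ne hi (by rw [abs_of_pos] <;> omega) (by rw [abs_of_pos] <;> omega)⟩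

theorem map_word (hl : ∀ x ∈ l, 2 ≤ x) (hp : l.Pairwise fun x y => x + 2 ≤ y) :
    l.map (word l) = pred l :=
  List.map_congr_left fun _ hx => (word_apply_mem hl hp hx).1

theorem map_word_pred (hl : ∀ x ∈ l, 2 ≤ x) (hp : l.Pairwise fun x y => x + 2 ≤ y) :
    (pred l).map (word l) = l := by
  rw [pred, List.map_map]
  exact (List.map_congr_left fun _ hx => (word_apply_mem hl hp hx).2).trans (List.map_id l)

end Word

section Index

variable {p : ℕ} {l : List ℤ}

theorem pairwise_lt_of_mem_J (hl : l ∈ J p a b) : l.Pairwise (· < ·) :=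
  (pairwise_of_mem_J hl).imp fun h => by omega

theorem word_mem (ha : 1 ≤ a) (hl : l ∈ J p a n) : word l ∈ weylGroup n :=
  Subgroup.list_prod_mem _ fun t ht => by
    obtain ⟨i, hi, rfl⟩ := List.mem_map.1 ht
    have := hl.2.1 i hi
    exact s_mem ⟨by omega, this.2⟩

theorem add_one_notMem_of_mem_J (hl : l ∈ J p a b) {x : ℤ} (hx : x ∈ l) : x + 1 ∉ l := fun hx' => by
  have := (pairwise_of_mem_J hl).imp (S := fun x y => x ≠ y + 1 ∧ y ≠ x + 1) fun h => by omega
  have hsymm : Std.Symm fun x y : ℤ => x ≠ y + 1 ∧ y ≠ x + 1 := ⟨fun _ _ h => h.symm⟩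
  exact (this.forall hx hx' (by omega)).2 rfl

theorem rest_append_perm {a : ℕ} (hl : l ∈ J p (a + 1) n) :
    (rest a n l ++ (pred l ++ l)).Perm (interval a n) := by
  have hnodup : (rest a n l ++ (pred l ++ l)).Nodup := by
    have hlt := pairwise_lt_of_mem_J hl
    rw [List.nodup_append', List.nodup_append']
    refine ⟨(pairwise_rest a n l).imp fun h => h.ne, ⟨(pairwise_pred hlt).imp fun h => h.ne,
      hlt.imp fun h => h.ne, ?_⟩, ?_⟩
    · exact fun x hx hx' => add_one_notMem_of_mem_J hl hx' (mem_pred.1 hx)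
    · intro x hx hx'
      have := (mem_rest.1 hx).2
      exact (List.mem_append.1 hx').elim this.2 this.1
  rw [List.perm_ext_iff_of_nodup hnodup ((pairwise_interval a n).imp fun h => h.ne)]
  intro x
  have hmem : x ∈ l → a ≤ x ∧ x ≤ n := fun hx => by have := hl.2.1 x hx; omega
  have hmem' : x ∈ pred l → a ≤ x ∧ x ≤ n := fun hx => by
    have := hl.2.1 _ (mem_pred.1 hx)
    omega
  simp only [List.mem_append, mem_rest, mem_interval]
  tauto

end Index

/-- There is `v` in `W^{I_r}` such that `x v` lies in `W^{I_r}` too, where `v` and `x v` have the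
given one-line notations, `v(ω_r) = χ` and `(x v)(ω_r) = -ψ`. -/
def HasPair (n r : ℕ) (vLine : List ℤ) (χ : E n) (x : Equiv.Perm ℤ) (wLine : List ℤ) (ψ : E n) :
    Prop :=
  ∃ v ∈ minReps n r, oneLine n v = vLine ∧ act n v (fundWeight n r) = χ ∧
    x * v ∈ minReps n r ∧ oneLine n (x * v) = wLine ∧ act n (x * v) (fundWeight n r) = -ψ

theorem hasPair_of_oneLine {A B : List ℤ} {x : Equiv.Perm ℤ} (hn : 2 ≤ n) (hr : 3 ≤ r)
    (habs : ((A ++ B).map fun x => |x|).Perm (interval 1 n))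
    (hsign : ((A ++ B).map Int.sign).prod = 1) (hlen : A.length + 1 = r) (hx : x ∈ weylGroup n)
    (hA : A.Pairwise fun x y => |x| < y) (hB : B.Pairwise (· < ·))
    (hxA : (A.map x).Pairwise fun x y => |x| < y) (hxB : (B.map x).Pairwise (· < ·)) :
    HasPair n r (A ++ B) (B.map (e n)).sum x (A.map x ++ B.map x)
      (-((B.map x).map (e n)).sum) := by
  obtain ⟨v, hv, hline⟩ := exists_oneLine_eq hn habs hsign
  have hline' : oneLine n (x * v) = A.map x ++ B.map x := by
    rw [oneLine_mul, hline, List.map_append]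
  have hlen' : (A.map x).length + 1 = r := by rw [List.length_map, hlen]
  exact ⟨v, mem_minReps_of_oneLine hn hr hv hline hlen hA hB, hline,
    act_fundWeight_of_oneLine hr hline hlen,
    mem_minReps_of_oneLine hn hr (mul_mem hx hv) hline' hlen' hxA hxB, hline',
    by rw [neg_neg, act_fundWeight_of_oneLine hr hline' hlen']⟩

section Block

variable {b p : ℕ} {l A M : List ℤ} {c : Equiv.Perm ℤ}

theorem pairwise_append_of_inRange {L U : List ℤ} (hL : L.Pairwise (· < ·))
    (hM : M.Pairwise (· < ·)) (hU : U.Pairwise (· < ·)) (hLb : ∀ x ∈ L, x < -b)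
    (hMb : ∀ x ∈ M, InRange b x) (hUb : ∀ x ∈ U, b < x) : (L ++ M ++ U).Pairwise (· < ·) := by
  have hLM : ∀ x ∈ L ++ M, x ≤ b := fun x hx => by
    rcases List.mem_append.1 hx with hx | hx
    · have := hLb x hx
      omega
    · exact (hMb x hx).2.2
  refine List.pairwise_append.2 ⟨List.pairwise_append.2 ⟨hL, hM, fun x hx y hy => ?_⟩, hU,
    fun x hx y hy => (hLM x hx).trans_lt (hUb y hy)⟩
  have := hLb x hx
  have := hMb y hy
  omega

theorem block_pairwise (hl : l ∈ J p (b + 2) n) (hMb : ∀ x ∈ M, InRange b x)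
    (hM : M.Pairwise (· < ·)) :
    (neg (pred l) ++ M ++ l).Pairwise (· < ·) ∧ (neg l ++ M ++ pred l).Pairwise (· < ·) := by
  have hlt := pairwise_lt_of_mem_J hl
  have hl' : ∀ x ∈ l, b < x := fun x hx => by
    have := (hl.2.1 x hx).1
    omega
  have hpred : ∀ x ∈ pred l, b < x := fun x hx => by
    have := (hl.2.1 _ (mem_pred.1 hx)).1
    omega
  exact ⟨pairwise_append_of_inRange (pairwise_neg (pairwise_pred hlt)) hM hlt
      (fun x hx => lt_neg.1 (hpred _ (mem_neg.1 hx))) hMb hl',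
    pairwise_append_of_inRange (pairwise_neg hlt) hM (pairwise_pred hlt)
      (fun x hx => lt_neg.1 (hl' _ (mem_neg.1 hx))) hMb hpred⟩

theorem block_perm (hl : l ∈ J p (b + 2) n) (hb : b ≤ n)
    (habs : ((A ++ M).map fun x => |x|).Perm (interval 1 b ++ rest (b + 1) n l)) :
    ((A ++ (neg (pred l) ++ M ++ l)).map fun x => |x|).Perm (interval 1 n) := by
  have hl' : ∀ x ∈ l, b + 2 ≤ x := fun x hx => (hl.2.1 x hx).1
  have hrest : (rest (b + 1) n l ++ (pred l ++ l)).Perm (interval (b + 1) n) :=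
    rest_append_perm (by rwa [Nat.cast_add_one, add_assoc])
  rw [← interval_append hb, List.perm_iff_count]
  intro x
  have hcount := habs.count_eq x
  have hcount' := hrest.count_eq x
  simp only [List.map_append, List.count_append, map_abs_neg,
    List.count_reverse] at hcount hcount' ⊢
  rw [map_abs_of_nonneg (l := l) fun x hx => by have := hl' x hx; omega,
    map_abs_of_nonneg (l := pred l) fun x hx => by have := hl' _ (mem_pred.1 hx); omega]
  omega

theorem block_sign (hl : l ∈ J p (b + 2) n) (hsign : ((A ++ M).map Int.sign).prod = (-1) ^ p) :
    ((A ++ (neg (pred l) ++ M ++ l)).map Int.sign).prod = 1 := by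
  have hl' : ∀ x ∈ l, b + 2 ≤ x := fun x hx => (hl.2.1 x hx).1
  have hlen : (pred l).length = p := by rw [pred, List.length_map, hl.1]
  simp only [List.map_append, List.prod_append] at hsign ⊢
  rw [prod_sign_neg, hlen, prod_sign_of_pos (l := l) fun x hx => by have := hl' x hx; omega,
    prod_sign_of_pos (l := pred l) fun x hx => by have := hl' _ (mem_pred.1 hx); omega, mul_one,
    mul_one, mul_left_comm, hsign, ← mul_pow, neg_one_mul, neg_neg, one_pow]

theorem block_map (hn : 2 ≤ n) (hl : l ∈ J p (b + 2) n) (hc : IsSigned b c)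
    (hAM : ∀ x ∈ A ++ M, |x| ∈ interval 1 b ++ rest (b + 1) n l) :
    A.map (c * word l) = A.map c ∧
      (neg (pred l) ++ M ++ l).map (c * word l) = neg l ++ M.map c ++ pred l := by
  have hl' : ∀ x ∈ l, b + 2 ≤ x := fun x hx => (hl.2.1 x hx).1
  have hl2 : ∀ x ∈ l, 2 ≤ x := fun x hx => by have := hl' x hx; omega
  have hp := pairwise_of_mem_J hl
  have hword : ∀ x ∈ A ++ M, (c * word l) x = c x := fun x hx => by
    have hnot : |x| ∉ l ∧ |x| ∉ pred l := by
      rcases List.mem_append.1 (hAM x hx) with h | h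
      · have := mem_interval.1 h
        exact ⟨fun h => by have := hl' _ h; omega,
          fun h => by have := hl' _ (mem_pred.1 h); omega⟩
      · exact (mem_rest.1 h).2
    rw [Equiv.Perm.mul_apply, word_apply_of_abs_notMem hl2 hnot.1 hnot.2]
  have hfix : ∀ L : List ℤ, (∀ x ∈ L, (b : ℤ) < x) → L.map c = L := fun L hL =>
    (List.map_congr_left fun x hx => hc.2 x (.inr (hL x hx))).trans (List.map_id L)
  have hcl : l.map c = l := hfix l fun x hx => by have := hl' x hx; omega
  have hcp : (pred l).map c = pred l := hfix _ fun x hx => by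
    have := hl' _ (mem_pred.1 hx)
    omega
  have hws := isSigned_of_mem hn (word_mem (by omega) hl)
  refine ⟨List.map_congr_left fun x hx => hword x (List.mem_append_left _ hx), ?_⟩
  rw [List.map_append, List.map_append,
    List.map_congr_left fun x hx => hword x (List.mem_append_right _ hx), Equiv.Perm.coe_mul,
    ← List.map_map, ← List.map_map, map_neg_of_odd hws, map_word hl2 hp, map_word_pred hl2 hp,
    map_neg_of_odd hc, hcl, hcp]

theorem hasPair_block (hn : 2 ≤ n) (hr : 3 ≤ r) (hl : l ∈ J p (b + 2) n) (hb : b ≤ n)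
    (hlen : n + 1 = r + M.length + 2 * p) (hMb : ∀ x ∈ M, InRange b x)
    (habs : ((A ++ M).map fun x => |x|).Perm (interval 1 b ++ rest (b + 1) n l))
    (hsign : ((A ++ M).map Int.sign).prod = (-1) ^ p)
    (hA : A.Pairwise fun x y => |x| < y) (hM : M.Pairwise (· < ·))
    (hc : c ∈ weylGroup n) (hcb : IsSigned b c)
    (hcA : (A.map c).Pairwise fun x y => |x| < y) (hcM : (M.map c).Pairwise (· < ·)) :
    HasPair n r (A ++ (neg (pred l) ++ M ++ l)) ((M.map (e n)).sum + rootSum n l) (c * word l)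
      (A.map c ++ (neg l ++ M.map c ++ pred l)) (-((M.map c).map (e n)).sum + rootSum n l) := by
  have hAM : ∀ x ∈ A ++ M, |x| ∈ interval 1 b ++ rest (b + 1) n l := fun x hx =>
    habs.mem_iff.1 (List.mem_map_of_mem hx)
  obtain ⟨hmapA, hmapB⟩ := block_map hn hl hcb hAM
  have hperm := block_perm hl hb habs
  have hlenA : A.length + 1 = r := by
    have := hperm.length_eq
    simp only [List.length_append, neg, pred, List.length_reverse, List.length_map, hl.1,
      length_interval] at this
    omega
  have hcMb : ∀ x ∈ M.map c, InRange b x := fun x hx => by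
    obtain ⟨y, hy, rfl⟩ := List.mem_map.1 hx
    exact hcb.inRange (hMb y hy)
  have hpair := hasPair_of_oneLine hn hr hperm (block_sign hl hsign) hlenA
    (mul_mem hc (word_mem (by omega) hl)) hA (block_pairwise hl hMb hM).1 (by rwa [hmapA])
    (by rw [hmapB]; exact (block_pairwise hl hcMb hcM).2)
  rw [hmapA, hmapB] at hpair
  convert hpair using 1
  all_goals
    rw [rootSum_eq_sub fun x hx => by have := (hl.2.1 x hx).1; omega]
    simp only [List.map_append, List.sum_append, sum_map_e_neg]
    abel

theorem map_eq_self_of_map_abs_eq_rest (hcb : IsSigned b c)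
    (hA : A.map (fun x => |x|) = rest (b + 1) n l) : A.map c = A := by
  refine (List.map_congr_left fun y hy => hcb.2 y ?_).trans (List.map_id A)
  have := (mem_rest.1 (hA ▸ List.mem_map_of_mem hy : |y| ∈ rest (b + 1) n l)).1.1
  have := abs_cases y
  omega

theorem pairwise_abs_lt_of_nonneg (h : ∀ x ∈ l, 0 ≤ x) (hp : l.Pairwise (· < ·)) :
    l.Pairwise fun x y => |x| < y :=
  hp.imp_of_mem fun hx _ hxy => by rwa [abs_of_nonneg (h _ hx)]

theorem map_abs_negHead (l : List ℤ) :
    (negHead l).map (fun x => |x|) = l.map fun x => |x| := by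
  cases l <;> simp only [negHead, List.map_nil, List.map_cons, abs_neg]

theorem pairwise_abs_lt_negHead (h : l.Pairwise fun x y => |x| < y) :
    (negHead l).Pairwise fun x y => |x| < y := by
  cases l with
  | nil => exact List.Pairwise.nil
  | cons t l => simpa only [negHead, List.pairwise_cons, abs_neg] using h

theorem prod_sign_negHead (h : l ≠ []) :
    ((negHead l).map Int.sign).prod = -(l.map Int.sign).prod := by
  cases l with
  | nil => exact absurd rfl h
  | cons t l => simp only [negHead, List.map_cons, List.prod_cons, Int.sign_neg, neg_mul]

theorem hasPair_signed_rest (hn : 2 ≤ n) (hr : 3 ≤ r) (hl : l ∈ J p (b + 2) n) (hb : b ≤ n)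
    (hlen : n + 1 = r + b + 2 * p) (hMb : ∀ x ∈ M, InRange b x)
    (habs : (M.map fun x => |x|).Perm (interval 1 b)) (P : Prop) [Decidable P]
    (hsign : (if P then 1 else -1) * (M.map Int.sign).prod = (-1) ^ p)
    (hM : M.Pairwise (· < ·)) (hc : c ∈ weylGroup n) (hcb : IsSigned b c)
    (hcM : (M.map c).Pairwise (· < ·)) :
    HasPair n r
      ((if P then rest (b + 1) n l else negHead (rest (b + 1) n l)) ++ (neg (pred l) ++ M ++ l))
      ((M.map (e n)).sum + rootSum n l) (c * word l)
      ((if P then rest (b + 1) n l else negHead (rest (b + 1) n l)) ++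
        (neg l ++ M.map c ++ pred l))
      (-((M.map c).map (e n)).sum + rootSum n l) := by
  have hpos : ∀ x ∈ rest (b + 1) n l, 0 < x := fun x hx => by
    have := mem_rest.1 hx
    omega
  have hlenM : M.length = b := by
    rw [← List.length_map (fun x => |x|), habs.length_eq, length_interval, Nat.add_sub_cancel]
  have hne : rest (b + 1) n l ≠ [] := fun h => by
    have := (rest_append_perm (a := b + 1)
      (by rwa [Nat.cast_add_one, add_assoc] : l ∈ J p ((b + 1 : ℕ) + 1) n)).length_eq
    simp only [h, List.nil_append, List.length_append, pred, List.length_map, hl.1,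
      length_interval] at this
    omega
  set A := if P then rest (b + 1) n l else negHead (rest (b + 1) n l) with hA
  have habsA : A.map (fun x => |x|) = rest (b + 1) n l := by
    rw [hA, apply_ite (List.map _), map_abs_negHead, ite_self,
      map_abs_of_nonneg fun x hx => (hpos x hx).le]
  have hpair : A.Pairwise fun x y => |x| < y := by
    have := pairwise_abs_lt_of_nonneg (fun x hx => (hpos x hx).le) (pairwise_rest (b + 1) n l)
    rw [hA]
    split_ifs
    · exact this
    · exact pairwise_abs_lt_negHead this
  have hsignA : (A.map Int.sign).prod = if P then 1 else -1 := by
    rw [hA, apply_ite (List.map _), apply_ite List.prod, prod_sign_negHead hne,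
      prod_sign_of_pos hpos]
  have hcA := map_eq_self_of_map_abs_eq_rest hcb habsA
  have := hasPair_block hn hr hl hb (by rwa [hlenM]) hMb
    (by rw [List.map_append, habsA]; exact (habs.append_left _).trans List.perm_append_comm)
    (by rw [List.map_append, List.prod_append, hsignA, hsign]) hpair hM hc hcb (by rwa [hcA]) hcM
  rwa [hcA] at this

theorem hasPair_cons_rest {ε : ℤ} (hn : 2 ≤ n) (hr : 3 ≤ r) (hb1 : 1 ≤ b)
    (hl : l ∈ J p (b + 2) n) (hb : b ≤ n) (hlen : n + 2 = r + b + 2 * p)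
    (hMb : ∀ x ∈ M, InRange b x) (habs : (1 :: M.map fun x => |x|).Perm (interval 1 b))
    (hε : |ε| = 1) (hsign : ε.sign * (M.map Int.sign).prod = (-1) ^ p) (hM : M.Pairwise (· < ·))
    (hc : c ∈ weylGroup n) (hcb : IsSigned b c) (hcε : |c ε| = 1)
    (hcM : (M.map c).Pairwise (· < ·)) :
    HasPair n r (ε :: rest (b + 1) n l ++ (neg (pred l) ++ M ++ l))
      ((M.map (e n)).sum + rootSum n l) (c * word l)
      (c ε :: rest (b + 1) n l ++ (neg l ++ M.map c ++ pred l))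
      (-((M.map c).map (e n)).sum + rootSum n l) := by
  have hpos : ∀ x ∈ rest (b + 1) n l, 1 < x := fun x hx => by
    have := mem_rest.1 hx
    omega
  have habsR : (rest (b + 1) n l).map (fun x => |x|) = rest (b + 1) n l :=
    map_abs_of_nonneg fun x hx => by have := hpos x hx; omega
  have hpair : ∀ {δ : ℤ}, |δ| = 1 → (δ :: rest (b + 1) n l).Pairwise fun x y => |x| < y :=
    fun hδ => List.pairwise_cons.2 ⟨fun y hy => by rw [hδ]; exact hpos y hy,
      pairwise_abs_lt_of_nonneg (fun x hx => by have := hpos x hx; omega) (pairwise_rest _ _ _)⟩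
  have hcR := map_eq_self_of_map_abs_eq_rest hcb habsR
  have hlenM : M.length + 1 = b := by
    rw [← List.length_map (fun x => |x|), ← List.length_cons (a := 1), habs.length_eq,
      length_interval, Nat.add_sub_cancel]
  have := hasPair_block (A := ε :: rest (b + 1) n l) hn hr hl hb (by omega) hMb
    (by
      rw [List.map_append, List.map_cons, habsR, hε]
      exact List.perm_middle.symm.trans (List.perm_append_comm.trans (habs.append_right _)))
    (by rw [List.map_append, List.map_cons, List.prod_append, List.prod_cons,
      prod_sign_of_pos (l := rest _ _ _) fun x hx => one_pos.trans (hpos x hx), mul_one, hsign])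
    (hpair hε) hM hc hcb (by rw [List.map_cons, hcR]; exact hpair hcε) hcM
  rwa [List.map_cons, hcR] at this

end Block

theorem ite_odd_neg_one_one (m : ℕ) : (if Odd m then -1 else 1 : ℤ) = (-1) ^ m := by
  split_ifs with h
  · exact h.neg_one_pow.symm
  · exact (Nat.not_odd_iff_even.1 h).neg_one_pow.symm

theorem ite_odd_succ (q : ℕ) : (if Odd (q + 1) then 1 else -1 : ℤ) = (-1) ^ q := by
  have := ite_odd_neg_one_one (q + 1)
  rw [pow_succ] at this
  split_ifs at this ⊢ <;> linarith

theorem ite_not_odd_succ (q : ℕ) : (if ¬Odd (q + 1) then 1 else -1 : ℤ) = -(-1) ^ q := by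
  rw [ite_not, ite_odd_neg_one_one, pow_succ, mul_neg_one]

theorem abs_ite_one_neg_one (P : Prop) [Decidable P] : |if P then (-1 : ℤ) else 1| = 1 := by
  split_ifs <;> rfl

theorem isSigned_s_mul_s_mul_s {i j k : ℤ} (hi : IsNode 3 i) (hj : IsNode 3 j)
    (hk : IsNode 3 k) : IsSigned 3 (s i * s j * s k) :=
  ((isSigned_s (by omega) hi).mul (isSigned_s (by omega) hj)).mul (isSigned_s (by omega) hk)

theorem s_mul_s_mul_s_mem {i j k : ℤ} (hi : IsNode n i) (hj : IsNode n j) (hk : IsNode n k) :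
    s i * s j * s k ∈ weylGroup n :=
  mul_mem (mul_mem (s_mem hi) (s_mem hj)) (s_mem hk)

section Families

variable {m q : ℕ} {l : List ℤ}

theorem hasPair_vE (hn : 2 ≤ n) (hr : 3 ≤ r) (h : n + 1 = r + 2 * m) (hl : l ∈ J m 3 n) :
    HasPair n r (vE n m l) (rootSum n l) (word l) (wE n m l) (rootSum n l) := by
  have hε := abs_ite_one_neg_one (Odd m)
  have := hasPair_cons_rest (b := 1) (M := []) hn hr le_rfl hl (by omega) (by omega)
    (fun _ hx => absurd hx List.not_mem_nil) (by decide) hε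
    (by rw [apply_ite Int.sign]; simpa using ite_odd_neg_one_one m) List.Pairwise.nil (one_mem _)
    (IsSigned.one 1) hε List.Pairwise.nil
  convert this using 1 <;> by_cases hm : Odd m <;> simp [vE, wE, hm]

theorem hasPair_vE1 (hr : 3 ≤ r) (h : n + 1 = r + 2 * (q + 1)) (hl : l ∈ J q 4 n) :
    HasPair n r (vE1 n (q + 1) l) (simpleRoot n 1 + rootSum n l) (s 1 * word l) (wE1 n (q + 1) l)
      (simpleRoot n 1 + rootSum n l) := by
  have hM : [1, 2].map (s 1) = [-2, -1] := by simp [s_apply, lo]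
  have := hasPair_signed_rest (b := 2) (M := [1, 2]) (c := s 1) (by omega) hr hl (by omega)
    (by omega) (by decide) (by decide) (Odd (q + 1)) ((mul_one _).trans (ite_odd_succ q))
    (by decide) (s_mem ⟨by omega, by omega⟩) (isSigned_s le_rfl (by decide)) (by rw [hM]; decide)
  rw [hM] at this
  convert this using 1 <;> simp [vE1, wE1, simpleRoot_one, e_neg]

theorem hasPair_vE2 (hr : 3 ≤ r) (h : n + 1 = r + 2 * (q + 1)) (hl : l ∈ J q 4 n) :
    HasPair n r (vE2 n (q + 1) l) (simpleRoot n 2 + rootSum n l) (s 2 * word l) (wE2 n (q + 1) l)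
      (simpleRoot n 2 + rootSum n l) := by
  have hM : [-1, 2].map (s 2) = [-2, 1] := by simp [s_apply, lo]
  have := hasPair_signed_rest (b := 2) (M := [-1, 2]) (c := s 2) (by omega) hr hl (by omega)
    (by omega) (by decide) (by decide) (¬Odd (q + 1))
    (by rw [ite_not_odd_succ]; exact (mul_neg_one _).trans (neg_neg _))
    (by decide) (s_mem ⟨by omega, by omega⟩) (isSigned_s le_rfl (by decide)) (by rw [hM]; decide)
  rw [hM] at this
  convert this using 1 <;>
    simp [vE2, wE2, simpleRoot_two, e_neg, ite_not, sub_eq_neg_add, -Nat.not_odd_iff_even]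

theorem hasPair_vO (hr : 3 ≤ r) (h : n + 1 = r + (2 * m + 1)) (hl : l ∈ J m 4 n) :
    HasPair n r (vO n m l) (oddEnd n + rootSum n l) (s 1 * s 2 * word l) (wO n m l)
      (oddEnd n + rootSum n l) := by
  have hM : [2].map (s 1 * s 2) = [-2] := by simp [s_apply, lo]
  have hc : (s 1 * s 2) (if Odd m then -1 else 1) = if Odd m then 1 else -1 := by
    split_ifs <;> simp [s_apply, lo]
  have := hasPair_cons_rest (b := 2) (M := [2]) (c := s 1 * s 2) (by omega) hr (by omega) hl
    (by omega) (by omega) (by decide) (by decide) (abs_ite_one_neg_one (Odd m))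
    (by rw [apply_ite Int.sign]; exact (mul_one _).trans (ite_odd_neg_one_one m))
    (by decide) (mul_mem (s_mem ⟨by omega, by omega⟩) (s_mem ⟨by omega, by omega⟩))
    ((isSigned_s le_rfl (by decide)).mul (isSigned_s le_rfl (by decide)))
    (by rw [hc]; split_ifs <;> rfl) (by rw [hM]; decide)
  rw [hM, hc] at this
  convert this using 1 <;> by_cases hm : Odd m <;> simp [vO, wO, hm, oddEnd_eq, e_neg]

theorem hasPair_vO1 (hr : 3 ≤ r) (h : n + 1 = r + (2 * (q + 1) + 1)) (hl : l ∈ J q 5 n) :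
    HasPair n r (vO1 n (q + 1) l) (oddEndOne n + rootSum n l) (s 2 * s 3 * s 1 * word l)
      (wO2 n (q + 1) l) (oddEndTwo n + rootSum n l) := by
  have hM : [1, 2, 3].map (s 2 * s 3 * s 1) = [-3, -2, 1] := by simp [s_apply, lo]
  have := hasPair_signed_rest (b := 3) (M := [1, 2, 3]) (c := s 2 * s 3 * s 1) (by omega) hr hl
    (by omega) (by omega) (by decide) (by decide) (Odd (q + 1))
    ((mul_one _).trans (ite_odd_succ q)) (by decide)
    (s_mul_s_mul_s_mem ⟨by omega, by omega⟩ ⟨by omega, by omega⟩ ⟨by omega, by omega⟩)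
    (isSigned_s_mul_s_mul_s (by decide) (by decide) (by decide)) (by rw [hM]; decide)
  rw [hM] at this
  convert this using 1 <;> simp [vO1, wO2, oddEndOne_eq, oddEndTwo_eq, e_neg, add_assoc]

theorem hasPair_vO2 (hr : 3 ≤ r) (h : n + 1 = r + (2 * (q + 1) + 1)) (hl : l ∈ J q 5 n) :
    HasPair n r (vO2 n (q + 1) l) (oddEndTwo n + rootSum n l) (s 1 * s 3 * s 2 * word l)
      (wO1 n (q + 1) l) (oddEndOne n + rootSum n l) := by
  have hM : [-1, 2, 3].map (s 1 * s 3 * s 2) = [-3, -2, -1] := by simp [s_apply, lo]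
  have := hasPair_signed_rest (b := 3) (M := [-1, 2, 3]) (c := s 1 * s 3 * s 2) (by omega) hr hl
    (by omega) (by omega) (by decide) (by decide) (¬Odd (q + 1))
    (by rw [ite_not_odd_succ]; exact (mul_neg_one _).trans (neg_neg _)) (by decide)
    (s_mul_s_mul_s_mem ⟨by omega, by omega⟩ ⟨by omega, by omega⟩ ⟨by omega, by omega⟩)
    (isSigned_s_mul_s_mul_s (by decide) (by decide) (by decide)) (by rw [hM]; decide)
  rw [hM] at this
  convert this using 1 <;>
    simp [vO2, wO1, oddEndOne_eq, oddEndTwo_eq, e_neg, add_assoc, ite_not, -Nat.not_odd_iff_even]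

end Families

theorem coord_fundWeight {k : ℕ} (hr : 3 ≤ r) (hk : IsNode n k) :
    coord (fundWeight n r) k = if r ≤ k then 1 else 0 := by
  obtain ⟨j, rfl⟩ : ∃ j, k = j + 1 := ⟨k - 1, by omega⟩
  rw [Nat.cast_add_one, coord, dot_e n _ j (by omega), fundWeight, if_neg (by omega),
    if_neg (by omega)]

theorem coef_fundWeight_of_le (hr : 3 ≤ r) {k : ℕ} (hrk : r ≤ k) (hk : k ≤ n + 1) :
    coef (fundWeight n r) k = n + 1 - k := by
  induction hk using Nat.decreasingInduction with
  | self => rw [coef_of_gt _ (by omega) (by omega), Nat.cast_add_one, sub_self]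
  | of_succ k hk ih =>
    rw [coef_succ _ (by omega), coord_fundWeight hr (by omega), if_pos hrk, ih (by omega),
      Nat.cast_add_one]
    ring

/-- The weights with coordinates in `{-1, 0, 1}` and squared norm `q`. For `q = n + 1 - r` and
`r ≥ 3` they contain the orbit of `ω_r`. -/
def smallWeights (n : ℕ) (q : ℝ) : Set (E n) :=
  {x | IsSmall x ∧ x ⬝ᵥ x = q}

theorem isStable_smallWeights (hn : 2 ≤ n) (q : ℝ) : IsStable (smallWeights n q) where
  small _ hx := hx.1
  act_s_mem x hx i hi := by
    have hs := isSigned_s hn hi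
    refine ⟨fun k hk => ?_, by rw [act_dotProduct_act hs, hx.2]⟩
    rw [coord_act hs x hk.inRange]
    exact hx.1.of_inRange (hs.inv.inRange hk.inRange)

theorem fundWeight_mem_smallWeights (hr : 3 ≤ r) (hrn : r ≤ n) :
    fundWeight n r ∈ smallWeights n (n + 1 - r) := by
  refine ⟨fun k hk => ?_, coef_fundWeight_of_le hr le_rfl (by omega)⟩
  lift k to ℕ using by omega
  rw [coord_fundWeight hr hk]
  split_ifs
  · exact Or.inr (Or.inr rfl)
  · exact Or.inr (Or.inl rfl)

theorem neg_mem_smallWeights {q : ℝ} {x : E n} (hx : x ∈ smallWeights n q) :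
    -x ∈ smallWeights n q := by
  refine ⟨fun k hk => ?_, by rw [neg_dotProduct_neg, hx.2]⟩
  rw [coord_neg, ← coord_neg_right]
  exact hx.1.of_inRange (by omega)

/-- `P` holds for the negatives of the top weights of squared norm `n + 1 - r`, and the weights
satisfying `P` are nonnegative and pairwise incomparable. -/
structure IsTopFamily (n r : ℕ) (P : E n → Prop) : Prop where
  of_isTop : ∀ z ∈ smallWeights n (n + 1 - r), IsTop z → P (-z)
  eq_of_rootNonneg_sub : ∀ x y, P x → P y → RootNonneg n (x - y) → x = y
  nonneg : ∀ y, P y → RootNonneg n y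

theorem rootNonneg_rootSum {p : ℕ} (hn : 2 ≤ n) (ha : 1 ≤ a) {l : List ℤ} (hl : l ∈ J p a n) :
    RootNonneg n (rootSum n l) := by
  rw [rootNonneg_iff hn]
  intro k hk _
  rw [coef_rootSum hn hk fun x hx => ⟨ha.trans (hl.2.1 x hx).1, (hl.2.1 x hx).2⟩]
  positivity

theorem isTopFamily_evenWeight {m : ℕ} (hn : 3 ≤ n) (h : n + 1 = r + 2 * m) :
    IsTopFamily n r (EvenWeight n m) := by
  have hn2 : 2 ≤ n := by omega
  refine ⟨fun z hz htop => htop.evenWeight hn ?_, fun x y hx hy => hx.eq_of_rootNonneg_sub hn hy,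
    ?_⟩
  · rw [hz.2, sub_eq_iff_eq_add']
    exact_mod_cast h
  · rintro y (⟨l, hl, rfl⟩ | ⟨q, -, l, hl, rfl | rfl⟩)
    · exact rootNonneg_rootSum hn2 (by norm_num) hl
    all_goals
      exact (rootNonneg_simpleRoot hn2 (by omega)).add hn2
        (rootNonneg_rootSum hn2 (by norm_num) hl)

theorem isTopFamily_oddWeight {m : ℕ} (hn : 3 ≤ n) (h : n + 1 = r + (2 * m + 1)) :
    IsTopFamily n r (OddWeight n m) := by
  have hn2 : 2 ≤ n := by omega
  have hnonneg : ∀ {i : ℤ} {t : ℝ}, IsNode n i → 0 ≤ t → RootNonneg n (t • simpleRoot n i) :=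
    fun hi ht => .smul hn2 ht (rootNonneg_simpleRoot hn2 hi)
  have hthree := rootNonneg_simpleRoot hn2 (i := 3) (by omega)
  refine ⟨fun z hz htop => htop.oddWeight hn ?_, fun x y hx hy => hx.eq_of_rootNonneg_sub hn hy,
    ?_⟩
  · rw [hz.2, sub_eq_iff_eq_add']
    exact_mod_cast h
  · rintro y (⟨l, hl, rfl⟩ | ⟨q, -, l, hl, rfl | rfl⟩) <;>
      refine RootNonneg.add hn2 ?_ (rootNonneg_rootSum hn2 (by norm_num) hl)
    · exact (hnonneg (by omega) (by norm_num)).add hn2 (hnonneg (by omega) (by norm_num))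
    all_goals
      exact ((hnonneg (by omega) (by norm_num)).add hn2
        (hnonneg (by omega) (by norm_num))).add hn2 hthree

namespace IsTopFamily

variable {P : E n → Prop} {y : E n}

theorem eq_neg_of_isTop (hP : IsTopFamily n r P) (hy : P y) {z : E n}
    (hz : z ∈ smallWeights n (n + 1 - r)) (htop : IsTop z) (h : RootNonneg n (z - -y)) :
    z = -y := by
  rw [hP.eq_of_rootNonneg_sub y (-z) hy (hP.of_isTop z hz htop)
    (by rwa [sub_neg_eq_add, add_comm, ← sub_neg_eq_add]), neg_neg]

theorem isMinimalNonpos (hP : IsTopFamily n r P) (hn : 2 ≤ n) (hr : 3 ≤ r) (hrn : r ≤ n)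
    (hw : w ∈ minReps n r) (hy : P y) (hwy : act n w (fundWeight n r) = -y) :
    IsMinimalNonpos n r w := by
  refine isMinimalNonpos_of_weight hn (by omega) (isStable_smallWeights hn (n + 1 - r)) one_pos
    (by rw [one_smul]; exact fundWeight_mem_smallWeights hr hrn) hw ?_ ?_
  · rw [hwy, neg_neg]
    exact hP.nonneg y hy
  · rw [one_smul, hwy]
    exact fun z => hP.eq_neg_of_isTop hy

theorem isMaximalNonneg (hP : IsTopFamily n r P) (hn : 2 ≤ n) (hr : 3 ≤ r) (hrn : r ≤ n)
    (hw : w ∈ minReps n r) (hy : P y) (hwy : act n w (fundWeight n r) = y) :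
    IsMaximalNonneg n r w := by
  refine isMaximalNonneg_of_weight hn (by omega) (isStable_smallWeights hn (n + 1 - r))
    (neg_mem_smallWeights (fundWeight_mem_smallWeights hr hrn)) hw ?_ ?_ <;> rw [hwy]
  · exact hP.nonneg y hy
  · exact fun z => hP.eq_neg_of_isTop hy

theorem exists_act_fundWeight_eq_neg (hP : IsTopFamily n r P) (hn : 2 ≤ n) (hr : 3 ≤ r)
    (hrn : r ≤ n) (hu : IsMinimalNonpos n r u) : ∃ y, P y ∧ act n u (fundWeight n r) = -y := by
  have hmem := (isStable_smallWeights hn _).act_mem hn (mem_minReps_iff hn |>.1 hu.1.1).1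
    (fundWeight_mem_smallWeights hr hrn)
  have htop := hu.isTop hn (by omega) one_pos (by rw [one_smul]; exact hmem.1)
  rw [one_smul] at htop
  exact ⟨_, hP.of_isTop _ hmem htop, (neg_neg _).symm⟩

end IsTopFamily

namespace HasPair

variable {vLine wLine : List ℤ} {χ ψ : E n} {x : Equiv.Perm ℤ}

theorem exists_listed {P : E n → Prop} (h : HasPair n r vLine χ x wLine ψ)
    (hP : IsTopFamily n r P) (hn : 2 ≤ n) (hr : 3 ≤ r) (hrn : r ≤ n) (hχ : P χ) (hψ : P ψ) :
    ∃ v, ListedMax n r vLine χ v ∧ ListedMin n r wLine (x * v) ∧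
      act n (x * v) (fundWeight n r) = -ψ := by
  obtain ⟨v, hv, hvLine, hvχ, hw, hwLine, hwψ⟩ := h
  exact ⟨v, ⟨hvLine, hP.isMaximalNonneg hn hr hrn hv hχ hvχ, hvχ⟩,
    ⟨hwLine, hP.isMinimalNonpos hn hr hrn hw hψ hwψ⟩, hwψ⟩

theorem matched {P : E n → Prop} (h : HasPair n r vLine χ x wLine χ) (hP : IsTopFamily n r P)
    (hn : 2 ≤ n) (hr : 3 ≤ r) (hrn : r ≤ n) (hχ : P χ) : Matched n r vLine χ x wLine := by
  obtain ⟨v, hv, hw, hwχ⟩ := h.exists_listed hP hn hr hrn hχ hχ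
  exact ⟨v, x * v, hv, hw, rfl, by rw [hwχ, hv.2.2]⟩

theorem oneLine_eq (h : HasPair n r vLine χ x wLine ψ) (hn : 2 ≤ n) (hr : 1 ≤ r)
    (hu : u ∈ minReps n r) (huψ : act n u (fundWeight n r) = -ψ) : oneLine n u = wLine := by
  obtain ⟨v, -, -, -, hw, hwLine, hwψ⟩ := h
  rw [eq_of_act_fundWeight_eq hn hr hu hw (huψ.trans hwψ.symm), hwLine]

end HasPair

theorem coord_fundWeight_half (hr : r = 1 ∨ r = 2) {k : ℤ} (hk : IsNode n k) :
    coord (fundWeight n r) k = if k = 1 ∧ r = 2 then -1 / 2 else 1 / 2 := by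
  obtain ⟨j, rfl⟩ := exists_fin hk
  rw [coord_fin]
  simp only [fundWeight]
  split_ifs <;> first | rfl | omega

/-- The vectors with coordinates `±1` whose coordinates have product `p`. These are the orbits of
`2 ω_1` (`p = 1`) and of `2 ω_2` (`p = -1`). -/
def signVectors (n : ℕ) (p : ℝ) : Set (E n) :=
  {x | (∀ k, IsNode n k → coord x k = -1 ∨ coord x k = 1) ∧
    ∏ k ∈ Finset.Icc (1 : ℤ) n, coord x k = p}

section SignVectors

variable {p : ℝ} {x y : E n}

theorem coord_of_mem_signVectors (hx : x ∈ signVectors n p) (ha : InRange n a) :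
    coord x a = -1 ∨ coord x a = 1 := by
  rcases lt_or_gt_of_ne ha.1 with h | h
  · have := hx.1 (-a) (by omega)
    rwa [coord_neg_right, neg_inj, neg_eq_iff_eq_neg, or_comm] at this
  · exact hx.1 a (by omega)

theorem isStable_signVectors (hn : 2 ≤ n) (p : ℝ) : IsStable (signVectors n p) where
  small x hx k hk := (hx.1 k hk).imp_right Or.inr
  act_s_mem x hx i hi := by
    have hs := isSigned_s hn hi
    have hcoord : ∀ k, IsNode n k → coord (act n (s i) x) k = coord x ((s i)⁻¹ k) :=
      fun k hk => coord_act hs x hk.inRange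
    refine ⟨fun k hk => ?_, ?_⟩
    · rw [hcoord k hk]
      exact coord_of_mem_signVectors hx (hs.inv.inRange hk.inRange)
    · rw [Finset.prod_congr rfl fun k hk => hcoord k (Finset.mem_Icc.1 hk),
        hs.inv.prod_odd (coord_neg_right x), signProd_of_mem hn (inv_mem (s_mem hi)), hx.2,
        Int.cast_one, one_mul]

theorem two_smul_fundWeight_mem_signVectors (hr : r = 1 ∨ r = 2) :
    (2 : ℝ) • fundWeight n r ∈
      signVectors n (∏ k ∈ Finset.Icc (1 : ℤ) n, coord ((2 : ℝ) • fundWeight n r) k) := by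
  refine ⟨fun k hk => ?_, rfl⟩
  rw [coord_smul, coord_fundWeight_half hr hk]
  split_ifs <;> norm_num

theorem eq_of_mem_signVectors (hn : 1 ≤ n) (hx : x ∈ signVectors n p) (hy : y ∈ signVectors n p)
    (h : ∀ k : ℤ, 2 ≤ k → k ≤ n → coord x k = coord y k) : x = y := by
  have hone : (1 : ℤ) ∈ Finset.Icc (1 : ℤ) n := Finset.mem_Icc.2 ⟨le_rfl, by omega⟩
  have hrest : ∏ k ∈ (Finset.Icc (1 : ℤ) n).erase 1, coord x k
      = ∏ k ∈ (Finset.Icc (1 : ℤ) n).erase 1, coord y k := by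
    refine Finset.prod_congr rfl fun k hk => ?_
    rw [Finset.mem_erase, Finset.mem_Icc] at hk
    exact h k (by omega) hk.2.2
  have hne : ∏ k ∈ (Finset.Icc (1 : ℤ) n).erase 1, coord y k ≠ 0 := by
    refine Finset.prod_ne_zero_iff.2 fun k hk => ?_
    rcases hy.1 k (Finset.mem_Icc.1 (Finset.mem_of_mem_erase hk)) with h | h <;>
      rw [h] <;> norm_num
  have hprod := hx.2.trans hy.2.symm
  rw [← Finset.mul_prod_erase _ _ hone, ← Finset.mul_prod_erase _ _ hone, hrest] at hprod
  refine ext_coord fun k hk => ?_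
  obtain rfl | hk1 := hk.1.eq_or_lt
  · exact mul_right_cancel₀ hne hprod
  · exact h k (by omega) hk.2

/-- The signs at the coordinates `2, …, n` of the top vectors with coordinates `±1`. -/
def HasTopSigns (x : E n) : Prop :=
  ∀ k : ℕ, 2 ≤ k → k ≤ n → coord x k = if k = 2 ∨ Even (n + k) then -1 else 1

theorem IsTop.coef_of_mem_signVectors (hn : 3 ≤ n) (hx : IsTop x) (hmem : x ∈ signVectors n p)
    {k : ℕ} (hk : 3 ≤ k) (hkn : k ≤ n + 1) : coef x k = if Even (n + k) then -1 else 0 := by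
  induction hkn using Nat.decreasingInduction with
  | self => rw [coef_of_gt x (by omega) (by omega), if_neg (by rw [Nat.even_iff]; omega)]
  | of_succ k hk' ih =>
    have hsucc := coef_succ x hk
    rw [ih (by omega), ← add_assoc] at hsucc
    simp only [Nat.even_add_one, ite_not] at hsucc
    rcases hx.coef_of_three_le hn hk with h | ⟨h, -⟩ <;>
      rcases hmem.1 k (by omega) with h' | h' <;> split_ifs at hsucc ⊢ <;> linarith

theorem IsTop.hasTopSigns (hn : 3 ≤ n) (hx : IsTop x) (hmem : x ∈ signVectors n p) :
    HasTopSigns x := by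
  intro k hk hkn
  obtain rfl | hk := hk.eq_or_lt
  · rw [if_pos (Or.inl rfl), Nat.cast_ofNat]
    refine (hmem.1 2 (by omega)).resolve_right fun h2 => ?_
    have hone := hx.coef_nonpos (by omega) (k := 1) (by omega)
    have htwo := hx.coef_nonpos (by omega) (k := 2) (by omega)
    have hadd := coef_one_add x
    have hsub := coef_one_sub x
    rcases hmem.1 1 (by omega) with h1 | h1 <;>
      rcases hx.coef_of_three_le hn le_rfl with h3 | ⟨h3, -⟩ <;> linarith
  · have hsucc := coef_succ x hk
    rw [hx.coef_of_mem_signVectors hn hmem hk (by omega),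
      hx.coef_of_mem_signVectors hn hmem (by omega) (by omega), ← add_assoc] at hsucc
    simp only [Nat.even_add_one, ite_not] at hsucc
    simp only [hk.ne', false_or]
    split_ifs at hsucc ⊢ <;> linarith

theorem HasTopSigns.coef_eq (hx : HasTopSigns x) {k : ℕ} (hk : 3 ≤ k) (hkn : k ≤ n + 1) :
    coef x k = if Even (n + k) then -1 else 0 := by
  induction hkn using Nat.decreasingInduction with
  | self => rw [coef_of_gt x (by omega) (by omega), if_neg (by rw [Nat.even_iff]; omega)]
  | of_succ k hk' ih =>
    rw [coef_succ x hk, ih (by omega), hx k (by omega) (by omega), ← add_assoc]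
    simp only [Nat.even_add_one, ite_not, show k ≠ 2 by omega, false_or]
    split_ifs <;> norm_num

theorem HasTopSigns.rootNonneg_neg (hn : 3 ≤ n) (hx : HasTopSigns x) (hmem : x ∈ signVectors n p) :
    RootNonneg n (-x) := by
  have hhigh : ∀ k : ℕ, 3 ≤ k → k ≤ n → coef x k ≤ 0 := fun k hk hkn => by
    rw [hx.coef_eq hk (by omega)]
    split_ifs <;> norm_num
  have hadd := coef_one_add x
  have hsub := coef_one_sub x
  have h2 := hx 2 le_rfl (by omega)
  have h3 := hhigh 3 le_rfl hn
  rw [if_pos (Or.inl rfl), Nat.cast_ofNat] at h2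
  rw [rootNonneg_neg_iff (by omega)]
  intro k hk hkn
  obtain rfl | rfl | hk : k = 1 ∨ k = 2 ∨ 3 ≤ k := by omega
  · rcases hmem.1 1 (by omega) with h1 | h1 <;> linarith
  · rcases hmem.1 1 (by omega) with h1 | h1 <;> linarith
  · exact hhigh k hk hkn

end SignVectors

theorem isMinimalNonpos_iff_eq_of_hasTopSigns (hn : 3 ≤ n) (hr : r = 1 ∨ r = 2)
    (hw : w ∈ minReps n r) (htop : HasTopSigns ((2 : ℝ) • act n w (fundWeight n r)))
    (u : Equiv.Perm ℤ) : IsMinimalNonpos n r u ↔ u = w := by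
  have hn2 : 2 ≤ n := by omega
  have hr1 : 1 ≤ r := by omega
  have hfund := two_smul_fundWeight_mem_signVectors (n := n) hr
  set p := ∏ k ∈ Finset.Icc (1 : ℤ) n, coord ((2 : ℝ) • fundWeight n r) k
  have hX := isStable_signVectors hn2 p
  have hmem : ∀ {u}, u ∈ minReps n r → (2 : ℝ) • act n u (fundWeight n r) ∈ signVectors n p :=
    fun {u} hu => act_smul u 2 (fundWeight n r) ▸ hX.act_mem hn2 hu.1 hfund
  have huniq : ∀ z ∈ signVectors n p, IsTop z → z = (2 : ℝ) • act n w (fundWeight n r) := by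
    intro z hz hztop
    refine eq_of_mem_signVectors (by omega) hz (hmem hw) fun k hk hkn => ?_
    lift k to ℕ using by omega
    rw [hztop.hasTopSigns hn hz k (by omega) (by omega), htop k (by omega) (by omega)]
  constructor
  · intro hu
    exact eq_of_act_fundWeight_eq hn2 hr1 hu.1.1 hw (smul_right_injective (E n) two_ne_zero
      (huniq _ (hmem hu.1.1) (hu.isTop hn2 hr1 two_pos (hX.small _ (hmem hu.1.1)))))
  · rintro rfl
    have hneg := htop.rootNonneg_neg hn (hmem hw)
    rw [← smul_neg, rootNonneg_smul_iff hn2 two_pos] at hneg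
    exact isMinimalNonpos_of_weight hn2 hr1 hX two_pos hfund hw hneg fun z hz hztop _ =>
      huniq z hz hztop

/-- The one-line notation of the element that sends the indices of the positive coordinates of
`ω_r` (`r = 1, 2`), which for `r = 2` are `-1, 2, …, n`, to `K`. -/
def spinLine (r : ℕ) (K : List ℤ) : List ℤ := if r = 1 then K else negHead K

section SpinLine

variable {K : List ℤ}

theorem map_abs_spinLine (r : ℕ) (K : List ℤ) :
    (spinLine r K).map (fun x => |x|) = K.map fun x => |x| := by
  unfold spinLine
  split_ifs
  · rfl
  · exact map_abs_negHead K

theorem length_spinLine (r : ℕ) (K : List ℤ) : (spinLine r K).length = K.length := by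
  simpa only [List.length_map] using congrArg List.length (map_abs_spinLine r K)

theorem getElem_negHead {k : ℕ} (h : k < (negHead K).length) (h' : k < K.length) :
    (negHead K)[k] = if k = 0 then -K[k] else K[k] := by
  cases K with
  | nil => exact absurd h' (Nat.not_lt_zero _)
  | cons t K => cases k <;> rfl

theorem getElem_of_oneLine_eq_spinLine (hr : r = 1 ∨ r = 2) (hline : oneLine n w = spinLine r K)
    {k : ℕ} (hk : k < K.length) : K[k] = if k = 0 ∧ r = 2 then -w (k + 1) else w (k + 1) := by
  have hk' : k < (oneLine n w).length := by rwa [hline, length_spinLine]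
  rw [← getElem_oneLine hk']
  simp only [hline]
  obtain rfl | rfl := hr
  · rw [if_neg (by omega)]
    rfl
  · have hneg : spinLine 2 K = negHead K := if_neg (by norm_num)
    have := getElem_negHead (by rwa [← hneg, length_spinLine]) hk
    simp only [hneg, this, and_true]
    split_ifs <;> simp only [neg_neg]

theorem mem_minReps_of_oneLine_eq_spinLine (hn : 2 ≤ n) (hr : r = 1 ∨ r = 2)
    (hw : w ∈ weylGroup n) (hline : oneLine n w = spinLine r K) (hK : K.Pairwise (· < ·)) :
    w ∈ minReps n r := by
  have hlen : K.length = n := by rw [← length_spinLine r, ← hline, length_oneLine]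
  rw [List.pairwise_iff_getElem] at hK
  have hstep : ∀ k, k + 1 < K.length → (if k = 0 ∧ r = 2 then -w (k + 1) else w (k + 1))
      < w (k + 2) := fun k hk => by
    have := hK k (k + 1) (by omega) hk (by omega)
    rwa [getElem_of_oneLine_eq_spinLine hr hline, getElem_of_oneLine_eq_spinLine hr hline,
      if_neg (by omega : ¬(k + 1 = 0 ∧ r = 2)), Nat.cast_succ, add_assoc, one_add_one_eq_two]
      at this
  rw [mem_minReps_iff hn]
  refine ⟨hw, fun i hi hir => ?_⟩
  rcases lo_cases i with ⟨rfl, hlo⟩ | ⟨hi1, hlo⟩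
  · have := hstep 0 (by omega)
    rw [if_pos (by omega)] at this
    rw [hlo, (isSigned_of_mem hn hw).1]
    exact neg_lt.1 this
  · have := hstep (i - 2).toNat (by omega)
    rwa [if_neg (by omega), show ((i - 2).toNat : ℤ) + 1 = i - 1 by omega,
      show ((i - 2).toNat : ℤ) + 2 = i by omega, ← hlo] at this

theorem coord_act_fundWeight_of_mem_spinLine (hn : 2 ≤ n) (hr : r = 1 ∨ r = 2)
    (hw : w ∈ weylGroup n) (hline : oneLine n w = spinLine r K) (ha : a ∈ K) :
    coord ((2 : ℝ) • act n w (fundWeight n r)) a = 1 := by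
  have hlen : K.length = n := by rw [← length_spinLine r, ← hline, length_oneLine]
  obtain ⟨k, hk, rfl⟩ := List.getElem_of_mem ha
  have hnode : IsNode n ((k : ℤ) + 1) := by omega
  have hcoord := coord_act_apply (isSigned_of_mem hn hw) (fundWeight n r) hnode.inRange
  rw [coord_fundWeight_half hr hnode] at hcoord
  rw [getElem_of_oneLine_eq_spinLine hr hline hk, coord_smul]
  by_cases hflip : k = 0 ∧ r = 2
  · rw [if_pos (by omega)] at hcoord
    rw [if_pos hflip, coord_neg_right, hcoord]
    norm_num
  · rw [if_neg (by omega)] at hcoord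
    rw [if_neg hflip, hcoord]
    norm_num

theorem map_abs_perm_interval (hlen : K.length = n) (hone : 1 ∈ K ∨ -1 ∈ K)
    (hmem : ∀ k : ℕ, 2 ≤ k → k ≤ n → (k : ℤ) ∈ K ∨ -(k : ℤ) ∈ K) :
    (K.map fun x => |x|).Perm (interval 1 n) := by
  have habs : ∀ k : ℕ, (k : ℤ) ∈ K ∨ -(k : ℤ) ∈ K → (k : ℤ) ∈ K.map fun x => |x| := by
    rintro k (h | h)
    · exact List.mem_map.2 ⟨k, h, Nat.abs_cast k⟩
    · exact List.mem_map.2 ⟨-k, h, by rw [abs_neg, Nat.abs_cast]⟩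
  have hsub : interval 1 n ⊆ K.map fun x => |x| := fun k hk => by
    rw [mem_interval] at hk
    lift k to ℕ using by omega
    obtain rfl | hk1 : k = 1 ∨ 2 ≤ k := by omega
    · exact habs 1 hone
    · exact habs k (hmem k hk1 (by omega))
  refine ((List.subperm_of_subset ((pairwise_interval 1 n).imp fun h => h.ne)
    hsub).perm_of_length_le ?_).symm
  rw [List.length_map, hlen, length_interval, Nat.add_sub_cancel]

theorem exists_isMinimalNonpos_iff_of_spinLine (hn : 3 ≤ n) (hr : r = 1 ∨ r = 2)
    (hlen : K.length = n) (hK : K.Pairwise (· < ·)) (hone : 1 ∈ K ∨ -1 ∈ K)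
    (hmem : ∀ k : ℕ, 2 ≤ k → k ≤ n → (if k = 2 ∨ Even (n + k) then -(k : ℤ) else k) ∈ K)
    (hsign : ((spinLine r K).map Int.sign).prod = 1) :
    ∃ w, oneLine n w = spinLine r K ∧ ∀ u, IsMinimalNonpos n r u ↔ u = w := by
  have hn2 : 2 ≤ n := by omega
  have hperm := map_abs_perm_interval hlen hone fun k hk hkn => by
    have := hmem k hk hkn
    split_ifs at this
    exacts [Or.inr this, Or.inl this]
  obtain ⟨w, hw, hline⟩ := exists_oneLine_eq hn2 (by rwa [map_abs_spinLine]) hsign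
  refine ⟨w, hline, isMinimalNonpos_iff_eq_of_hasTopSigns hn hr
    (mem_minReps_of_oneLine_eq_spinLine hn2 hr hw hline hK) fun k hk hkn => ?_⟩
  have := coord_act_fundWeight_of_mem_spinLine hn2 hr hw hline (hmem k hk hkn)
  split_ifs at this ⊢
  · rwa [coord_neg_right, neg_eq_iff_eq_neg] at this
  · exact this

end SpinLine

theorem mem_down {x : ℤ} : x ∈ down n ↔ ∃ j : ℕ, j < n / 2 ∧ x = -((n : ℤ) - 2 * j) := by
  rw [down, list_natCast_eq_map, List.map_map]
  simp only [List.mem_map, List.mem_range, Function.comp_apply, eq_comm]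

theorem mem_up {x : ℤ} :
    x ∈ up n ↔ ∃ j : ℕ, j < n / 2 - 1 ∧ x = (if Even n then 3 else 4) + 2 * (j : ℤ) := by
  rw [up, list_natCast_eq_map, List.map_map]
  simp only [List.mem_map, List.mem_range, Function.comp_apply, eq_comm]

theorem length_down (n : ℕ) : (down n).length = n / 2 := by
  rw [down, list_natCast_eq_map, List.length_map, List.length_map, List.length_range]

theorem length_up (n : ℕ) : (up n).length = n / 2 - 1 := by
  rw [up, list_natCast_eq_map, List.length_map, List.length_map, List.length_range]

theorem pairwise_down (n : ℕ) : (down n).Pairwise (· < ·) := by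
  rw [down, list_natCast_eq_map, List.pairwise_map, List.pairwise_map]
  exact List.pairwise_lt_range.imp fun h => by omega

theorem pairwise_up (n : ℕ) : (up n).Pairwise (· < ·) := by
  rw [up, list_natCast_eq_map, List.pairwise_map, List.pairwise_map]
  exact List.pairwise_lt_range.imp fun h => by omega

theorem prod_sign_down (n : ℕ) : ((down n).map Int.sign).prod = (-1) ^ (n / 2) := by
  rw [List.prod_eq_pow_card _ (-1), List.length_map, length_down]
  rintro x hx
  obtain ⟨y, hy, rfl⟩ := List.mem_map.1 hx
  obtain ⟨j, hj, rfl⟩ := mem_down.1 hy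
  exact Int.sign_eq_neg_one_of_neg (by omega)

theorem prod_sign_up (n : ℕ) : ((up n).map Int.sign).prod = 1 := by
  refine prod_sign_of_pos fun x hx => ?_
  obtain ⟨j, -, rfl⟩ := mem_up.1 hx
  split_ifs <;> omega

/-- The list `(-n, -(n-2), …, δ, …, n-3, n-1)` with `δ` in place of `±1`, the common shape of
`wOne`, `wTwo`, up to the sign of the first entry. -/
def halfLine (n : ℕ) (δ : ℤ) : List ℤ :=
  down n ++ (if Even n then [δ] else [-2, δ]) ++ up n

section HalfLine

variable {δ : ℤ}

theorem mem_halfLine {x : ℤ} :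
    x ∈ halfLine n δ ↔ x ∈ down n ∨ x = δ ∨ (¬Even n ∧ x = -2) ∨ x ∈ up n := by
  rw [halfLine, List.mem_append, List.mem_append]
  split_ifs with hn <;>
    simp only [List.mem_cons, List.not_mem_nil, hn, not_true, not_false_iff] <;> tauto

theorem pairwise_halfLine (hδ : δ = 1 ∨ δ = -1) : (halfLine n δ).Pairwise (· < ·) := by
  rw [halfLine, List.append_assoc, List.pairwise_append, List.pairwise_append]
  refine ⟨pairwise_down n, ⟨?_, pairwise_up n, fun x hx y hy => ?_⟩, fun x hx y hy => ?_⟩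
  · split_ifs
    · exact List.pairwise_singleton _ _
    · rw [List.pairwise_pair]
      omega
  · obtain ⟨j, -, rfl⟩ := mem_up.1 hy
    split_ifs at hx ⊢ <;> simp only [List.mem_cons, List.not_mem_nil, or_false] at hx <;> omega
  · obtain ⟨i, hi, rfl⟩ := mem_down.1 hx
    rw [List.mem_append, mem_up] at hy
    split_ifs at hy with hn <;> rw [Nat.even_iff] at hn <;>
      simp only [List.mem_cons, List.not_mem_nil, or_false] at hy <;>
      obtain hy | ⟨j, -, rfl⟩ := hy <;> omega

theorem length_halfLine (hn : 2 ≤ n) (δ : ℤ) : (halfLine n δ).length = n := by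
  rw [halfLine, List.length_append, List.length_append, length_down, length_up]
  split_ifs with h <;> rw [Nat.even_iff] at h <;>
    simp only [List.length_cons, List.length_nil] <;> omega

theorem signed_mem_halfLine (δ : ℤ) {k : ℕ} (hk : 2 ≤ k) (hkn : k ≤ n) :
    (if k = 2 ∨ Even (n + k) then -(k : ℤ) else k) ∈ halfLine n δ := by
  rw [mem_halfLine, mem_down, mem_up]
  simp only [Nat.even_iff]
  split_ifs with h hn
  · exact Or.inl ⟨(n - k) / 2, by omega, by omega⟩
  · rcases Nat.even_or_odd (n + k) with hnk | hnk
    · rw [Nat.even_iff] at hnk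
      exact Or.inl ⟨(n - k) / 2, by omega, by omega⟩
    · rw [Nat.odd_iff] at hnk
      exact Or.inr (Or.inr (Or.inl ⟨hn, by omega⟩))
  · exact Or.inr (Or.inr (Or.inr ⟨(k - 3) / 2, by omega, by omega⟩))
  · exact Or.inr (Or.inr (Or.inr ⟨(k - 4) / 2, by omega, by omega⟩))

theorem prod_sign_halfLine (n : ℕ) (δ : ℤ) :
    ((halfLine n δ).map Int.sign).prod = (-1) ^ ((n + 1) / 2) * δ.sign := by
  rw [halfLine, List.map_append, List.map_append, List.prod_append, List.prod_append,
    prod_sign_down, prod_sign_up, mul_one]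
  split_ifs with h <;> rw [Nat.even_iff] at h
  · rw [show (n + 1) / 2 = n / 2 by omega, List.map_singleton, List.prod_singleton]
  · rw [show (n + 1) / 2 = n / 2 + 1 by omega, pow_succ, mul_assoc]
    simp only [List.map_cons, List.map_nil, List.prod_cons, List.prod_nil, mul_one]
    rfl

theorem exists_isMinimalNonpos_iff_of_halfLine (hn : 3 ≤ n) (hr : r = 1 ∨ r = 2)
    (hδ : δ = (-1) ^ ((n + 1) / 2) * (if r = 1 then 1 else -1)) :
    ∃ w, oneLine n w = spinLine r (halfLine n δ) ∧ ∀ u, IsMinimalNonpos n r u ↔ u = w := by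
  have hlen := length_halfLine (by omega : 2 ≤ n) δ
  have hone : δ = 1 ∨ δ = -1 := by
    rw [hδ]
    rcases neg_one_pow_eq_or ℤ ((n + 1) / 2) with h | h <;> rw [h] <;> split_ifs <;> norm_num
  have hδmem : δ ∈ halfLine n δ := mem_halfLine.2 (Or.inr (Or.inl rfl))
  refine exists_isMinimalNonpos_iff_of_spinLine hn hr hlen (pairwise_halfLine hone)
    (hone.imp (fun h => by rwa [← h]) fun h => by rwa [← h])
    (fun k => signed_mem_halfLine δ) ?_
  have hne : halfLine n δ ≠ [] := List.ne_nil_of_mem hδmem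
  have hsign : δ.sign = δ := by rcases hone with rfl | rfl <;> rfl
  have hsq : (-1 : ℤ) ^ ((n + 1) / 2) * (-1) ^ ((n + 1) / 2) = 1 := by
    rw [← mul_pow, neg_one_mul, neg_neg, one_pow]
  unfold spinLine
  split_ifs with h1
  · rw [prod_sign_halfLine, hsign, hδ, if_pos h1, mul_one, hsq]
  · rw [prod_sign_negHead hne, prod_sign_halfLine, hsign, hδ, if_neg h1, mul_neg_one, mul_neg,
      neg_neg, hsq]

end HalfLine

theorem neg_one_pow_succ_half (n : ℕ) :
    (-1 : ℤ) ^ ((n + 1) / 2) = if n % 4 = 0 ∨ n % 4 = 3 then 1 else -1 := by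
  split_ifs with h
  · exact (Nat.even_iff.2 (by omega)).neg_one_pow
  · exact (Nat.odd_iff.2 (by omega)).neg_one_pow

theorem wOne_eq (n : ℕ) : wOne n = halfLine n ((-1) ^ ((n + 1) / 2)) := by
  rw [wOne, halfLine, neg_one_pow_succ_half]
  simp only [Nat.even_iff]
  split_ifs <;> first | rfl | omega

theorem negHead_append {K L : List ℤ} (h : K ≠ []) : negHead (K ++ L) = negHead K ++ L := by
  cases K with
  | nil => exact absurd rfl h
  | cons t K => rfl

theorem wTwo_eq (hn : 2 ≤ n) : wTwo n = negHead (halfLine n (-(-1) ^ ((n + 1) / 2))) := by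
  have hdown : down n ≠ [] := List.ne_nil_of_length_pos (by rw [length_down]; omega)
  rw [wTwo, halfLine, negHead_append (List.append_ne_nil_of_left_ne_nil hdown _),
    negHead_append hdown, neg_one_pow_succ_half]
  simp only [Nat.even_iff]
  split_ifs <;> first | rfl | omega

theorem exists_isMinimalNonpos_one (hn : 3 ≤ n) :
    ∃ w, oneLine n w = wOne n ∧ ∀ u, IsMinimalNonpos n 1 u ↔ u = w :=
  wOne_eq n ▸ exists_isMinimalNonpos_iff_of_halfLine hn (Or.inl rfl) (mul_one _).symm

theorem exists_isMinimalNonpos_two (hn : 3 ≤ n) :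
    ∃ w, oneLine n w = wTwo n ∧ ∀ u, IsMinimalNonpos n 2 u ↔ u = w :=
  wTwo_eq (by omega : 2 ≤ n) ▸
    exists_isMinimalNonpos_iff_of_halfLine hn (Or.inr rfl) (mul_neg_one _).symm

section Classification

variable {m q : ℕ} {l : List ℤ}

theorem oneLine_of_isMinimalNonpos_even (hn : 3 ≤ n) (hr : 3 ≤ r) (hrn : r ≤ n)
    (h : n + 1 = r + 2 * (q + 1)) (hu : IsMinimalNonpos n r u) :
    (∃ l ∈ J (q + 1) 3 n, oneLine n u = wE n (q + 1) l) ∨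
      ∃ l ∈ J q 4 n, oneLine n u = wE1 n (q + 1) l ∨ oneLine n u = wE2 n (q + 1) l := by
  have hn2 : 2 ≤ n := by omega
  have hr1 : 1 ≤ r := by omega
  have hrep := hu.1.1
  obtain ⟨y, hy, huy⟩ :=
    (isTopFamily_evenWeight hn h).exists_act_fundWeight_eq_neg hn2 hr hrn hu
  rcases hy with ⟨l, hl, rfl⟩ | ⟨q', hq', l, hl, hy⟩
  · exact Or.inl ⟨l, hl, (hasPair_vE hn2 hr h hl).oneLine_eq hn2 hr1 hrep huy⟩
  · obtain rfl := Nat.succ_injective hq'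
    refine Or.inr ⟨l, hl, hy.imp ?_ ?_⟩ <;> rintro rfl
    · exact (hasPair_vE1 hr h hl).oneLine_eq hn2 hr1 hrep huy
    · exact (hasPair_vE2 hr h hl).oneLine_eq hn2 hr1 hrep huy

theorem oneLine_of_isMinimalNonpos_odd (hn : 3 ≤ n) (hr : 3 ≤ r) (hrn : r ≤ n)
    (h : n + 1 = r + (2 * m + 1)) (hu : IsMinimalNonpos n r u) :
    (∃ l ∈ J m 4 n, oneLine n u = wO n m l) ∨
      ∃ q, q + 1 = m ∧ ∃ l ∈ J q 5 n, oneLine n u = wO1 n m l ∨ oneLine n u = wO2 n m l := by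
  have hn2 : 2 ≤ n := by omega
  have hr1 : 1 ≤ r := by omega
  have hrep := hu.1.1
  obtain ⟨y, hy, huy⟩ :=
    (isTopFamily_oddWeight hn h).exists_act_fundWeight_eq_neg hn2 hr hrn hu
  rcases hy with ⟨l, hl, rfl⟩ | ⟨q, rfl, l, hl, hy⟩
  · exact Or.inl ⟨l, hl, (hasPair_vO hr h hl).oneLine_eq hn2 hr1 hrep huy⟩
  · refine Or.inr ⟨q, rfl, l, hl, hy.imp ?_ ?_⟩ <;> rintro rfl
    · exact (hasPair_vO2 hr h hl).oneLine_eq hn2 hr1 hrep huy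
    · exact (hasPair_vO1 hr h hl).oneLine_eq hn2 hr1 hrep huy

theorem matched_vE (hn : 3 ≤ n) (hr : 3 ≤ r) (hrn : r ≤ n) (h : n + 1 = r + 2 * m)
    (hl : l ∈ J m 3 n) : Matched n r (vE n m l) (rootSum n l) (word l) (wE n m l) :=
  (hasPair_vE (by omega) hr h hl).matched (isTopFamily_evenWeight hn h) (by omega) hr hrn
    (Or.inl ⟨l, hl, rfl⟩)

theorem matched_vE1 (hn : 3 ≤ n) (hr : 3 ≤ r) (hrn : r ≤ n) (h : n + 1 = r + 2 * (q + 1))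
    (hl : l ∈ J q 4 n) :
    Matched n r (vE1 n (q + 1) l) (simpleRoot n 1 + rootSum n l) (s 1 * word l)
      (wE1 n (q + 1) l) :=
  (hasPair_vE1 hr h hl).matched (isTopFamily_evenWeight hn h) (by omega) hr hrn
    (Or.inr ⟨q, rfl, l, hl, Or.inl rfl⟩)

theorem matched_vE2 (hn : 3 ≤ n) (hr : 3 ≤ r) (hrn : r ≤ n) (h : n + 1 = r + 2 * (q + 1))
    (hl : l ∈ J q 4 n) :
    Matched n r (vE2 n (q + 1) l) (simpleRoot n 2 + rootSum n l) (s 2 * word l)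
      (wE2 n (q + 1) l) :=
  (hasPair_vE2 hr h hl).matched (isTopFamily_evenWeight hn h) (by omega) hr hrn
    (Or.inr ⟨q, rfl, l, hl, Or.inr rfl⟩)

theorem matched_vO (hn : 3 ≤ n) (hr : 3 ≤ r) (hrn : r ≤ n) (h : n + 1 = r + (2 * m + 1))
    (hl : l ∈ J m 4 n) :
    Matched n r (vO n m l) (oddEnd n + rootSum n l) (s 1 * s 2 * word l) (wO n m l) :=
  (hasPair_vO hr h hl).matched (isTopFamily_oddWeight hn h) (by omega) hr hrn
    (Or.inl ⟨l, hl, rfl⟩)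

theorem exists_listed_vO1_vO2 (hn : 3 ≤ n) (hr : 3 ≤ r) (hrn : r ≤ n)
    (h : n + 1 = r + (2 * (q + 1) + 1)) (hl : l ∈ J q 5 n) :
    ∃ v₁ v₂ w₁ w₂ : Equiv.Perm ℤ,
      ListedMax n r (vO1 n (q + 1) l) (oddEndOne n + rootSum n l) v₁ ∧
      ListedMax n r (vO2 n (q + 1) l) (oddEndTwo n + rootSum n l) v₂ ∧
      ListedMin n r (wO1 n (q + 1) l) w₁ ∧ ListedMin n r (wO2 n (q + 1) l) w₂ ∧
      w₂ = s 2 * s 3 * s 1 * word l * v₁ ∧ w₁ = s 1 * s 3 * s 2 * word l * v₂ ∧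
      act n w₁ (fundWeight n r) = -act n v₁ (fundWeight n r) ∧
      act n w₂ (fundWeight n r) = -act n v₂ (fundWeight n r) := by
  have hn2 : 2 ≤ n := by omega
  have hP := isTopFamily_oddWeight hn h
  have hone : OddWeight n (q + 1) (oddEndOne n + rootSum n l) :=
    Or.inr ⟨q, rfl, l, hl, Or.inl rfl⟩
  have htwo : OddWeight n (q + 1) (oddEndTwo n + rootSum n l) :=
    Or.inr ⟨q, rfl, l, hl, Or.inr rfl⟩
  obtain ⟨v₁, hv₁, hw₂, hweight₂⟩ := (hasPair_vO1 hr h hl).exists_listed hP hn2 hr hrn hone htwo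
  obtain ⟨v₂, hv₂, hw₁, hweight₁⟩ := (hasPair_vO2 hr h hl).exists_listed hP hn2 hr hrn htwo hone
  exact ⟨v₁, v₂, _, _, hv₁, hv₂, hw₁, hw₂, rfl, rfl, by rw [hweight₁, hv₁.2.2],
    by rw [hweight₂, hv₂.2.2]⟩

theorem nil_mem_J (a b : ℤ) : [] ∈ J 0 a b :=
  ⟨rfl, fun _ hx => absurd hx List.not_mem_nil, List.isChain_nil⟩

theorem rest_nil (a n : ℕ) : rest a n [] = interval a n := by
  simp [rest, pred]

theorem vO_zero_nil (n : ℕ) : vO n 0 [] = vLast n := by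
  simp [vO, vLast, rest_nil, pred, neg]

theorem wO_zero_nil (n : ℕ) : wO n 0 [] = wLast n := by
  simp [wO, wLast, rest_nil, pred, neg]

theorem matched_vLast (hn : 3 ≤ n) :
    Matched n n (vLast n) (oddEnd n) (s 1 * s 2) (wLast n) := by
  have := matched_vO hn hn le_rfl (m := 0) rfl (nil_mem_J 4 n)
  rwa [vO_zero_nil, wO_zero_nil, rootSum_nil, add_zero, word, List.map_nil, List.prod_nil,
    mul_one] at this

theorem oneLine_of_isMinimalNonpos_last (hn : 3 ≤ n) (hu : IsMinimalNonpos n n u) :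
    oneLine n u = wLast n := by
  rcases oneLine_of_isMinimalNonpos_odd hn hn le_rfl (m := 0) rfl hu with
    ⟨l, hl, hline⟩ | ⟨q, hq, -⟩
  · rw [hline, List.eq_nil_of_length_eq_zero hl.1, wO_zero_nil]
  · exact absurd hq q.succ_ne_zero

end Classification

end TypeD

theorem proposition5p3 (n : ℕ) (hn : 3 ≤ n) :
    -- (i) `r = 1`
    (∃ w, oneLine n w = wOne n ∧ ∀ u, IsMinimalNonpos n 1 u ↔ u = w) ∧
    -- (ii) `r = 2`
    (∃ w, oneLine n w = wTwo n ∧ ∀ u, IsMinimalNonpos n 2 u ↔ u = w) ∧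
    -- (iii) `3 ≤ r ≤ n - 1` and `n + 1 - r = 2 m`
    (∀ r m : ℕ, 3 ≤ r → r + 1 ≤ n → n + 1 = r + 2 * m →
      (∀ i ∈ J m 3 n,
        Matched n r (vE n m i) (rootSum n i) (word i) (wE n m i)) ∧
      (∀ i ∈ J (m - 1) 4 n,
        Matched n r (vE1 n m i) (simpleRoot n 1 + rootSum n i) (s 1 * word i) (wE1 n m i)) ∧
      (∀ i ∈ J (m - 1) 4 n,
        Matched n r (vE2 n m i) (simpleRoot n 2 + rootSum n i) (s 2 * word i) (wE2 n m i)) ∧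
      ∀ u, IsMinimalNonpos n r u →
        (∃ i ∈ J m 3 n, oneLine n u = wE n m i) ∨
        (∃ i ∈ J (m - 1) 4 n, oneLine n u = wE1 n m i ∨ oneLine n u = wE2 n m i)) ∧
    -- (iv) `3 ≤ r ≤ n - 1` and `n + 1 - r = 2 m + 1`
    (∀ r m : ℕ, 3 ≤ r → r + 1 ≤ n → n + 1 = r + (2 * m + 1) →
      (∀ i ∈ J m 4 n,
        Matched n r (vO n m i)
          ((1 / 2 : ℝ) • simpleRoot n 1 + (1 / 2 : ℝ) • simpleRoot n 2 + rootSum n i)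
          (s 1 * s 2 * word i) (wO n m i)) ∧
      (∀ i ∈ J (m - 1) 5 n, ∃ v₁ v₂ w₁ w₂ : Equiv.Perm ℤ,
        ListedMax n r (vO1 n m i)
          ((3 / 2 : ℝ) • simpleRoot n 1 + (1 / 2 : ℝ) • simpleRoot n 2 + simpleRoot n 3
            + rootSum n i) v₁ ∧
        ListedMax n r (vO2 n m i)
          ((1 / 2 : ℝ) • simpleRoot n 1 + (3 / 2 : ℝ) • simpleRoot n 2 + simpleRoot n 3
            + rootSum n i) v₂ ∧
        ListedMin n r (wO1 n m i) w₁ ∧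
        ListedMin n r (wO2 n m i) w₂ ∧
        w₂ = s 2 * s 3 * s 1 * word i * v₁ ∧
        w₁ = s 1 * s 3 * s 2 * word i * v₂ ∧
        act n w₁ (fundWeight n r) = -act n v₁ (fundWeight n r) ∧
        act n w₂ (fundWeight n r) = -act n v₂ (fundWeight n r)) ∧
      ∀ u, IsMinimalNonpos n r u →
        (∃ i ∈ J m 4 n, oneLine n u = wO n m i) ∨
        (∃ i ∈ J (m - 1) 5 n, oneLine n u = wO1 n m i ∨ oneLine n u = wO2 n m i)) ∧
    -- (v) `r = n`
    (Matched n n (vLast n) ((1 / 2 : ℝ) • simpleRoot n 1 + (1 / 2 : ℝ) • simpleRoot n 2)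
        (s 1 * s 2) (wLast n) ∧
      ∀ u, IsMinimalNonpos n n u → oneLine n u = wLast n) := by
  refine ⟨exists_isMinimalNonpos_one hn, exists_isMinimalNonpos_two hn, ?_, ?_, matched_vLast hn,
    fun u hu => oneLine_of_isMinimalNonpos_last hn hu⟩
  · intro r m hr hr' h
    have hrn := Nat.le_of_succ_le hr'
    obtain ⟨q, rfl⟩ : ∃ q, m = q + 1 := ⟨m - 1, by omega⟩
    exact ⟨fun i hi => matched_vE hn hr hrn h hi, fun i hi => matched_vE1 hn hr hrn h hi,
      fun i hi => matched_vE2 hn hr hrn h hi,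
      fun u hu => oneLine_of_isMinimalNonpos_even hn hr hrn h hu⟩
  · intro r m hr hr' h
    have hrn := Nat.le_of_succ_le hr'
    obtain ⟨q, rfl⟩ : ∃ q, m = q + 1 := ⟨m - 1, by omega⟩
    refine ⟨fun i hi => matched_vO hn hr hrn h hi,
      fun i hi => exists_listed_vO1_vO2 hn hr hrn h hi, fun u hu => ?_⟩
    refine (oneLine_of_isMinimalNonpos_odd hn hr hrn h hu).imp_right ?_
    rintro ⟨q', hq', hline⟩
    obtain rfl := Nat.succ_injective hq'
    exact hline
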